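/- Let $\eta$ be the Dedekind eta function, $\zeta_n=e^{2\pi i/n}$, $q=e^{2\pi i\tau}$, $\operatorname{Im}\tau>0$, and let non-integral powers of $-i\tau$ be principal. Let $A$ be the Cartan matrix of $D_5$ (nodes $4,5$ both joined to node $3$), $M$ the root lattice, $M^*\cong\mathbf Z^5$ the weight lattice in the basis of fundamental weights. The level $4$ $D_5$ theta function of weight $\beta\in M^*$ is $$\theta^\beta(\tau)=\sum_{m\in\mathbf Z^5}q^{\frac42\,{}^t(m+\frac14A^{-1}\beta)A(m+\frac14A^{-1}\beta)}$$ (an absolutely convergent series). For $ad=4$, $0\le b<d$ put $\Theta^{d,b}_{D_5}(\tau)=\eta(\tau)^6/\eta(\frac{a\tau+b}d)$, and similarly $\Theta^{d,b}_{A_3}(\tau)=\eta(\tau)^4/\eta(\frac{a\tau+b}d)$. (1) The group generated by the Weyl group of $D_5$ and $-1$ has exactly $39$ orbits on $M^*/4M$; $\theta^\beta$ depends only on the orbit of $\beta$; and a complete system of representatives is given by the weights $\lambda_n^{(k)}=k\lambda_n$ (with $k=1$ where no $k$ is listed), where $\lambda_0=(0,0,0,0,0)$; $\lambda_1=(1,0,0,0,0)$,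 $k=1,2,3,4$; $\lambda_2=(0,1,0,0,0)$, $k=1,2$; $\lambda_3=(1,1,0,0,0)$; $\lambda_4=(2,1,0,0,0)$; $\lambda_5=(0,0,1,0,0)$, $k=1,2$; $\lambda_6=(1,0,1,0,0)$; $\lambda_7=(2,0,1,0,0)$; $\lambda_8=(0,1,1,0,0)$; $\lambda_9=(0,0,0,1,1)$, $k=1,2$; $\lambda_{10}=(1,0,0,1,1)$; $\lambda_{11}=(2,0,0,1,1)$; $\lambda_{12}=(0,1,0,1,1)$; $\lambda_{13}=(0,0,1,1,1)$; $\lambda_{14}=(0,0,0,1,0)$, $k=1,2,3,4$; $\lambda_{15}=(1,0,0,1,0)$, $k=1,2$; $\lambda_{16}=(2,0,0,1,0)$, $k=1,3$; $\lambda_{17}=(3,0,0,1,0)$; $\lambda_{18}=(1,0,0,3,0)$; $\lambda_{19}=(0,1,0,1,0)$; $\lambda_{20}=(1,1,0,1,0)$; $\lambda_{21}=(3,2,0,3,0)$; $\lambda_{22}=(0,0,1,1,0)$; $\lambda_{23}=(1,0,1,1,0)$; $\lambda_{25}=(1,0,0,2,0)$; $\lambda_{26}=(1,0,0,4,0)$;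 $\lambda_{27}=(0,1,0,2,0)$; $\lambda_{28}=(0,0,1,2,0)$. (2) Write $x_n^{(k)}=\theta^{\lambda_n^{(k)}}(\tau)$ and $x_n=x_n^{(1)}$. For all $ad=4$, $0\le b<d$ one has $(\Theta^{d,b}_{D_5}(\tau))^3=(\tilde\Theta^{d,b}_{D_5}(\tau))^3$, where the right-hand sides denote the following cubic polynomials in level $4$ $D_5$ theta functions: $$\begin{aligned}(\tilde\Theta^{1,0}_{D_5})^3&=8x_{0}x_{2}^{(2)}x_{4}-64x_{5}^{(2)}x_{13}x_{26}+128x_{5}^{(2)}x_{0}x_{6}-64x_{15}^{(2)}x_{1}^{(3)}x_{9}^{(1)}+80x_{1}^{(2)}x_{5}^{(1)}x_{27}-96x_{1}^{(2)}x_{14}^{(2)}x_{1}^{(1)}\\ &\quad -16x_{2}^{(2)}x_{28}x_{14}^{(4)}-24x_{1}^{(4)}x_{2}^{(2)}x_{4}-2x_{0}x_{1}^{(1)}x_{1}^{(3)}+64x_{15}^{(2)}x_{4}x_{27}+192x_{5}^{(2)}x_{14}^{(2)}x_{1}^{(1)}-x_{1}^{(4)}x_{0}x_{2}^{(1)}\\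 &\quad +32x_{2}^{(2)}x_{26}x_{1}^{(3)}+64x_{15}^{(2)}x_{2}^{(1)}x_{7}+8x_{0}x_{7}x_{10}+64x_{1}^{(2)}x_{9}^{(1)}x_{2}^{(1)}-24x_{1}^{(2)}x_{0}x_{6}-192x_{5}^{(2)}x_{3}x_{1}^{(1)}\\ &\quad +4x_{1}^{(4)}x_{26}x_{1}^{(3)}+136x_{1}^{(2)}x_{3}x_{1}^{(1)}+48x_{1}^{(4)}x_{6}x_{11}-16x_{0}x_{6}x_{11}-128x_{5}^{(2)}x_{9}^{(1)}x_{12}+4x_{0}x_{26}x_{1}^{(3)}\\ &\quad -56x_{1}^{(4)}x_{7}x_{10}+2x_{1}^{(4)}x_{1}^{(1)}x_{1}^{(3)}+192x_{5}^{(2)}x_{15}^{(2)}x_{26}-16x_{1}^{(2)}x_{9}^{(1)}x_{12}-64x_{15}^{(2)}x_{26}x_{11}-96x_{1}^{(2)}x_{15}^{(2)}x_{26}\\ &\quad +32x_{1}^{(2)}x_{13}x_{26}+64x_{15}^{(2)}x_{7}x_{4}-128x_{5}^{(2)}x_{9}^{(1)}x_{2}^{(1)}-64x_{15}^{(2)}x_{5}^{(1)}x_{4}+x_{0}x_{1}^{(4)}x_{4}-(x_{1}^{(4)})^2x_{4}\\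 &\quad -16x_{2}^{(2)}(x_{1}^{(1)})^2+x_{0}^2x_{2}^{(1)}-4x_{0}x_{3}^2+28x_{1}^{(4)}x_{3}^2-60(x_{1}^{(2)})^2x_{2}^{(1)}-20x_{4}(x_{1}^{(2)})^2,\\ (\tilde\Theta^{2,0}_{D_5})^3&=x_{1}^{(2)}x_{1}^{(4)}x_{1}^{(1)}+x_{1}^{(2)}x_{0}x_{1}^{(1)}+x_{1}^{(2)}x_{0}x_{1}^{(3)}+4x_{1}^{(2)}x_{1}^{(3)}x_{2}^{(2)}+x_{1}^{(2)}x_{1}^{(4)}x_{1}^{(3)}-48x_{1}^{(2)}x_{28}x_{27}\\ &\quad -48x_{1}^{(2)}x_{28}x_{5}^{(1)}-56x_{5}^{(2)}x_{11}x_{14}^{(2)}-56x_{5}^{(2)}x_{9}^{(1)}x_{14}^{(2)}-96x_{15}^{(2)}x_{6}x_{4}-96x_{15}^{(2)}x_{14}^{(2)}x_{7}+192x_{15}^{(2)}x_{14}^{(2)}x_{5}^{(1)}\\ &\quad +96x_{15}^{(2)}x_{14}^{(2)}x_{27}+192x_{15}^{(2)}x_{1}^{(3)}x_{10}+128x_{1}^{(2)}x_{11}x_{14}^{(2)}-144x_{1}^{(2)}x_{6}x_{5}^{(1)}+128x_{1}^{(2)}x_{9}^{(1)}x_{14}^{(2)}+16x_{5}^{(2)}x_{28}x_{27}\\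 &\quad +80x_{5}^{(2)}x_{6}x_{5}^{(1)}+16x_{5}^{(2)}x_{28}x_{5}^{(1)}+8x_{14}^{(4)}x_{6}x_{5}^{(1)}-8x_{14}^{(4)}x_{28}x_{27}-24x_{1}^{(2)}x_{6}x_{7}-96x_{15}^{(2)}x_{11}^2\\ &\quad -192x_{15}^{(2)}(x_{9}^{(1)})^2,\\ (\tilde\Theta^{2,1}_{D_5})^3&=\zeta_{16}^{-1}\bigl((x_{1}^{(1)})^2x_{5}^{(1)}+7(x_{1}^{(1)})^2x_{7}-10x_{1}^{(1)}x_{1}^{(3)}x_{5}^{(1)}-6x_{1}^{(1)}x_{1}^{(3)}x_{7}+9(x_{1}^{(3)})^2x_{5}^{(1)}-(x_{1}^{(3)})^2x_{7}-32x_{5}^{(1)}(x_{14}^{(2)})^2-32x_{7}x_{14}^{(2)}x_{15}^{(2)}+64x_{9}^{(1)}x_{11}x_{14}^{(2)}\bigr),\\ (\tilde\Theta^{4,b}_{D_5})^3&=\zeta_4^{-3b}\zeta_{32}^{23b}\bigl(G_0+\zeta_4^{b}G_1+\zeta_4^{2b}G_2+\zeta_4^{3b}G_3\bigr)\qquad(b=0,1,2,3),\end{aligned}$$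 with $$\begin{aligned}G_0&=1729(x_{16}^{(3)})^2x_{14}^{(3)}-215x_{20}^2x_{23}+(x_{14}^{(1)})^2x_{15}^{(1)}-904x_{20}x_{23}x_{16}^{(3)}-1265x_{21}^2x_{23}+3x_{17}^2x_{15}^{(1)}\\ &\quad +3x_{22}(x_{14}^{(3)})^2+33x_{22}(x_{15}^{(1)})^2+1149x_{22}x_{21}x_{20}-297x_{22}x_{15}^{(1)}x_{14}^{(3)}-1742x_{18}x_{23}x_{14}^{(3)}+119x_{17}x_{21}x_{23}\\ &\quad -82x_{19}x_{17}x_{23}+26x_{19}x_{17}x_{15}^{(1)}+22x_{18}x_{21}x_{16}^{(3)}+1329x_{18}x_{21}x_{20}+85x_{22}(x_{16}^{(1)})^2+6(x_{16}^{(1)})^3,\\ G_1&=9x_{21}^3+x_{18}^2x_{16}^{(3)}+3x_{21}x_{18}x_{14}^{(3)}+321x_{19}x_{22}x_{14}^{(3)}+747x_{22}x_{18}x_{20}+60x_{16}^{(1)}x_{22}x_{14}^{(1)}\\ &\quad -428x_{16}^{(1)}x_{22}x_{16}^{(3)}-9x_{16}^{(3)}(x_{15}^{(1)})^2+70x_{20}x_{23}^2+3x_{19}(x_{14}^{(1)})^2+100x_{22}x_{18}x_{14}^{(1)}+4x_{17}x_{20}^2\\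 &\quad +10x_{16}^{(3)}x_{23}^2+23x_{21}(x_{16}^{(3)})^2-1042x_{22}^2x_{16}^{(3)}+100x_{21}^2x_{17}-43(x_{16}^{(1)})^2x_{16}^{(3)}+9x_{17}^2x_{19}\\ &\quad +62x_{19}^2x_{21},\\ G_2&=x_{16}^{(1)}x_{17}^2-41x_{17}x_{18}x_{21}+33x_{21}x_{17}x_{16}^{(1)}-50x_{21}x_{20}x_{23}-48x_{21}x_{16}^{(3)}x_{23}-51x_{21}x_{16}^{(3)}x_{14}^{(3)}\\ &\quad +30x_{22}x_{14}^{(1)}x_{16}^{(3)}+3x_{22}x_{14}^{(1)}x_{20}+23x_{17}x_{14}^{(1)}x_{23}-107x_{19}x_{20}x_{23}+3x_{17}x_{14}^{(1)}x_{15}^{(1)}-6x_{17}x_{16}^{(3)}x_{14}^{(3)}\\ &\quad +19x_{18}x_{20}x_{16}^{(3)}+9x_{22}(x_{14}^{(1)})^2+140x_{23}^2x_{14}^{(3)}+60x_{23}(x_{14}^{(3)})^2+45x_{16}^{(1)}(x_{16}^{(3)})^2-47x_{15}^{(1)}(x_{14}^{(3)})^2\\ &\quad +3x_{18}(x_{16}^{(3)})^2-19(x_{15}^{(1)})^2x_{14}^{(3)},\\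 G_3&=x_{21}(x_{14}^{(3)})^2-28x_{21}x_{19}x_{16}^{(3)}-18x_{19}x_{15}^{(1)}x_{14}^{(3)}-17x_{18}x_{20}x_{14}^{(3)}+61x_{18}x_{20}x_{23}-7x_{18}x_{14}^{(1)}x_{14}^{(3)}\\ &\quad +13x_{22}x_{14}^{(1)}x_{15}^{(1)}+160x_{22}x_{16}^{(3)}x_{14}^{(3)}-75x_{22}x_{16}^{(3)}x_{15}^{(1)}+3x_{18}x_{16}^{(3)}x_{14}^{(3)}+9x_{18}x_{16}^{(3)}x_{23}+4x_{16}^{(1)}x_{14}^{(1)}x_{14}^{(3)}\\ &\quad +9x_{16}^{(1)}x_{14}^{(1)}x_{15}^{(1)}+17x_{16}^{(1)}x_{16}^{(3)}x_{14}^{(3)}-3x_{16}^{(1)}x_{20}x_{14}^{(3)}-7x_{17}(x_{14}^{(3)})^2-56x_{17}x_{23}^2+3x_{17}(x_{16}^{(1)})^2\\ &\quad +47x_{19}(x_{16}^{(1)})^2+4x_{17}^2x_{16}^{(3)}-120x_{21}^2x_{16}^{(3)}.\end{aligned}$$ (3) These cubic polynomials satisfy $$\begin{aligned}(\tilde\Theta^{1,0}_{D_5}(-\tfrac1\tau))^3&=(-i\tau)^{15/2}\,2^3\,(\tilde\Theta^{4,0}_{D_5}(\tau))^3,&(\tilde\Theta^{2,0}_{D_5}(-\tfrac1\tau))^3&=(-i\tau)^{15/2}(\tilde\Theta^{2,0}_{D_5}(\tau))^3,\\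 (\tilde\Theta^{2,1}_{D_5}(-\tfrac1\tau))^3&=(-i\tau)^{15/2}\,2\sqrt2\,(\tilde\Theta^{4,2}_{D_5}(\tau))^3,&(\tilde\Theta^{4,1}_{D_5}(-\tfrac1\tau))^3&=(-i\tau)^{15/2}\,\zeta_4\,(\tilde\Theta^{4,3}_{D_5}(\tau))^3.\end{aligned}$$ The cubes $(\Theta^{d,b}_{D_5})^3$ satisfy the same four laws, and so do the cubes $(\Theta^{d,b}_{A_3})^3$, with $(-i\tau)^{9/2}$ in place of $(-i\tau)^{15/2}$. -/

import Mathlib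

noncomputable section

/-! ### Weights of `D₅` and orbits modulo four times the root lattice

A weight `β ∈ M*` of `D₅` is given by its coordinates `β = (b₁, …, b₅)` in the basis of fundamental
weights.  In these coordinates the simple root `αᵢ` is the `i`-th row of the Cartan matrix. -/

/-- The weight lattice `M*` of `D₅`, in the basis of fundamental weights. -/
abbrev WeightD5 : Type := Fin 5 → ℤ

/-- The simple root `αᵢ` of `D₅`, in the basis of fundamental weights. -/
def simpleRootD5 (i : Fin 5) : WeightD5 := fun j => CartanMatrix.D 5 i j

/-- The simple reflection `sᵢ β = β - bᵢ αᵢ`. -/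
def reflectD5 (i : Fin 5) (β : WeightD5) : WeightD5 := β - β i • simpleRootD5 i

theorem reflectD5_involutive (i : Fin 5) : Function.Involutive (reflectD5 i) := by
  intro β
  have h : simpleRootD5 i i = 2 := by simp [simpleRootD5, CartanMatrix.D]
  funext j
  simp only [reflectD5, Pi.sub_apply, Pi.smul_apply, smul_eq_mul, h]
  ring

/-- The Weyl group of `D₅`, as a group of permutations of `M*`. -/
def weylD5 : Subgroup (Equiv.Perm WeightD5) :=
  Subgroup.closure (Set.range fun i => (reflectD5_involutive i).toPerm (reflectD5 i))

/-- The group of the translations of `M*` by the elements of `4 M`, with `M` the root lattice. -/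
def translationsD5 : Subgroup (Equiv.Perm WeightD5) :=
  Subgroup.closure (Set.range fun i => Equiv.addRight ((4 : ℤ) • simpleRootD5 i))

/-- The group generated by the Weyl group, `β ↦ -β` and the translations by `4 M`.  Its orbits on
`M*` are the orbits of the group generated by the Weyl group and `-1` on `M* / 4 M`. -/
def symmetryD5 : Subgroup (Equiv.Perm WeightD5) :=
  weylD5 ⊔ Subgroup.closure {Equiv.neg WeightD5} ⊔ translationsD5

/-- The primitive weights `λ₀, …, λ₂₈` (the index `24` is not used). -/
def baseWeightD5 : ℕ → WeightD5
  | 1 => ![1, 0, 0, 0, 0]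
  | 2 => ![0, 1, 0, 0, 0]
  | 3 => ![1, 1, 0, 0, 0]
  | 4 => ![2, 1, 0, 0, 0]
  | 5 => ![0, 0, 1, 0, 0]
  | 6 => ![1, 0, 1, 0, 0]
  | 7 => ![2, 0, 1, 0, 0]
  | 8 => ![0, 1, 1, 0, 0]
  | 9 => ![0, 0, 0, 1, 1]
  | 10 => ![1, 0, 0, 1, 1]
  | 11 => ![2, 0, 0, 1, 1]
  | 12 => ![0, 1, 0, 1, 1]
  | 13 => ![0, 0, 1, 1, 1]
  | 14 => ![0, 0, 0, 1, 0]
  | 15 => ![1, 0, 0, 1, 0]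
  | 16 => ![2, 0, 0, 1, 0]
  | 17 => ![3, 0, 0, 1, 0]
  | 18 => ![1, 0, 0, 3, 0]
  | 19 => ![0, 1, 0, 1, 0]
  | 20 => ![1, 1, 0, 1, 0]
  | 21 => ![3, 2, 0, 3, 0]
  | 22 => ![0, 0, 1, 1, 0]
  | 23 => ![1, 0, 1, 1, 0]
  | 25 => ![1, 0, 0, 2, 0]
  | 26 => ![1, 0, 0, 4, 0]
  | 27 => ![0, 1, 0, 2, 0]
  | 28 => ![0, 0, 1, 2, 0]
  | _ => 0

/-- The weight `λₙᵏ`, the `k`-fold multiple of `λₙ`; for `k = 1` it is `λₙ` itself. -/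
def lamD5 (n k : ℕ) : WeightD5 := k • baseWeightD5 n

/-- The indices `(n, k)` of the 39 representatives `λₙᵏ` of the orbits. -/
def orbitIndicesD5 : Finset (ℕ × ℕ) :=
  {(0, 1), (1, 1), (1, 2), (1, 3), (1, 4), (2, 1), (2, 2), (3, 1), (4, 1), (5, 1), (5, 2), (6, 1),
    (7, 1), (8, 1), (9, 1), (9, 2), (10, 1), (11, 1), (12, 1), (13, 1), (14, 1), (14, 2), (14, 3),
    (14, 4), (15, 1), (15, 2), (16, 1), (16, 3), (17, 1), (18, 1), (19, 1), (20, 1), (21, 1),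
    (22, 1), (23, 1), (25, 1), (26, 1), (27, 1), (28, 1)}

/-! ### Level 4 theta functions of `D₅` -/

/-- The Cartan matrix of `D₅` with real entries. -/
def cartanD5 : Matrix (Fin 5) (Fin 5) ℝ := (CartanMatrix.D 5).map (Int.cast : ℤ → ℝ)

/-- The vector `m + (1/4) A⁻¹ β`, with `A` the Cartan matrix of `D₅`. -/
def shiftedD5 (β : WeightD5) (m : Fin 5 → ℤ) : Fin 5 → ℝ :=
  fun i => (m i : ℝ) + (1 / 4 : ℝ) * (cartanD5⁻¹.mulVec fun j => (β j : ℝ)) i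

/-- The term `q ^ ((4/2) ᵗv A v)` with `v = m + (1/4) A⁻¹ β` and `q = exp (2πiτ)`. -/
def thetaTermD5 (β : WeightD5) (τ : ℂ) (m : Fin 5 → ℤ) : ℂ :=
  Complex.exp (2 * Real.pi * Complex.I * τ *
    (((4 / 2 : ℝ) * (shiftedD5 β m ⬝ᵥ cartanD5.mulVec (shiftedD5 β m)) : ℝ) : ℂ))

/-- The level 4 theta function of `D₅` with weight `β`. -/
def thetaD5 (β : WeightD5) (τ : ℂ) : ℂ := ∑' m : Fin 5 → ℤ, thetaTermD5 β τ m

/-! ### The cubic forms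

The variable `x n k` stands for the theta function of the weight `λₙᵏ`. -/

/-- The cubic form for `(d, b) = (1, 0)`. -/
def polyD5One (x : ℕ → ℕ → ℂ) : ℂ :=
  8 * x 0 1 * x 2 2 * x 4 1 - 64 * x 5 2 * x 13 1 * x 26 1 + 128 * x 5 2 * x 0 1 * x 6 1
    - 64 * x 15 2 * x 1 3 * x 9 1 + 80 * x 1 2 * x 5 1 * x 27 1 - 96 * x 1 2 * x 14 2 * x 1 1
    - 16 * x 2 2 * x 28 1 * x 14 4 - 24 * x 1 4 * x 2 2 * x 4 1 - 2 * x 0 1 * x 1 1 * x 1 3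
    + 64 * x 15 2 * x 4 1 * x 27 1 + 192 * x 5 2 * x 14 2 * x 1 1 - x 1 4 * x 0 1 * x 2 1
    + 32 * x 2 2 * x 26 1 * x 1 3 + 64 * x 15 2 * x 2 1 * x 7 1 + 8 * x 0 1 * x 7 1 * x 10 1
    + 64 * x 1 2 * x 9 1 * x 2 1 - 24 * x 1 2 * x 0 1 * x 6 1 - 192 * x 5 2 * x 3 1 * x 1 1
    + 4 * x 1 4 * x 26 1 * x 1 3 + 136 * x 1 2 * x 3 1 * x 1 1 + 48 * x 1 4 * x 6 1 * x 11 1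
    - 16 * x 0 1 * x 6 1 * x 11 1 - 128 * x 5 2 * x 9 1 * x 12 1 + 4 * x 0 1 * x 26 1 * x 1 3
    - 56 * x 1 4 * x 7 1 * x 10 1 + 2 * x 1 4 * x 1 1 * x 1 3 + 192 * x 5 2 * x 15 2 * x 26 1
    - 16 * x 1 2 * x 9 1 * x 12 1 - 64 * x 15 2 * x 26 1 * x 11 1 - 96 * x 1 2 * x 15 2 * x 26 1
    + 32 * x 1 2 * x 13 1 * x 26 1 + 64 * x 15 2 * x 7 1 * x 4 1 - 128 * x 5 2 * x 9 1 * x 2 1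
    - 64 * x 15 2 * x 5 1 * x 4 1 + x 0 1 * x 1 4 * x 4 1 - x 1 4 ^ 2 * x 4 1
    - 16 * x 2 2 * x 1 1 ^ 2 + x 0 1 ^ 2 * x 2 1 - 4 * x 0 1 * x 3 1 ^ 2
    + 28 * x 1 4 * x 3 1 ^ 2 - 60 * x 1 2 ^ 2 * x 2 1 - 20 * x 4 1 * x 1 2 ^ 2

/-- The cubic form for `(d, b) = (2, 0)`. -/
def polyD5TwoZero (x : ℕ → ℕ → ℂ) : ℂ :=
  x 1 2 * x 1 4 * x 1 1 + x 1 2 * x 0 1 * x 1 1 + x 1 2 * x 0 1 * x 1 3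
    + 4 * x 1 2 * x 1 3 * x 2 2 + x 1 2 * x 1 4 * x 1 3 - 48 * x 1 2 * x 28 1 * x 27 1
    - 48 * x 1 2 * x 28 1 * x 5 1 - 56 * x 5 2 * x 11 1 * x 14 2 - 56 * x 5 2 * x 9 1 * x 14 2
    - 96 * x 15 2 * x 6 1 * x 4 1 - 96 * x 15 2 * x 14 2 * x 7 1 + 192 * x 15 2 * x 14 2 * x 5 1
    + 96 * x 15 2 * x 14 2 * x 27 1 + 192 * x 15 2 * x 1 3 * x 10 1
    + 128 * x 1 2 * x 11 1 * x 14 2 - 144 * x 1 2 * x 6 1 * x 5 1 + 128 * x 1 2 * x 9 1 * x 14 2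
    + 16 * x 5 2 * x 28 1 * x 27 1 + 80 * x 5 2 * x 6 1 * x 5 1 + 16 * x 5 2 * x 28 1 * x 5 1
    + 8 * x 14 4 * x 6 1 * x 5 1 - 8 * x 14 4 * x 28 1 * x 27 1 - 24 * x 1 2 * x 6 1 * x 7 1
    - 96 * x 15 2 * x 11 1 ^ 2 - 192 * x 15 2 * x 9 1 ^ 2

/-- The cubic form for `(d, b) = (2, 1)`, up to the factor `ζ₁₆⁻¹`. -/
def polyD5TwoOne (x : ℕ → ℕ → ℂ) : ℂ :=
  x 1 1 ^ 2 * x 5 1 + 7 * x 1 1 ^ 2 * x 7 1 - 10 * x 1 1 * x 1 3 * x 5 1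
    - 6 * x 1 1 * x 1 3 * x 7 1 + 9 * x 1 3 ^ 2 * x 5 1 - x 1 3 ^ 2 * x 7 1
    - 32 * x 5 1 * x 14 2 ^ 2 - 32 * x 7 1 * x 14 2 * x 15 2 + 64 * x 9 1 * x 11 1 * x 14 2

/-- The part of the cubic forms for `d = 4` that carries `ζ₄ ^ (0 b)`. -/
def polyD5FourZero (x : ℕ → ℕ → ℂ) : ℂ :=
  1729 * x 16 3 ^ 2 * x 14 3 - 215 * x 20 1 ^ 2 * x 23 1 + x 14 1 ^ 2 * x 15 1
    - 904 * x 20 1 * x 23 1 * x 16 3 - 1265 * x 21 1 ^ 2 * x 23 1 + 3 * x 17 1 ^ 2 * x 15 1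
    + 3 * x 22 1 * x 14 3 ^ 2 + 33 * x 22 1 * x 15 1 ^ 2 + 1149 * x 22 1 * x 21 1 * x 20 1
    - 297 * x 22 1 * x 15 1 * x 14 3 - 1742 * x 18 1 * x 23 1 * x 14 3
    + 119 * x 17 1 * x 21 1 * x 23 1 - 82 * x 19 1 * x 17 1 * x 23 1
    + 26 * x 19 1 * x 17 1 * x 15 1 + 22 * x 18 1 * x 21 1 * x 16 3
    + 1329 * x 18 1 * x 21 1 * x 20 1 + 85 * x 22 1 * x 16 1 ^ 2 + 6 * x 16 1 ^ 3

/-- The part of the cubic forms for `d = 4` that carries `ζ₄ ^ (1 b)`. -/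
def polyD5FourOne (x : ℕ → ℕ → ℂ) : ℂ :=
  9 * x 21 1 ^ 3 + x 18 1 ^ 2 * x 16 3 + 3 * x 21 1 * x 18 1 * x 14 3
    + 321 * x 19 1 * x 22 1 * x 14 3 + 747 * x 22 1 * x 18 1 * x 20 1
    + 60 * x 16 1 * x 22 1 * x 14 1 - 428 * x 16 1 * x 22 1 * x 16 3 - 9 * x 16 3 * x 15 1 ^ 2
    + 70 * x 20 1 * x 23 1 ^ 2 + 3 * x 19 1 * x 14 1 ^ 2 + 100 * x 22 1 * x 18 1 * x 14 1
    + 4 * x 17 1 * x 20 1 ^ 2 + 10 * x 16 3 * x 23 1 ^ 2 + 23 * x 21 1 * x 16 3 ^ 2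
    - 1042 * x 22 1 ^ 2 * x 16 3 + 100 * x 21 1 ^ 2 * x 17 1 - 43 * x 16 1 ^ 2 * x 16 3
    + 9 * x 17 1 ^ 2 * x 19 1 + 62 * x 19 1 ^ 2 * x 21 1

/-- The part of the cubic forms for `d = 4` that carries `ζ₄ ^ (2 b)`. -/
def polyD5FourTwo (x : ℕ → ℕ → ℂ) : ℂ :=
  x 16 1 * x 17 1 ^ 2 - 41 * x 17 1 * x 18 1 * x 21 1 + 33 * x 21 1 * x 17 1 * x 16 1
    - 50 * x 21 1 * x 20 1 * x 23 1 - 48 * x 21 1 * x 16 3 * x 23 1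
    - 51 * x 21 1 * x 16 3 * x 14 3 + 30 * x 22 1 * x 14 1 * x 16 3
    + 3 * x 22 1 * x 14 1 * x 20 1 + 23 * x 17 1 * x 14 1 * x 23 1
    - 107 * x 19 1 * x 20 1 * x 23 1 + 3 * x 17 1 * x 14 1 * x 15 1
    - 6 * x 17 1 * x 16 3 * x 14 3 + 19 * x 18 1 * x 20 1 * x 16 3 + 9 * x 22 1 * x 14 1 ^ 2
    + 140 * x 23 1 ^ 2 * x 14 3 + 60 * x 23 1 * x 14 3 ^ 2 + 45 * x 16 1 * x 16 3 ^ 2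
    - 47 * x 15 1 * x 14 3 ^ 2 + 3 * x 18 1 * x 16 3 ^ 2 - 19 * x 15 1 ^ 2 * x 14 3

/-- The part of the cubic forms for `d = 4` that carries `ζ₄ ^ (3 b)`. -/
def polyD5FourThree (x : ℕ → ℕ → ℂ) : ℂ :=
  x 21 1 * x 14 3 ^ 2 - 28 * x 21 1 * x 19 1 * x 16 3 - 18 * x 19 1 * x 15 1 * x 14 3
    - 17 * x 18 1 * x 20 1 * x 14 3 + 61 * x 18 1 * x 20 1 * x 23 1
    - 7 * x 18 1 * x 14 1 * x 14 3 + 13 * x 22 1 * x 14 1 * x 15 1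
    + 160 * x 22 1 * x 16 3 * x 14 3 - 75 * x 22 1 * x 16 3 * x 15 1
    + 3 * x 18 1 * x 16 3 * x 14 3 + 9 * x 18 1 * x 16 3 * x 23 1 + 4 * x 16 1 * x 14 1 * x 14 3
    + 9 * x 16 1 * x 14 1 * x 15 1 + 17 * x 16 1 * x 16 3 * x 14 3
    - 3 * x 16 1 * x 20 1 * x 14 3 - 7 * x 17 1 * x 14 3 ^ 2 - 56 * x 17 1 * x 23 1 ^ 2
    + 3 * x 17 1 * x 16 1 ^ 2 + 47 * x 19 1 * x 16 1 ^ 2 + 4 * x 17 1 ^ 2 * x 16 3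
    - 120 * x 21 1 ^ 2 * x 16 3

/-- `ζₙ = exp (2πi/n)`. -/
def zetaRoot (n : ℕ) : ℂ := Complex.exp (2 * Real.pi * Complex.I / n)

/-- The function of `τ` that is given by the explicit cubic form in level 4 theta functions of `D₅`
with index `(d, b)`, for `d = 1, 2, 4` and `0 ≤ b < d`. -/
def cubeThetaTildeD5 (d b : ℕ) (τ : ℂ) : ℂ :=
  let x : ℕ → ℕ → ℂ := fun n k => thetaD5 (lamD5 n k) τ
  match d, b with
  | 1, _ => polyD5One x
  | 2, 0 => polyD5TwoZero x
  | 2, _ => (zetaRoot 16)⁻¹ * polyD5TwoOne x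
  | 4, b => zetaRoot 4 ^ (-(3 * b : ℤ)) * zetaRoot 32 ^ (23 * b) *
      (polyD5FourZero x + zetaRoot 4 ^ b * polyD5FourOne x
        + zetaRoot 4 ^ (2 * b) * polyD5FourTwo x + zetaRoot 4 ^ (3 * b) * polyD5FourThree x)
  | _, _ => 0

/-! ### Eta quotients and the transformation `τ ↦ -1/τ` -/

/-- The eta quotient `η(τ) ^ (r + 1) / η((a τ + b) / d)` with `a = 4 / d`. -/
def etaQuotient (r d b : ℕ) (τ : ℂ) : ℂ :=
  ModularForm.eta τ ^ (r + 1) / ModularForm.eta (((4 / d : ℂ) * τ + b) / d)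

/-- The transformation laws under `τ ↦ -1/τ`, with the factor `(-iτ) ^ w`, of a family of functions
`F d b` on the upper half-plane. -/
def STransformationLaws (w : ℂ) (F : ℕ → ℕ → ℂ → ℂ) : Prop :=
  ∀ τ : ℂ, 0 < τ.im →
    F 1 0 (-1 / τ) = (-Complex.I * τ) ^ w * 2 ^ 3 * F 4 0 τ ∧
    F 2 0 (-1 / τ) = (-Complex.I * τ) ^ w * F 2 0 τ ∧
    F 2 1 (-1 / τ) = (-Complex.I * τ) ^ w * (2 * (Real.sqrt 2 : ℂ)) * F 4 2 τ ∧
    F 4 1 (-1 / τ) = (-Complex.I * τ) ^ w * zetaRoot 4 * F 4 3 τ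

end

/-! In orthonormal coordinates the root lattice of D₅ is the set of vectors in ℤ⁵ with even
coordinate sum. Inserting the projector (1 + (-1)^(∑ nᵢ)) / 2 turns θ^β into sums over ℤ⁵, which
factor: θ^β is half of ∏ f(cᵢ) + ∏ g(cᵢ), where c holds the doubled orthonormal coordinates of β,
f(k) = ∑ q^((8n+k)²/32) and g(k) = ∑ (-1)ⁿ q^((8n+k)²/32) (`thetaEight`, `hasSum_thetaTermD5`). Both
f and g are even, f has period 8 and g changes sign under a shift by 8; this alone gives the
invariance under the Weyl group, -1 and 4M (`IsThetaPair.weightForm_eq_of_mem_orbit`).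

The cubic forms thereby become polynomials in f(0), f(2), f(4), g(0), g(2) when d ≤ 2, and in f(1),
f(3), g(1), g(3) when d = 4. The product formula `thetaEight_mul`, a rotation of ℤ² by 45 degrees,
yields relations modulo which each polynomial collapses to a product (`polyD5One_weightForm` and its
companions). Gauss' identity for the triangular numbers gives f(2) = η(2τ)²/η(τ); the half-shift of
τ and the product formula then give g(2) and g(0), so all these products are eta quotients. For d =
4 this proves b = 0 only. The other b follow by τ ↦ τ + b, since the part Gⱼ is an eigenvector of τ
↦ τ + 1 with eigenvalue ζ₃₂^(23+8j).

The laws under τ ↦ -1/τ are consequences of η(-1/τ) = (-iτ)^(1/2) η(τ), with some care for branches,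
and pass to the cubic forms through the equality of cubes.

For the orbits, every weight is moved into the closed alcove of level four by a descent on the
distance to the Weyl vector, which leaves finitely many weights. The representatives are
inequivalent because the invariant ∏ f + ∏ g makes sense for any pair with the symmetries of (f, g),
and a suitable integer-valued pair takes 39 different values on them. -/

/-! ### Infinite products and Gauss' identity for the triangular numbers -/

open Filter Topology in
theorem tendsto_prod_one_sub_pow {x : ℂ} (hx : ‖x‖ < 1) :
    Tendsto (fun N => ∏ n ∈ Finset.range N, (1 - x ^ (n + 1))) atTop
      (𝓝 (∏' n : ℕ, (1 - x ^ (n + 1)))) :=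
  (ModularForm.multipliable_one_sub_pow hx).hasProd.tendsto_prod_nat

theorem one_sub_pow_succ_ne_zero {x : ℂ} (hx : ‖x‖ < 1) (n : ℕ) : 1 - x ^ (n + 1) ≠ 0 := by
  intro h
  have h1 : ‖x ^ (n + 1)‖ < 1 := by
    rw [norm_pow]; exact pow_lt_one₀ (norm_nonneg _) hx (Nat.succ_ne_zero n)
  rw [← sub_eq_zero.mp h] at h1
  simp at h1

theorem tprod_one_sub_pow_ne_zero {x : ℂ} (hx : ‖x‖ < 1) : ∏' n : ℕ, (1 - x ^ (n + 1)) ≠ 0 := by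
  have := tprod_one_add_ne_zero_of_summable (f := fun n : ℕ => -x ^ (n + 1))
    (fun n => by simpa [sub_eq_add_neg] using one_sub_pow_succ_ne_zero hx n) (by
      simpa using (summable_nat_add_iff 1).mpr (summable_geometric_of_lt_one (norm_nonneg _) hx))
  simpa only [sub_eq_add_neg] using this

/-- The finite products `∏ (1 - x ^ (2 k)) / (1 - x ^ (2 k - 1))` over `1 ≤ k ≤ n`. -/
noncomputable def gaussProd (x : ℂ) (n : ℕ) : ℂ :=
  ∏ k ∈ Finset.range n, (1 - x ^ (2 * k + 2)) / (1 - x ^ (2 * k + 1))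

theorem gaussProd_succ (x : ℂ) (n : ℕ) :
    gaussProd x (n + 1) = gaussProd x n * ((1 - x ^ (2 * n + 2)) / (1 - x ^ (2 * n + 1))) :=
  Finset.prod_range_succ _ _

theorem gaussProd_ne_zero {x : ℂ} (hx : ‖x‖ < 1) (n : ℕ) : gaussProd x n ≠ 0 :=
  Finset.prod_ne_zero_iff.mpr fun k _ => div_ne_zero
    (one_sub_pow_succ_ne_zero hx (2 * k + 1)) (one_sub_pow_succ_ne_zero hx (2 * k))

/-- Shanks' finite form of Gauss' identity for the triangular numbers. -/
theorem sum_gaussProd_div_eq {x : ℂ} (hx : ‖x‖ < 1) (n : ℕ) :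
    ∑ s ∈ Finset.range n, gaussProd x n / gaussProd x s * x ^ (s * (2 * n + 1))
      = ∑ j ∈ Finset.range (2 * n), x ^ (j * (j + 1) / 2) := by
  induction n with
  | zero => simp
  | succ n ih =>
    have hn : 1 - x ^ (2 * n + 1) ≠ 0 := one_sub_pow_succ_ne_zero hx (2 * n)
    have hP := gaussProd_ne_zero hx
    have e1 : (2 * n) * (2 * n + 1) / 2 = n * (2 * n + 1) := by
      rw [mul_assoc]; exact Nat.mul_div_cancel_left _ two_pos
    have e2 : (2 * n + 1) * (2 * n + 1 + 1) / 2 = (n + 1) * (2 * n + 1) := by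
      rw [show (2 * n + 1) * (2 * n + 1 + 1) = 2 * ((n + 1) * (2 * n + 1)) by ring]
      exact Nat.mul_div_cancel_left _ two_pos
    rw [show 2 * (n + 1) = 2 * n + 1 + 1 by ring, Finset.sum_range_succ (n := 2 * n + 1),
      Finset.sum_range_succ (n := 2 * n), ← ih, e1, e2]
    -- Passing from n to n + 1 changes the s-th summand by U (s + 1) - U s. As U 0 = 0, what remains
    -- is U n plus the new summand s = n, and this equals the two new triangular powers.
    let U : ℕ → ℂ := fun s =>
      gaussProd x n / (1 - x ^ (2 * n + 1)) * x ^ (s * (2 * n + 1)) * (1 - x ^ (2 * s))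
        / gaussProd x s
    have htel : ∀ s, gaussProd x (n + 1) / gaussProd x s * x ^ (s * (2 * n + 1 + 1 + 1))
        = gaussProd x n / gaussProd x s * x ^ (s * (2 * n + 1)) + (U (s + 1) - U s) := by
      intro s
      have hs : 1 - x ^ (2 * s + 1) ≠ 0 := one_sub_pow_succ_ne_zero hx (2 * s)
      have hs2 : 1 - x ^ (2 * s + 2) ≠ 0 := one_sub_pow_succ_ne_zero hx (2 * s + 1)
      simp only [U, gaussProd_succ]
      have := hP s
      have := hP n
      field_simp
      ring
    rw [Finset.sum_range_succ, Finset.sum_congr rfl fun s _ => htel s, Finset.sum_add_distrib,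
      Finset.sum_range_sub, gaussProd_succ, show U 0 = 0 by simp [U],
      sub_zero]
    simp only [add_assoc, add_right_inj]
    have := hP n
    simp only [U]
    field_simp
    ring

-- Multiplying numerator and denominator by the even factors makes the denominator the full product
-- up to 2n and squares the numerator.
open Filter Topology in
theorem tendsto_gaussProd {x : ℂ} (hx : ‖x‖ < 1) :
    Tendsto (gaussProd x) atTop
      (𝓝 ((∏' n : ℕ, (1 - (x ^ 2) ^ (n + 1))) ^ 2 / ∏' n : ℕ, (1 - x ^ (n + 1)))) := by
  have hx2 : ‖x ^ 2‖ < 1 := by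
    rw [norm_pow]; exact pow_lt_one₀ (norm_nonneg _) hx two_ne_zero
  have h1 := (tendsto_prod_one_sub_pow hx2).pow 2
  have h2 := (tendsto_prod_one_sub_pow hx).comp (tendsto_id.const_mul_atTop' (r := 2) two_pos)
  refine (h1.div h2 (tprod_one_sub_pow_ne_zero hx)).congr fun N => ?_
  simp only [Pi.div_apply, Function.comp, id]
  induction N with
  | zero => simp [gaussProd]
  | succ N ih =>
    rw [gaussProd_succ, ← ih, show 2 * (N + 1) = 2 * N + 1 + 1 by ring, Finset.prod_range_succ,
      Finset.prod_range_succ _ (2 * N + 1), Finset.prod_range_succ _ (2 * N)]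
    have h3 : ∏ n ∈ Finset.range (2 * N), (1 - x ^ (n + 1)) ≠ 0 :=
      Finset.prod_ne_zero_iff.mpr fun k _ => one_sub_pow_succ_ne_zero hx k
    have h4 := one_sub_pow_succ_ne_zero hx (2 * N)
    have h5 := one_sub_pow_succ_ne_zero hx (2 * N + 1)
    rw [← pow_mul, show 2 * (N + 1) = 2 * N + 1 + 1 by ring]
    field_simp

open Filter Topology in
/-- Gauss' product formula for the generating function of the triangular numbers. -/
theorem hasSum_pow_triangular {x : ℂ} (hx : ‖x‖ < 1) :
    HasSum (fun j : ℕ => x ^ (j * (j + 1) / 2))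
      ((∏' n : ℕ, (1 - (x ^ 2) ^ (n + 1))) ^ 2 / ∏' n : ℕ, (1 - x ^ (n + 1))) := by
  have hx2 : ‖x ^ 2‖ < 1 := by
    rw [norm_pow]; exact pow_lt_one₀ (norm_nonneg _) hx two_ne_zero
  have hP := tendsto_gaussProd hx
  have hl : (∏' n : ℕ, (1 - (x ^ 2) ^ (n + 1))) ^ 2 / ∏' n : ℕ, (1 - x ^ (n + 1)) ≠ 0 :=
    div_ne_zero (pow_ne_zero _ (tprod_one_sub_pow_ne_zero hx2)) (tprod_one_sub_pow_ne_zero hx)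
  set l := (∏' n : ℕ, (1 - (x ^ 2) ^ (n + 1))) ^ 2 / ∏' n : ℕ, (1 - x ^ (n + 1))
  -- The products converge to a nonzero limit, so they and their inverses are bounded.
  obtain ⟨C, hC⟩ := (hP.norm.isBoundedUnder_le).bddAbove_range
  obtain ⟨C', hC'⟩ := ((hP.inv₀ hl).norm.isBoundedUnder_le).bddAbove_range
  have hb (n : ℕ) : ‖gaussProd x n‖ ≤ C := hC ⟨n, rfl⟩
  have hb' (n : ℕ) : ‖(gaussProd x n)⁻¹‖ ≤ C' := hC' ⟨n, rfl⟩
  have hC0 : 0 ≤ C := (norm_nonneg _).trans (hb 0)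
  have hsum : Summable fun j : ℕ => x ^ (j * (j + 1) / 2) := by
    refine Summable.of_norm_bounded_eventually_nat (g := fun j => ‖x‖ ^ j)
      (summable_geometric_of_lt_one (norm_nonneg _) hx) ?_
    filter_upwards [eventually_ge_atTop 1] with j hj
    rw [norm_pow]
    refine pow_le_pow_of_le_one (norm_nonneg _) hx.le ?_
    rw [Nat.le_div_iff_mul_le two_pos]
    gcongr
    omega
  -- In Shanks' sum only s = 0 survives in the limit, and that summand is the product itself. Each
  -- of the other n summands is at most C C' ‖x‖ⁿ in norm.
  have hrest : Tendsto (fun n : ℕ => ∑ s ∈ Finset.range (n + 1),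
      gaussProd x (n + 1) / gaussProd x s * x ^ (s * (2 * (n + 1) + 1))) atTop (𝓝 l) := by
    have h0 : Tendsto (fun n : ℕ => ∑ s ∈ Finset.range n, gaussProd x (n + 1) / gaussProd x (s + 1)
        * x ^ ((s + 1) * (2 * (n + 1) + 1))) atTop (𝓝 0) := by
      have hg : Tendsto (fun n : ℕ => (C * C') * ((n : ℝ) * ‖x‖ ^ n)) atTop (𝓝 0) := by
        simpa using (tendsto_self_mul_const_pow_of_lt_one (norm_nonneg x) hx).const_mul (C * C')
      refine squeeze_zero_norm (fun n => ?_) hg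
      refine (norm_sum_le_of_le (f := _) _ (n := fun _ => C * C' * ‖x‖ ^ n) fun s _ => ?_).trans ?_
      · rw [norm_mul, div_eq_mul_inv, norm_mul, norm_pow]
        refine mul_le_mul (mul_le_mul (hb _) (hb' _) (norm_nonneg _) hC0) ?_ (by positivity)
          (mul_nonneg hC0 ((norm_nonneg _).trans (hb' 0)))
        refine pow_le_pow_of_le_one (norm_nonneg _) hx.le ?_
        nlinarith
      · rw [Finset.sum_const, Finset.card_range, nsmul_eq_mul]
        exact (by ring : _ = _).le
    have := h0.add (hP.comp (tendsto_add_atTop_nat 1))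
    rw [zero_add] at this
    refine this.congr fun n => ?_
    rw [Finset.sum_range_succ']
    simp [gaussProd]
  have hlim := hsum.hasSum.tendsto_sum_nat.comp
    ((tendsto_id.const_mul_atTop' (r := 2) two_pos).comp (tendsto_add_atTop_nat 1))
  have : ∑' j : ℕ, x ^ (j * (j + 1) / 2) = l :=
    tendsto_nhds_unique hlim (hrest.congr fun n => sum_gaussProd_div_eq hx (n + 1))
  rw [← this]
  exact hsum.hasSum

-- For odd n the factors of the first two products pair to 1 - x^(2n), and for even n they give the
-- square of ∏ (1 - x^(2n)). The third product supplies the factors 1 - x^(2n) with n even that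
-- complete a third copy. In the finite version the products in ±x run to 2N and the one in x⁴ to N.
open Filter Topology in
theorem tprod_one_sub_neg_pow {x : ℂ} (hx : ‖x‖ < 1) :
    (∏' n : ℕ, (1 - (-x) ^ (n + 1))) * (∏' n : ℕ, (1 - x ^ (n + 1)))
        * (∏' n : ℕ, (1 - (x ^ 4) ^ (n + 1))) = (∏' n : ℕ, (1 - (x ^ 2) ^ (n + 1))) ^ 3 := by
  have hx2 : ‖x ^ 2‖ < 1 := by
    rw [norm_pow]; exact pow_lt_one₀ (norm_nonneg _) hx two_ne_zero
  have hx4 : ‖x ^ 4‖ < 1 := by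
    rw [norm_pow]; exact pow_lt_one₀ (norm_nonneg _) hx four_ne_zero
  have hxn : ‖-x‖ < 1 := by rwa [norm_neg]
  have h2N : Tendsto (fun N : ℕ => 2 * N) atTop atTop := tendsto_id.const_mul_atTop' two_pos
  have hl := ((tendsto_prod_one_sub_pow hxn).comp h2N).mul
    ((tendsto_prod_one_sub_pow hx).comp h2N) |>.mul (tendsto_prod_one_sub_pow hx4)
  have hr := ((tendsto_prod_one_sub_pow hx2).pow 2).mul ((tendsto_prod_one_sub_pow hx2).comp h2N)
  rw [show (∏' n : ℕ, (1 - (x ^ 2) ^ (n + 1))) ^ 3 = (∏' n : ℕ, (1 - (x ^ 2) ^ (n + 1))) ^ 2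
    * ∏' n : ℕ, (1 - (x ^ 2) ^ (n + 1)) by ring]
  refine tendsto_nhds_unique hl (hr.congr fun N => ?_)
  simp only [Function.comp]
  induction N with
  | zero => simp
  | succ N ih =>
    rw [show 2 * (N + 1) = 2 * N + 1 + 1 by ring]
    simp only [Finset.prod_range_succ]
    have e1 : (-x) ^ (2 * N + 1) = -x ^ (2 * N + 1) := Odd.neg_pow ⟨N, rfl⟩ x
    have e2 : (-x) ^ (2 * N + 1 + 1) = x ^ (2 * N + 1 + 1) := Even.neg_pow ⟨N + 1, by ring⟩ x
    rw [e1, e2]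
    simp only [← pow_mul] at ih ⊢
    linear_combination (1 - x ^ (2 * (N + 1))) ^ 2 * (1 - x ^ (2 * (2 * N + 1)))
      * (1 - x ^ (2 * (2 * N + 1 + 1))) * ih

/-! ### Theta series in one variable -/

open Complex in
/-- The terms of the theta series `∑ εⁿ q ^ ((8 n + k)² / 32)`. -/
noncomputable def thetaEightTerm (ε : ℤˣ) (k : ℤ) (τ : ℂ) (n : ℤ) : ℂ :=
  ((ε ^ n : ℤˣ) : ℤ) * cexp (Real.pi * I * τ * ((8 * n + k) ^ 2 / 16))

/-- The theta series `∑ εⁿ q ^ ((8 n + k)² / 32)` in one variable. -/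
noncomputable def thetaEight (ε : ℤˣ) (k : ℤ) (τ : ℂ) : ℂ := ∑' n : ℤ, thetaEightTerm ε k τ n

theorem norm_int_unit_cast (u : ℤˣ) : ‖((u : ℤ) : ℂ)‖ = 1 := by
  rcases Int.units_eq_one_or u with rfl | rfl <;> simp

theorem neg_one_unit_zpow_cast (n : ℤ) : ((((-1) ^ n : ℤˣ) : ℤ) : ℂ) = (-1) ^ n := by
  rcases Int.even_or_odd n with h | h
  · simp [h.neg_one_zpow]
  · simp [h.neg_one_zpow]

theorem summable_norm_thetaEightTerm (ε : ℤˣ) (k : ℤ) {τ : ℂ} (hτ : 0 < τ.im) :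
    Summable fun n => ‖thetaEightTerm ε k τ n‖ := by
  -- Expanding (8n+k)²/16 = 4n² + nk + k²/16 identifies the term, up to a constant and a sign, with
  -- a Jacobi theta term at z = kτ/2 and modulus 4τ.
  have h := (((summable_jacobiTheta₂_term_iff (k * τ / 2) (4 * τ)).mpr (by simpa)).mul_left
    (Complex.exp (Real.pi * Complex.I * τ * (k ^ 2 / 16)))).norm
  refine h.congr fun n => ?_
  rw [thetaEightTerm, norm_mul _ (Complex.exp _), norm_int_unit_cast, one_mul, jacobiTheta₂_term,
    ← Complex.exp_add]
  congr 2
  ring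

theorem summable_thetaEightTerm (ε : ℤˣ) (k : ℤ) {τ : ℂ} (hτ : 0 < τ.im) :
    Summable (thetaEightTerm ε k τ) :=
  (summable_norm_thetaEightTerm ε k hτ).of_norm

theorem thetaEight_neg (ε : ℤˣ) (k : ℤ) (τ : ℂ) : thetaEight ε (-k) τ = thetaEight ε k τ := by
  rw [thetaEight, thetaEight, ← (Equiv.neg ℤ).tsum_eq]
  refine tsum_congr fun n => ?_
  simp only [thetaEightTerm, Equiv.neg_apply, zpow_neg, Int.units_inv_eq_self]
  congr 2
  push_cast
  ring

theorem thetaEight_add_eight (ε : ℤˣ) (k : ℤ) (τ : ℂ) :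
    thetaEight ε (k + 8) τ = (ε : ℤ) * thetaEight ε k τ := by
  rw [thetaEight, thetaEight, ← (Equiv.addRight (1 : ℤ)).tsum_eq (thetaEightTerm ε k τ),
    ← tsum_mul_left]
  refine tsum_congr fun n => ?_
  simp only [thetaEightTerm, Equiv.coe_addRight, zpow_add, zpow_one, ← mul_assoc, ← Int.cast_mul,
    ← Units.val_mul]
  rw [mul_comm ε, mul_assoc (ε ^ n), Int.units_mul_self, mul_one]
  congr 2
  push_cast
  ring

/-- The index 4 equals its own reflection 8 - 4, and the reflection changes the sign of the
alternating series. -/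
theorem thetaEight_neg_one_four (τ : ℂ) : thetaEight (-1) 4 τ = 0 := by
  have h := thetaEight_add_eight (-1) (-4) τ
  rw [thetaEight_neg, show (-4 + 8 : ℤ) = 4 by norm_num] at h
  push_cast at h
  linear_combination h / 2

/-- Pairs of integers, sorted by the parity of their sum. -/
def intPairParityEquiv : (ℤ × ℤ) ⊕ (ℤ × ℤ) ≃ ℤ × ℤ where
  toFun := Sum.elim (fun p => (p.1 + p.2, p.1 - p.2)) fun p => (p.1 + p.2 + 1, p.1 - p.2)
  invFun p := if (p.1 + p.2) % 2 = 0 then .inl ((p.1 + p.2) / 2, (p.1 - p.2) / 2)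
    else .inr ((p.1 + p.2) / 2, (p.1 - p.2) / 2)
  left_inv p := by
    rcases p with ⟨u, v⟩ | ⟨u, v⟩
    · have h : (u + v + (u - v)) % 2 = 0 := by omega
      simp only [Sum.elim_inl, h, if_true, Sum.inl.injEq, Prod.mk.injEq]
      omega
    · have h : ¬ (u + v + 1 + (u - v)) % 2 = 0 := by omega
      simp only [Sum.elim_inr, h, if_false, Sum.inr.injEq, Prod.mk.injEq]
      omega
  right_inv p := by
    obtain ⟨n, m⟩ := p
    by_cases h : (n + m) % 2 = 0
    · simp only [h, if_true, Sum.elim_inl, Prod.mk.injEq]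
      omega
    · simp only [h, if_false, Sum.elim_inr, Prod.mk.injEq]
      omega

/-- By (A + B)² + (A - B)² = 2 (A² + B²), the substitution n = u + v, m = u - v turns the double
series into a product of series at 2τ. It reaches only the pairs with n + m even; for n + m odd one
takes n = u + v + 1, which adds 4 to both indices and a factor ε. The signs combine because δ⁻¹ = δ.
-/
theorem thetaEight_mul (ε δ : ℤˣ) (p r : ℤ) {τ : ℂ} (hτ : 0 < τ.im) :
    thetaEight ε (p + r) τ * thetaEight δ (p - r) τ
      = thetaEight (ε * δ) p (2 * τ) * thetaEight (ε * δ) r (2 * τ)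
        + (ε : ℤ) * (thetaEight (ε * δ) (p + 4) (2 * τ) * thetaEight (ε * δ) (r + 4) (2 * τ)) := by
  have hτ2 : 0 < (2 * τ).im := by simpa
  have key (α β : ℤˣ) (k l : ℤ) {σ : ℂ} (hσ : 0 < σ.im) :
      HasSum (fun x : ℤ × ℤ => thetaEightTerm α k σ x.1 * thetaEightTerm β l σ x.2)
        (thetaEight α k σ * thetaEight β l σ) := by
    have h1 := summable_norm_thetaEightTerm α k hσ
    have h2 := summable_norm_thetaEightTerm β l hσ
    rw [thetaEight, thetaEight, tsum_mul_tsum_of_summable_norm h1 h2]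
    exact (summable_mul_of_summable_norm h1 h2).hasSum
  have h1 := key ε δ (p + r) (p - r) hτ
  rw [← intPairParityEquiv.hasSum_iff] at h1
  refine h1.unique (HasSum.sum ?_ ?_)
  · refine (congrArg (HasSum · _) (funext fun x => ?_)).mpr (key (ε * δ) (ε * δ) p r hτ2)
    have hs : ε ^ (x.1 + x.2) * δ ^ (x.1 - x.2) = (ε * δ) ^ x.1 * (ε * δ) ^ x.2 := by
      rw [zpow_add, zpow_sub, mul_zpow, mul_zpow, Int.units_inv_eq_self]
      exact mul_mul_mul_comm _ _ _ _
    have hs' := congrArg (fun u : ℤˣ => ((u : ℤ) : ℂ)) hs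
    simp only [Units.val_mul, Int.cast_mul] at hs'
    simp only [intPairParityEquiv, Function.comp, Equiv.coe_fn_mk, Sum.elim_inl, thetaEightTerm]
    rw [mul_mul_mul_comm, mul_mul_mul_comm (((((ε * δ) ^ x.1 : ℤˣ)) : ℤ) : ℂ), hs',
      ← Complex.exp_add, ← Complex.exp_add]
    congr 2
    push_cast
    ring
  · refine (congrArg (HasSum · _) (funext fun x => ?_)).mpr
      ((key (ε * δ) (ε * δ) (p + 4) (r + 4) hτ2).mul_left ((ε : ℤ) : ℂ))
    have hs : ε ^ (x.1 + x.2 + 1) * δ ^ (x.1 - x.2)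
        = ε * ((ε * δ) ^ x.1 * (ε * δ) ^ x.2) := by
      rw [zpow_add, zpow_add, zpow_sub, mul_zpow, mul_zpow, Int.units_inv_eq_self, zpow_one,
        mul_comm _ ε, mul_assoc, mul_mul_mul_comm]
    have hs' := congrArg (fun u : ℤˣ => ((u : ℤ) : ℂ)) hs
    simp only [Units.val_mul, Int.cast_mul] at hs'
    simp only [intPairParityEquiv, Function.comp, Equiv.coe_fn_mk, Sum.elim_inr, thetaEightTerm]
    rw [mul_mul_mul_comm, mul_mul_mul_comm (((((ε * δ) ^ x.1 : ℤˣ)) : ℤ) : ℂ), hs', mul_assoc,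
      ← Complex.exp_add, ← Complex.exp_add]
    congr 3
    push_cast
    ring

-- The n-th term acquires exp(πi (8n+k)²/16) = exp(πi k²/16) (-1)^(nk). For odd k the translation
-- thus exchanges the alternating and the plain series.
open Complex in
theorem thetaEight_add_one (ε : ℤˣ) (k : ℤ) (τ : ℂ) :
    thetaEight ε k (τ + 1)
      = cexp (Real.pi * I * (k ^ 2 / 16)) * thetaEight (ε * (-1) ^ k) k τ := by
  rw [thetaEight, thetaEight, ← tsum_mul_left]
  refine tsum_congr fun n => ?_
  have h : (((((-1) ^ k) ^ n : ℤˣ) : ℤ) : ℂ) = cexp (Real.pi * I * (4 * n ^ 2 + n * k)) := by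
    rw [← zpow_mul, show Real.pi * I * (4 * n ^ 2 + n * k)
      = (k * n : ℤ) * (Real.pi * I) + (2 * n ^ 2 : ℤ) * (2 * Real.pi * I) by push_cast; ring,
      exp_add, exp_int_mul_two_pi_mul_I, exp_int_mul, exp_pi_mul_I,
      mul_one, neg_one_unit_zpow_cast]
  simp only [thetaEightTerm, mul_zpow, Units.val_mul, Int.cast_mul, h]
  rw [show ∀ a b c d : ℂ, a * (b * c * d) = b * (a * c * d) by intros; ring, ← exp_add, ← exp_add]
  congr 2
  ring

-- Here (8n+2)²/32 = 2n² + n + 1/8, so the half-shift yields the phase (-1)ⁿ ζ₁₆.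
open Complex in
theorem thetaEight_two_add_half (τ : ℂ) :
    thetaEight 1 2 (τ + 1 / 2) = zetaRoot 16 * thetaEight (-1) 2 τ := by
  rw [thetaEight, thetaEight, ← tsum_mul_left]
  refine tsum_congr fun n => ?_
  have h : ((((-1) ^ n : ℤˣ) : ℤ) : ℂ) = cexp (Real.pi * I * (2 * n ^ 2 + n)) := by
    rw [show Real.pi * I * (2 * n ^ 2 + n)
      = (n : ℤ) * (Real.pi * I) + (n ^ 2 : ℤ) * (2 * Real.pi * I) by push_cast; ring,
      exp_add, exp_int_mul_two_pi_mul_I, exp_int_mul, exp_pi_mul_I,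
      mul_one, neg_one_unit_zpow_cast]
  simp only [thetaEightTerm, h, zetaRoot, one_zpow, Units.val_one, Int.cast_one, one_mul]
  rw [← exp_add, ← exp_add]
  congr 1
  push_cast
  ring

/-! ### Theta series as eta quotients -/

theorem norm_exp_two_pi_mul_I_lt_one {τ : ℂ} (hτ : 0 < τ.im) :
    ‖Complex.exp (2 * Real.pi * Complex.I * τ)‖ < 1 :=
  UpperHalfPlane.norm_exp_two_pi_I_lt_one ⟨τ, hτ⟩

open Complex in
theorem eta_eq_exp_mul_tprod (τ : ℂ) :
    ModularForm.eta τ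
      = cexp (Real.pi * I * τ / 12) * ∏' n : ℕ, (1 - cexp (2 * Real.pi * I * τ) ^ (n + 1)) := by
  simp only [ModularForm.eta, ModularForm.eta_q_eq_pow, Function.Periodic.qParam]
  congr 2
  push_cast
  ring

theorem eta_ne_zero_of_im_pos {τ : ℂ} (hτ : 0 < τ.im) : ModularForm.eta τ ≠ 0 :=
  ModularForm.eta_ne_zero hτ

-- The exponents are (4n+1)²/8, and |4n+1| runs once through the odd positive integers 2j+1. Since
-- (2j+1)²/8 = j(j+1)/2 + 1/8, the series is q^(1/8) times the triangular series evaluated by Gauss.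
open Complex in
theorem thetaEight_one_two_mul_eta {τ : ℂ} (hτ : 0 < τ.im) :
    thetaEight 1 2 τ * ModularForm.eta τ = ModularForm.eta (2 * τ) ^ 2 := by
  set x := cexp (2 * Real.pi * I * τ) with hx
  have hx1 : ‖x‖ < 1 := norm_exp_two_pi_mul_I_lt_one hτ
  have hsum := (hasSum_pow_triangular hx1).mul_left (cexp (Real.pi * I * τ / 4))
  rw [← Equiv.intEquivNat.hasSum_iff] at hsum
  have hpow (j : ℕ) : cexp (Real.pi * I * τ / 4) * x ^ (j * (j + 1) / 2)
      = cexp (Real.pi * I * τ * ((2 * j + 1) ^ 2 / 4)) := by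
    obtain ⟨t, ht⟩ := Nat.even_mul_succ_self j
    have ht' : (j : ℂ) * (j + 1) = t + t := mod_cast ht
    rw [ht, ← two_mul, Nat.mul_div_cancel_left _ two_pos, hx, ← exp_nat_mul, ← exp_add]
    congr 1
    linear_combination -(Real.pi * I * τ) * ht'
  -- The bijection sends n ≥ 0 to j = 2n and -(n+1) to j = 2n+1, which is exactly |4m+1| = 2j+1 for
  -- the corresponding integer m.
  have hfun : (fun i : ℕ => cexp (Real.pi * I * τ / 4) * x ^ (i * (i + 1) / 2)) ∘ Equiv.intEquivNat
      = thetaEightTerm 1 2 τ := by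
    funext n
    rw [Function.comp, hpow, thetaEightTerm, one_zpow, Units.val_one, Int.cast_one, one_mul]
    rcases n with n | n
    · rw [show Equiv.intEquivNat (Int.ofNat n) = 2 * n from rfl, Int.ofNat_eq_natCast,
        Int.cast_natCast]
      congr 1
      push_cast
      ring
    · rw [show Equiv.intEquivNat (Int.negSucc n) = 2 * n + 1 from rfl]
      congr 1
      push_cast
      ring
  have hF := hsum.tsum_eq
  rw [hfun, ← thetaEight] at hF
  have h2 : cexp (2 * Real.pi * I * (2 * τ)) = x ^ 2 := by
    rw [hx, ← exp_nat_mul]; congr 1; push_cast; ring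
  have h0 := tprod_one_sub_pow_ne_zero hx1
  have he : cexp (Real.pi * I * (2 * τ) / 12) ^ 2
      = cexp (Real.pi * I * τ / 4) * cexp (Real.pi * I * τ / 12) := by
    rw [← exp_nat_mul, ← exp_add]; congr 1; push_cast; ring
  rw [hF, eta_eq_exp_mul_tprod, eta_eq_exp_mul_tprod, ← hx, h2, mul_pow, he]
  field_simp

open Complex in
theorem eta_add_one (τ : ℂ) : ModularForm.eta (τ + 1) = zetaRoot 24 * ModularForm.eta τ := by
  rw [eta_eq_exp_mul_tprod, eta_eq_exp_mul_tprod, ← mul_assoc, zetaRoot, ← exp_add,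
    show 2 * Real.pi * I * (τ + 1) = 2 * Real.pi * I * τ + 2 * Real.pi * I by ring, exp_add,
    exp_two_pi_mul_I, mul_one]
  congr 2
  push_cast
  ring

-- The shift replaces q by -q, so this is `tprod_one_sub_neg_pow`; the factor ζ₄₈ is the phase of
-- q^(1/24).
open Complex in
theorem eta_add_half {τ : ℂ} (hτ : 0 < τ.im) :
    ModularForm.eta (τ + 1 / 2) * ModularForm.eta τ * ModularForm.eta (4 * τ)
      = zetaRoot 48 * ModularForm.eta (2 * τ) ^ 3 := by
  have h := tprod_one_sub_neg_pow (norm_exp_two_pi_mul_I_lt_one hτ)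
  set x := cexp (2 * Real.pi * I * τ) with hx
  have h2 : cexp (2 * Real.pi * I * (2 * τ)) = x ^ 2 := by
    rw [hx, ← exp_nat_mul]; congr 1; push_cast; ring
  have h4 : cexp (2 * Real.pi * I * (4 * τ)) = x ^ 4 := by
    rw [hx, ← exp_nat_mul]; congr 1; push_cast; ring
  have hh : cexp (2 * Real.pi * I * (τ + 1 / 2)) = -x := by
    rw [show 2 * Real.pi * I * (τ + 1 / 2) = 2 * Real.pi * I * τ + Real.pi * I by ring, exp_add,
      exp_pi_mul_I, mul_neg_one]
  simp only [eta_eq_exp_mul_tprod, ← hx, h2, h4, hh, mul_pow, ← exp_nat_mul, zetaRoot]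
  rw [← h]
  have e : cexp (Real.pi * I * (τ + 1 / 2) / 12) * cexp (Real.pi * I * τ / 12)
      * cexp (Real.pi * I * (4 * τ) / 12) = cexp (2 * Real.pi * I / (48 : ℕ))
        * cexp ((3 : ℕ) * (Real.pi * I * (2 * τ) / 12)) := by
    rw [← exp_add, ← exp_add, ← exp_add]
    congr 1
    push_cast
    ring
  linear_combination (∏' n : ℕ, (1 - (-x) ^ (n + 1))) * (∏' n : ℕ, (1 - x ^ (n + 1)))
        * (∏' n : ℕ, (1 - (x ^ 4) ^ (n + 1))) * e

-- This is the evaluation of `thetaEight 1 2` at τ + 1/2, where the plain series turns into the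
-- alternating one.
open Complex in
theorem thetaEight_neg_one_two_mul_eta {τ : ℂ} (hτ : 0 < τ.im) :
    thetaEight (-1) 2 τ * ModularForm.eta (2 * τ)
      = ModularForm.eta τ * ModularForm.eta (4 * τ) := by
  have hτ' : 0 < (τ + 1 / 2).im := by simpa
  have h1 := thetaEight_one_two_mul_eta hτ'
  have h2 := eta_add_half hτ
  rw [thetaEight_two_add_half, show 2 * (τ + 1 / 2) = 2 * τ + 1 by ring, eta_add_one] at h1
  have n2 : ModularForm.eta (2 * τ) ≠ 0 := eta_ne_zero_of_im_pos (by simpa)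
  have z : zetaRoot 16 * zetaRoot 48 = zetaRoot 24 ^ 2 := by
    simp only [zetaRoot]
    rw [← exp_add, ← exp_nat_mul]
    congr 1
    push_cast
    ring
  have zn : zetaRoot 24 ^ 2 ≠ 0 := pow_ne_zero _ (exp_ne_zero _)
  refine mul_left_cancel₀ (mul_ne_zero zn (pow_ne_zero 2 n2)) ?_
  linear_combination (ModularForm.eta τ * ModularForm.eta (4 * τ)) * h1
    - zetaRoot 16 * thetaEight (-1) 2 τ * h2
    - thetaEight (-1) 2 τ * ModularForm.eta (2 * τ) ^ 3 * z

/-- In the product formula for the plain and the alternating series of index 2 at τ/2, the second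
summand contains the vanishing series of index 4. Hence g(0) g(2) at τ is a product of two known eta
quotients. -/
theorem thetaEight_neg_one_zero_mul_eta {τ : ℂ} (hτ : 0 < τ.im) :
    thetaEight (-1) 0 τ * ModularForm.eta (4 * τ) = ModularForm.eta (2 * τ) ^ 2 := by
  have hσ : 0 < (τ / 2).im := by simpa
  have h := thetaEight_mul 1 (-1) 2 0 hσ
  have h1 := thetaEight_one_two_mul_eta hσ
  have h2 := thetaEight_neg_one_two_mul_eta hσ
  have h3 := thetaEight_neg_one_two_mul_eta hτ
  rw [show 2 * (τ / 2) = τ by ring] at h h1 h2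
  rw [show 4 * (τ / 2) = 2 * τ by ring] at h2
  simp only [add_zero, sub_zero, one_mul, zero_add, thetaEight_neg_one_four, mul_zero] at h
  have n0 : ModularForm.eta (τ / 2) ≠ 0 := eta_ne_zero_of_im_pos hσ
  have n1 : ModularForm.eta τ ≠ 0 := eta_ne_zero_of_im_pos hτ
  have n2 : ModularForm.eta (2 * τ) ≠ 0 := eta_ne_zero_of_im_pos (by simpa)
  refine mul_left_cancel₀ (mul_ne_zero n0 (pow_ne_zero 2 n1)) ?_
  linear_combination (exp := 1) -ModularForm.eta (τ / 2) * ModularForm.eta τ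
      * (thetaEight (-1) 0 τ) * h3
    - ModularForm.eta (τ / 2) * ModularForm.eta τ * ModularForm.eta (2 * τ) * h
    + ModularForm.eta τ * ModularForm.eta (2 * τ) * thetaEight (-1) 2 (τ / 2) * h1
    + ModularForm.eta τ ^ 2 * ModularForm.eta (2 * τ) * h2

/-! ### Orthonormal coordinates and invariants of the symmetry group -/

/-- Twice the coordinates of a weight of `D₅` in the standard orthonormal basis. -/
def coordD5 (β : WeightD5) : Fin 5 → ℤ :=
  ![2 * (β 0 + β 1 + β 2) + β 3 + β 4, 2 * (β 1 + β 2) + β 3 + β 4, 2 * β 2 + β 3 + β 4,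
    β 3 + β 4, β 4 - β 3]

theorem simpleRootD5_zero : simpleRootD5 0 = ![2, -1, 0, 0, 0] := by decide
theorem simpleRootD5_one : simpleRootD5 1 = ![-1, 2, -1, 0, 0] := by decide
theorem simpleRootD5_two : simpleRootD5 2 = ![0, -1, 2, -1, -1] := by decide
theorem simpleRootD5_three : simpleRootD5 3 = ![0, 0, -1, 2, 0] := by decide
theorem simpleRootD5_four : simpleRootD5 4 = ![0, 0, -1, 0, 2] := by decide

theorem coordD5_injective : Function.Injective coordD5 := by
  intro β γ h
  have h0 := congrFun h 0
  have h1 := congrFun h 1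
  have h2 := congrFun h 2
  have h3 := congrFun h 3
  have h4 := congrFun h 4
  simp [coordD5] at h0 h1 h2 h3 h4
  funext i
  fin_cases i <;> simp <;> omega

theorem coordD5_reflectD5_zero (β : WeightD5) : coordD5 (reflectD5 0 β)
    = ![coordD5 β 1, coordD5 β 0, coordD5 β 2, coordD5 β 3, coordD5 β 4] := by
  funext j
  fin_cases j <;> simp [coordD5, reflectD5, simpleRootD5_zero] <;> ring

theorem coordD5_reflectD5_one (β : WeightD5) : coordD5 (reflectD5 1 β)
    = ![coordD5 β 0, coordD5 β 2, coordD5 β 1, coordD5 β 3, coordD5 β 4] := by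
  funext j
  fin_cases j <;> simp [coordD5, reflectD5, simpleRootD5_one] <;> ring

theorem coordD5_reflectD5_two (β : WeightD5) : coordD5 (reflectD5 2 β)
    = ![coordD5 β 0, coordD5 β 1, coordD5 β 3, coordD5 β 2, coordD5 β 4] := by
  funext j
  fin_cases j <;> simp [coordD5, reflectD5, simpleRootD5_two] <;> ring

theorem coordD5_reflectD5_three (β : WeightD5) : coordD5 (reflectD5 3 β)
    = ![coordD5 β 0, coordD5 β 1, coordD5 β 2, coordD5 β 4, coordD5 β 3] := by
  funext j
  fin_cases j <;> simp [coordD5, reflectD5, simpleRootD5_three] <;> ring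

theorem coordD5_reflectD5_four (β : WeightD5) : coordD5 (reflectD5 4 β)
    = ![coordD5 β 0, coordD5 β 1, coordD5 β 2, -coordD5 β 4, -coordD5 β 3] := by
  funext j
  fin_cases j <;> simp [coordD5, reflectD5, simpleRootD5_four] <;> ring

theorem coordD5_neg (β : WeightD5) : coordD5 (-β) = -coordD5 β := by
  funext j
  fin_cases j <;> simp [coordD5] <;> ring

theorem coordD5_add (β γ : WeightD5) : coordD5 (β + γ) = coordD5 β + coordD5 γ := by
  funext j
  fin_cases j <;> simp [coordD5] <;> ring

theorem coordD5_four_smul_simpleRootD5 (i : Fin 5) : coordD5 ((4 : ℤ) • simpleRootD5 i)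
    = ![![8, -8, 0, 0, 0], ![0, 8, -8, 0, 0], ![0, 0, 8, -8, 0], ![0, 0, 0, 8, -8],
      ![0, 0, 0, 8, 8]] i := by
  decide +revert

/-- A function on the weights that is invariant under the generators of `symmetryD5` is constant on
the orbits. -/
theorem eq_of_mem_orbit_symmetryD5 {X : Type*} (φ : WeightD5 → X)
    (hrefl : ∀ i β, φ (reflectD5 i β) = φ β) (hneg : ∀ β, φ (-β) = φ β)
    (htrans : ∀ i β, φ (β + (4 : ℤ) • simpleRootD5 i) = φ β) {β γ : WeightD5}
    (h : γ ∈ MulAction.orbit symmetryD5 β) : φ γ = φ β := by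
  let S : Subgroup (Equiv.Perm WeightD5) :=
    { carrier := {σ | ∀ β, φ (σ β) = φ β}
      mul_mem' := fun {σ τ} hσ hτ β => by rw [Equiv.Perm.mul_apply, hσ, hτ]
      one_mem' := fun β => rfl
      inv_mem' := fun {σ} hσ β => show φ (σ.symm β) = φ β by
        rw [← hσ (σ.symm β), Equiv.apply_symm_apply] }
  have hS : symmetryD5 ≤ S := by
    refine sup_le (sup_le ?_ ?_) ?_ <;> refine (Subgroup.closure_le S).mpr ?_
    · rintro _ ⟨i, rfl⟩
      exact hrefl i
    · rintro _ rfl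
      exact hneg
    · rintro _ ⟨i, rfl⟩
      exact htrans i
  obtain ⟨⟨σ, hσ⟩, rfl⟩ := h
  exact hS hσ β

/-- Functions on `ℤ` that behave like `k ↦ ∑ q ^ ((8 n + k)² / 32)` and
`k ↦ ∑ (-1)ⁿ q ^ ((8 n + k)² / 32)`. -/
structure IsThetaPair {R : Type*} [CommRing R] (f g : ℤ → R) : Prop where
  left_neg (k : ℤ) : f (-k) = f k
  right_neg (k : ℤ) : g (-k) = g k
  left_add_eight (k : ℤ) : f (k + 8) = f k
  right_add_eight (k : ℤ) : g (k + 8) = -g k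

/-- The sum of the products of the values of `f` and of `g` at the doubled coordinates. -/
def weightForm {R : Type*} [CommRing R] (f g : ℤ → R) (β : WeightD5) : R :=
  ∏ i, f (coordD5 β i) + ∏ i, g (coordD5 β i)

/-- Reflections permute the coordinates up to signs, and f and g are even. A translation by 4αᵢ
moves exactly two coordinates by ±8, so the two sign changes of g cancel. -/
theorem IsThetaPair.weightForm_eq_of_mem_orbit {R : Type*} [CommRing R] {f g : ℤ → R}
    (h : IsThetaPair f g) {β γ : WeightD5} (hγ : γ ∈ MulAction.orbit symmetryD5 β) :
    weightForm f g γ = weightForm f g β := by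
  have hf (k : ℤ) : f (k + -8) = f k := by
    rw [← h.left_add_eight (k + -8), neg_add_cancel_right]
  have hg (k : ℤ) : g (k + -8) = -g k := by
    rw [← neg_neg (g (k + -8)), ← h.right_add_eight (k + -8), neg_add_cancel_right]
  refine eq_of_mem_orbit_symmetryD5 _ (fun i β => ?_) (fun β => ?_) (fun i β => ?_) hγ
  · fin_cases i <;>
      simp [weightForm, coordD5_reflectD5_zero, coordD5_reflectD5_one, coordD5_reflectD5_two,
        coordD5_reflectD5_three, coordD5_reflectD5_four, Fin.prod_univ_five, h.left_neg,
        h.right_neg] <;> ring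
  · simp [weightForm, coordD5_neg, h.left_neg, h.right_neg]
  · rw [weightForm, coordD5_add, coordD5_four_smul_simpleRootD5]
    fin_cases i <;>
      simp [weightForm, Fin.prod_univ_five, h.left_add_eight, h.right_add_eight, hf, hg]

theorem isThetaPair_thetaEight (τ : ℂ) :
    IsThetaPair (fun k => thetaEight 1 k τ) (fun k => thetaEight (-1) k τ) where
  left_neg k := thetaEight_neg 1 k τ
  right_neg k := thetaEight_neg (-1) k τ
  left_add_eight k := by simp [thetaEight_add_eight]
  right_add_eight k := by simp [thetaEight_add_eight]

/-! ### Theta functions of `D₅` as sums of two products -/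

/-- Absolute summability is part of the induction because splitting off one variable multiplies two
series. -/
theorem summable_norm_and_hasSum_prod_apply {n : ℕ} (f : Fin n → ℤ → ℂ)
    (hf : ∀ i, Summable fun k => ‖f i k‖) :
    Summable (fun x : Fin n → ℤ => ‖∏ i, f i (x i)‖) ∧
      HasSum (fun x : Fin n → ℤ => ∏ i, f i (x i)) (∏ i, ∑' k, f i k) := by
  induction n with
  | zero => exact ⟨Summable.of_finite, by simp⟩
  | succ n ih =>
    obtain ⟨h1, h2⟩ := ih (fun i => f i.succ) fun i => hf i.succ
    have e (x : ℤ × (Fin n → ℤ)) : ∏ i, f i ((Fin.consEquiv fun _ => ℤ) x i)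
        = f 0 x.1 * ∏ i : Fin n, f i.succ (x.2 i) := by
      simp [Fin.prod_univ_succ, Fin.consEquiv]
    have hs := summable_mul_of_summable_norm (hf 0) h1
    constructor
    · rw [← (Fin.consEquiv fun _ => ℤ).summable_iff]
      refine ((hf 0).mul_norm h1).congr fun x => ?_
      rw [Function.comp, e]
    · rw [← (Fin.consEquiv fun _ => ℤ).hasSum_iff, Fin.prod_univ_succ, ← h2.tsum_eq,
        tsum_mul_tsum_of_summable_norm (hf 0) h1]
      exact (congrArg (HasSum · _) (funext e)).mpr hs.hasSum

/-- The orthonormal coordinates of the element of the root lattice with given coordinates in the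
basis of simple roots. -/
def rootCoordD5 (m : Fin 5 → ℤ) : Fin 5 → ℤ :=
  ![m 0, m 1 - m 0, m 2 - m 1, m 3 + m 4 - m 2, m 4 - m 3]

theorem rootCoordD5_injective : Function.Injective rootCoordD5 := by
  intro m n h
  have h0 := congrFun h 0
  have h1 := congrFun h 1
  have h2 := congrFun h 2
  have h3 := congrFun h 3
  have h4 := congrFun h 4
  simp [rootCoordD5] at h0 h1 h2 h3 h4
  funext i
  fin_cases i <;> simp <;> omega

theorem mem_range_rootCoordD5 {n : Fin 5 → ℤ} (h : Even (∑ i, n i)) :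
    n ∈ Set.range rootCoordD5 := by
  obtain ⟨t, ht⟩ := h
  rw [Fin.sum_univ_five] at ht
  -- The first three coefficients are partial sums; the last two solve m₃ + m₄ = n₀ + n₁ + n₂ + n₃
  -- and m₄ - m₃ = n₄, which is where the sum 2t must be even.
  refine ⟨![n 0, n 0 + n 1, n 0 + n 1 + n 2, t - n 4, t], ?_⟩
  funext i
  fin_cases i <;> simp [rootCoordD5] <;> omega

theorem even_sum_rootCoordD5 (m : Fin 5 → ℤ) : Even (∑ i, rootCoordD5 m i) := by
  refine ⟨m 4, ?_⟩
  simp [rootCoordD5, Fin.sum_univ_five]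
  ring

theorem cartanD5_eq : cartanD5 = !![2, -1, 0, 0, 0; -1, 2, -1, 0, 0; 0, -1, 2, -1, -1;
    0, 0, -1, 2, 0; 0, 0, -1, 0, 2] := by
  have h : CartanMatrix.D 5 = !![2, -1, 0, 0, 0; -1, 2, -1, 0, 0; 0, -1, 2, -1, -1;
    0, 0, -1, 2, 0; 0, 0, -1, 0, 2] := by decide
  rw [cartanD5, h]
  ext i j
  fin_cases i <;> (fin_cases j <;> simp)

theorem cartanD5_inv : cartanD5⁻¹ = (1 / 4 : ℝ) • !![4, 4, 4, 2, 2; 4, 8, 8, 4, 4; 4, 8, 12, 6, 6;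
    2, 4, 6, 5, 3; 2, 4, 6, 3, 5] := by
  refine Matrix.inv_eq_right_inv ?_
  rw [cartanD5_eq]
  ext i j
  fin_cases i <;> fin_cases j <;> simp [Matrix.mul_apply, Fin.sum_univ_five] <;>
    norm_num

/-- In orthonormal coordinates A becomes the standard form, and m + A⁻¹β/4 becomes `rootCoordD5 m`
plus an eighth of the doubled coordinates of β. -/
theorem shiftedD5_form (β : WeightD5) (m : Fin 5 → ℤ) :
    (4 / 2 : ℝ) * (shiftedD5 β m ⬝ᵥ cartanD5.mulVec (shiftedD5 β m))
      = ∑ i, (8 * (rootCoordD5 m i : ℝ) + coordD5 β i) ^ 2 / 32 := by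
  have h (i : Fin 5) : shiftedD5 β m i = (m i : ℝ) + 1 / 16 * (![4 * β 0 + 4 * β 1 + 4 * β 2
      + 2 * β 3 + 2 * β 4, 4 * β 0 + 8 * β 1 + 8 * β 2 + 4 * β 3 + 4 * β 4,
      4 * β 0 + 8 * β 1 + 12 * β 2 + 6 * β 3 + 6 * β 4,
      2 * β 0 + 4 * β 1 + 6 * β 2 + 5 * β 3 + 3 * β 4,
      2 * β 0 + 4 * β 1 + 6 * β 2 + 3 * β 3 + 5 * β 4] i : ℤ) := by
    rw [shiftedD5, cartanD5_inv]
    fin_cases i <;> simp [Matrix.mulVec, dotProduct, Fin.sum_univ_five] <;> ring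
  rw [cartanD5_eq]
  simp only [Matrix.mulVec, dotProduct, Fin.sum_univ_five, h]
  simp [rootCoordD5, coordD5]
  ring

theorem thetaTermD5_eq_prod (β : WeightD5) (τ : ℂ) (m : Fin 5 → ℤ) :
    thetaTermD5 β τ m = ∏ i, thetaEightTerm 1 (coordD5 β i) τ (rootCoordD5 m i) := by
  simp only [thetaEightTerm, one_zpow, Units.val_one, Int.cast_one, one_mul]
  rw [thetaTermD5, shiftedD5_form, ← Complex.exp_sum, ← Finset.mul_sum]
  congr 1
  push_cast
  rw [Finset.mul_sum, Finset.mul_sum]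
  exact Finset.sum_congr rfl fun i _ => by ring

/-- The mean of the plain and the alternating product over ℤ⁵ keeps precisely the points of even
coordinate sum, which are the points of the root lattice. -/
theorem hasSum_thetaTermD5 (β : WeightD5) {τ : ℂ} (hτ : 0 < τ.im) :
    HasSum (thetaTermD5 β τ)
      (weightForm (fun k => thetaEight 1 k τ) (fun k => thetaEight (-1) k τ) β / 2) := by
  have h (ε : ℤˣ) := (summable_norm_and_hasSum_prod_apply
    (fun i => thetaEightTerm ε (coordD5 β i) τ)
    fun i => summable_norm_thetaEightTerm ε (coordD5 β i) hτ).2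
  have hs := ((h 1).add (h (-1))).div_const 2
  have key (x : Fin 5 → ℤ) : (∏ i, thetaEightTerm 1 (coordD5 β i) τ (x i)
      + ∏ i, thetaEightTerm (-1) (coordD5 β i) τ (x i)) / 2
      = (1 + (-1) ^ (∑ i, x i)) / 2 * ∏ i, thetaEightTerm 1 (coordD5 β i) τ (x i) := by
    have : ∏ i, thetaEightTerm (-1) (coordD5 β i) τ (x i)
        = (-1) ^ (∑ i, x i) * ∏ i, thetaEightTerm 1 (coordD5 β i) τ (x i) := by
      simp only [thetaEightTerm, neg_one_unit_zpow_cast, one_zpow, Units.val_one, Int.cast_one,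
        one_mul, Finset.prod_mul_distrib]
      congr 1
      simp [Fin.prod_univ_five, Fin.sum_univ_five, zpow_add₀]
    rw [this]
    ring
  simp only [key] at hs
  rw [← rootCoordD5_injective.hasSum_iff] at hs
  · refine (congrArg (HasSum · _) (funext fun m => ?_)).mpr hs
    rw [thetaTermD5_eq_prod, Function.comp, (even_sum_rootCoordD5 m).neg_one_zpow]
    ring
  · intro x hx
    have hodd : Odd (∑ i, x i) := by
      rw [← Int.not_even_iff_odd]
      exact fun he => hx (mem_range_rootCoordD5 he)
    simp [hodd.neg_one_zpow]

theorem thetaD5_eq_weightForm (β : WeightD5) {τ : ℂ} (hτ : 0 < τ.im) :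
    thetaD5 β τ
      = weightForm (fun k => thetaEight 1 k τ) (fun k => thetaEight (-1) k τ) β / 2 :=
  (hasSum_thetaTermD5 β hτ).tsum_eq

theorem thetaD5_eq_of_mem_orbit {β γ : WeightD5} {τ : ℂ} (hτ : 0 < τ.im)
    (h : γ ∈ MulAction.orbit symmetryD5 β) : thetaD5 γ τ = thetaD5 β τ := by
  rw [thetaD5_eq_weightForm γ hτ, thetaD5_eq_weightForm β hτ,
    (isThetaPair_thetaEight τ).weightForm_eq_of_mem_orbit h]

/-! ### The cubic forms as polynomials in one-variable values -/

theorem IsThetaPair.eight_sub {R : Type*} [CommRing R] {f g : ℤ → R} (h : IsThetaPair f g)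
    (k : ℤ) : f (8 - k) = f k ∧ g (8 - k) = -g k := by
  rw [show 8 - k = -k + 8 by ring, h.left_add_eight, h.right_add_eight, h.left_neg, h.right_neg]
  exact ⟨rfl, rfl⟩

theorem IsThetaPair.values {R : Type*} [CommRing R] {f g : ℤ → R} (h : IsThetaPair f g) :
    f 5 = f 3 ∧ f 6 = f 2 ∧ f 7 = f 1 ∧ f 8 = f 0 ∧ f 13 = f 3 ∧ f 15 = f 1 ∧
      g 5 = -g 3 ∧ g 6 = -g 2 ∧ g 7 = -g 1 ∧ g 8 = -g 0 ∧ g 13 = g 3 ∧ g 15 = g 1 := by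
  have h3 := h.eight_sub 3
  have h2 := h.eight_sub 2
  have h1 := h.eight_sub 1
  have h0 := h.eight_sub 0
  have a5 := h.left_add_eight 5
  have a7 := h.left_add_eight 7
  have b5 := h.right_add_eight 5
  have b7 := h.right_add_eight 7
  norm_num at h3 h2 h1 h0 a5 a7 b5 b7
  simp [h3, h2, h1, h0, a5, a7, b5, b7]

/-- These weights are the ones occurring in the cubic forms with d ≤ 2. All their doubled
coordinates are even, and g(4) = 0 removes the second product whenever a coordinate is 4 modulo 8.
-/
theorem IsThetaPair.weightForm_lamD5_of_even {R : Type*} [CommRing R] {f g : ℤ → R}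
    (h : IsThetaPair f g) (h4 : g 4 = 0) :
    weightForm f g (lamD5 0 1) = f 0 ^ 5 + g 0 ^ 5 ∧
    weightForm f g (lamD5 1 1) = f 0 ^ 4 * f 2 + g 0 ^ 4 * g 2 ∧
    weightForm f g (lamD5 1 2) = f 0 ^ 4 * f 4 ∧
    weightForm f g (lamD5 1 3) = f 0 ^ 4 * f 2 - g 0 ^ 4 * g 2 ∧
    weightForm f g (lamD5 1 4) = f 0 ^ 5 - g 0 ^ 5 ∧
    weightForm f g (lamD5 2 1) = f 0 ^ 3 * f 2 ^ 2 + g 0 ^ 3 * g 2 ^ 2 ∧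
    weightForm f g (lamD5 2 2) = f 0 ^ 3 * f 4 ^ 2 ∧
    weightForm f g (lamD5 3 1) = f 0 ^ 3 * f 2 * f 4 ∧
    weightForm f g (lamD5 4 1) = f 0 ^ 3 * f 2 ^ 2 - g 0 ^ 3 * g 2 ^ 2 ∧
    weightForm f g (lamD5 5 1) = f 0 ^ 2 * f 2 ^ 3 + g 0 ^ 2 * g 2 ^ 3 ∧
    weightForm f g (lamD5 5 2) = f 0 ^ 2 * f 4 ^ 3 ∧
    weightForm f g (lamD5 6 1) = f 0 ^ 2 * f 2 ^ 2 * f 4 ∧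
    weightForm f g (lamD5 7 1) = f 0 ^ 2 * f 2 ^ 3 - g 0 ^ 2 * g 2 ^ 3 ∧
    weightForm f g (lamD5 9 1) = f 0 * f 2 ^ 4 + g 0 * g 2 ^ 4 ∧
    weightForm f g (lamD5 10 1) = f 0 * f 2 ^ 3 * f 4 ∧
    weightForm f g (lamD5 11 1) = f 0 * f 2 ^ 4 - g 0 * g 2 ^ 4 ∧
    weightForm f g (lamD5 12 1) = f 0 * f 2 ^ 2 * f 4 ^ 2 ∧
    weightForm f g (lamD5 13 1) = f 0 * f 2 * f 4 ^ 3 ∧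
    weightForm f g (lamD5 14 2) = f 2 ^ 5 + g 2 ^ 5 ∧
    weightForm f g (lamD5 14 4) = f 4 ^ 5 ∧
    weightForm f g (lamD5 15 2) = f 2 ^ 5 - g 2 ^ 5 ∧
    weightForm f g (lamD5 26 1) = f 2 * f 4 ^ 4 ∧
    weightForm f g (lamD5 27 1) = f 2 ^ 3 * f 4 ^ 2 ∧
    weightForm f g (lamD5 28 1) = f 2 ^ 2 * f 4 ^ 3 := by
  obtain ⟨-, e2, -, e4, -, -, -, e8, -, e10, -, -⟩ := h.values
  refine ⟨?_, ?_, ?_, ?_, ?_, ?_, ?_, ?_, ?_, ?_, ?_, ?_, ?_, ?_, ?_, ?_, ?_, ?_, ?_, ?_, ?_,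
    ?_, ?_, ?_⟩ <;>
    simp [weightForm, coordD5, lamD5, baseWeightD5, Fin.prod_univ_five, h.left_neg,
      h.right_neg, e2, e4, e8, e10, h4] <;> ring

theorem IsThetaPair.weightForm_lamD5_of_odd {R : Type*} [CommRing R] {f g : ℤ → R}
    (h : IsThetaPair f g) :
    weightForm f g (lamD5 14 1) = f 1 ^ 5 + g 1 ^ 5 ∧
    weightForm f g (lamD5 14 3) = f 3 ^ 5 + g 3 ^ 5 ∧
    weightForm f g (lamD5 15 1) = f 1 ^ 4 * f 3 + g 1 ^ 4 * g 3 ∧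
    weightForm f g (lamD5 16 1) = f 1 ^ 4 * f 3 - g 1 ^ 4 * g 3 ∧
    weightForm f g (lamD5 16 3) = f 1 * f 3 ^ 4 + g 1 * g 3 ^ 4 ∧
    weightForm f g (lamD5 17 1) = f 1 ^ 5 - g 1 ^ 5 ∧
    weightForm f g (lamD5 18 1) = f 3 ^ 5 - g 3 ^ 5 ∧
    weightForm f g (lamD5 19 1) = f 1 ^ 3 * f 3 ^ 2 + g 1 ^ 3 * g 3 ^ 2 ∧
    weightForm f g (lamD5 20 1) = f 1 ^ 3 * f 3 ^ 2 - g 1 ^ 3 * g 3 ^ 2 ∧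
    weightForm f g (lamD5 21 1) = f 1 * f 3 ^ 4 - g 1 * g 3 ^ 4 ∧
    weightForm f g (lamD5 22 1) = f 1 ^ 2 * f 3 ^ 3 + g 1 ^ 2 * g 3 ^ 3 ∧
    weightForm f g (lamD5 23 1) = f 1 ^ 2 * f 3 ^ 3 - g 1 ^ 2 * g 3 ^ 3 := by
  obtain ⟨e1, -, e3, -, e5, e6, e7, -, e9, -, e11, e12⟩ := h.values
  refine ⟨?_, ?_, ?_, ?_, ?_, ?_, ?_, ?_, ?_, ?_, ?_, ?_⟩ <;>
    simp [weightForm, coordD5, lamD5, baseWeightD5, Fin.prod_univ_five, h.left_neg,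
      h.right_neg, e1, e3, e5, e6, e7, e9, e11, e12] <;> ring

/-- An ideal membership in the five variables f(0), f(2), f(4), g(0), g(2): the coefficients are
explicit cofactors of the relations, which `weightForm_thetaEight_cubic` proves for the theta
series. The next two lemmas have the same form. -/
theorem polyD5One_weightForm {f g : ℤ → ℂ} (h : IsThetaPair f g) (h0 : g 4 = 0)
    (h1 : f 2 ^ 4 = 1 / 2 * f 0 * f 4 * (f 0 ^ 2 + f 4 ^ 2))
    (h2 : g 2 ^ 4 = 1 / 2 * f 0 * f 4 * (f 0 ^ 2 - f 4 ^ 2))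
    (h3 : g 0 ^ 4 = (f 0 ^ 2 + f 4 ^ 2) * (f 0 ^ 2 - f 4 ^ 2))
    (h4 : f 2 ^ 2 * g 2 ^ 2 = 1 / 2 * f 0 * f 4 * g 0 ^ 2)
    (h5 : f 2 ^ 2 * g 0 ^ 2 = (f 0 ^ 2 + f 4 ^ 2) * g 2 ^ 2)
    (h6 : g 0 ^ 2 * g 2 ^ 2 = (f 0 ^ 2 - f 4 ^ 2) * f 2 ^ 2) :
    polyD5One (fun n k => weightForm f g (lamD5 n k) / 2)
      = g 2 ^ 2 * g 0 ^ 5 * (f 0 ^ 2 - f 4 ^ 2) ^ 4 := by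
  obtain ⟨e0_1, e1_1, e1_2, e1_3, e1_4, e2_1, e2_2, e3_1, e4_1, e5_1, e5_2, e6_1, e7_1, e9_1,
    e10_1, e11_1, e12_1, e13_1, e14_2, e14_4, e15_2, e26_1, e27_1, e28_1⟩ :=
    h.weightForm_lamD5_of_even h0
  simp only [polyD5One, e0_1, e1_1, e1_2, e1_3, e1_4, e2_1, e2_2, e3_1, e4_1, e5_1, e5_2, e6_1,
    e7_1, e9_1, e10_1, e11_1, e12_1, e13_1, e14_2, e14_4, e15_2, e26_1, e27_1, e28_1]
  linear_combination (-6 * f 0 ^ 8 * f 2 ^ 2 * f 4 + 20 * f 0 ^ 6 * f 2 ^ 2 * f 4 ^ 3 + 12 * f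
    0 ^ 5 * f 4 * g 0 ^ 3 * g 2 ^ 2 - 28 * f 0 ^ 4 * f 2 ^ 2 * f 4 ^ 5 - 8 * f 0 ^ 4 * f 2 ^ 2 * g
    0 * g 2 ^ 4 - 8 * f 0 ^ 4 * f 2 * f 4 * g 0 ^ 4 * g 2 + 8 * f 0 ^ 3 * f 2 ^ 6 * f 4 ^ 2 - 24
    * f 0 ^ 3 * f 2 ^ 3 * g 0 ^ 2 * g 2 ^ 3 - 8 * f 0 ^ 3 * f 2 * f 4 ^ 2 * g 2 ^ 5 - 16 * f 0 ^ 3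
    * f 4 ^ 3 * g 0 ^ 3 * g 2 ^ 2 + 8 * f 0 ^ 2 * f 2 ^ 4 * g 0 ^ 3 * g 2 ^ 2 + 20 * f 0 ^ 2 * f
    2 ^ 2 * f 4 ^ 7 + 28 * f 0 ^ 2 * f 2 * f 4 ^ 3 * g 0 ^ 4 * g 2 - 8 * f 0 * f 2 ^ 6 * f 4 ^ 4
    + 8 * f 0 * f 2 ^ 5 * g 0 ^ 4 * g 2 + 8 * f 0 * f 2 * f 4 ^ 4 * g 2 ^ 5 - 4 * f 0 * f 4 ^ 5 * g
    0 ^ 3 * g 2 ^ 2 - 8 * f 0 * g 0 ^ 4 * g 2 ^ 6 - 8 * f 2 ^ 4 * f 4 ^ 2 * g 0 ^ 3 * g 2 ^ 2 + 8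
    * f 2 ^ 2 * f 4 ^ 4 * g 0 * g 2 ^ 4 + 16 * f 2 * g 0 ^ 5 * g 2 ^ 5) * h1 + (-12 * f 0 ^ 8 * f 2
    * f 4 * g 2 + 4 * f 0 ^ 7 * f 2 * f 4 * g 0 * g 2 + 12 * f 0 ^ 6 * f 2 ^ 2 * f 4 * g 0 ^ 2 + 20
    * f 0 ^ 6 * f 2 * f 4 ^ 3 * g 2 - 22 * f 0 ^ 5 * f 2 ^ 2 * f 4 ^ 3 * g 0 - 4 * f 0 ^ 5 * f 2
    * f 4 ^ 3 * g 0 * g 2 - 12 * f 0 ^ 4 * f 2 ^ 2 * f 4 ^ 3 * g 0 ^ 2 + 12 * f 0 ^ 4 * f 2 * f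
    4 ^ 5 * g 2 + 8 * f 0 ^ 4 * f 2 * g 0 * g 2 ^ 5 - 8 * f 0 ^ 4 * f 4 * g 0 ^ 4 * g 2 ^ 2 - 12
    * f 0 ^ 3 * f 2 ^ 2 * f 4 ^ 5 * g 0 + 24 * f 0 ^ 3 * f 2 ^ 2 * g 0 ^ 2 * g 2 ^ 4 - 4 * f 0 ^ 3
    * f 2 * f 4 ^ 5 * g 0 * g 2 + 8 * f 0 ^ 3 * f 2 * f 4 * g 0 ^ 5 * g 2 - 8 * f 0 ^ 3 * f 4 * g
    0 ^ 5 * g 2 ^ 2 - 8 * f 0 ^ 2 * f 2 ^ 3 * g 0 ^ 3 * g 2 ^ 3 + 8 * f 0 ^ 2 * f 2 ^ 2 * f 4 * g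
    0 ^ 6 - 20 * f 0 ^ 2 * f 2 * f 4 ^ 7 * g 2 + 4 * f 0 ^ 2 * f 4 ^ 3 * g 0 ^ 4 * g 2 ^ 2 + 4 * f
    0 * f 2 ^ 2 * f 4 ^ 7 * g 0 + 4 * f 0 * f 2 * f 4 ^ 7 * g 0 * g 2 + 8 * f 0 * f 2 * f 4 ^ 3 * g
    0 ^ 5 * g 2 + 8 * f 0 * f 4 ^ 3 * g 0 ^ 5 * g 2 ^ 2 + 8 * f 2 ^ 3 * f 4 ^ 2 * g 0 ^ 3 * g 2 ^ 3
    - 8 * f 2 * f 4 ^ 4 * g 0 * g 2 ^ 5 - 16 * g 0 ^ 5 * g 2 ^ 6) * h2 + (6 * f 0 ^ 7 * f 2 * f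
    4 ^ 2 * g 2 - 10 * f 0 ^ 7 * f 4 ^ 2 * g 2 ^ 2 - 3 * f 0 ^ 6 * f 2 ^ 2 * f 4 ^ 2 * g 0 - 2 * f
    0 ^ 6 * f 2 * f 4 ^ 2 * g 0 * g 2 + 4 * f 0 ^ 5 * f 2 ^ 2 * f 4 ^ 2 * g 0 ^ 2 - 16 * f 0 ^ 5
    * f 2 * f 4 ^ 4 * g 2 + 6 * f 0 ^ 5 * f 4 ^ 4 * g 2 ^ 2 + 16 * f 0 ^ 4 * f 2 ^ 2 * f 4 ^ 4 * g
    0 + 4 * f 0 ^ 4 * f 2 * f 4 ^ 4 * g 0 * g 2 + f 0 ^ 4 * g 0 ^ 5 * g 2 ^ 2 - 4 * f 0 ^ 3 * f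
    2 ^ 2 * f 4 ^ 4 * g 0 ^ 2 + 10 * f 0 ^ 3 * f 2 * f 4 ^ 6 * g 2 + 4 * f 0 ^ 3 * f 4 ^ 6 * g
    2 ^ 2 - 6 * f 0 ^ 3 * f 4 ^ 2 * g 0 ^ 4 * g 2 ^ 2 - 2 * f 0 ^ 2 * f 2 * f 4 ^ 6 * g 0 * g 2 - 8
    * f 0 * f 2 ^ 3 * f 4 * g 0 ^ 3 * g 2 ^ 3 - f 4 ^ 4 * g 0 ^ 5 * g 2 ^ 2 + g 0 ^ 9 * g 2 ^ 2)
    * h3 + (-6 * f 0 ^ 6 * f 2 * f 4 * g 0 ^ 2 * g 2 - 12 * f 0 ^ 5 * f 2 * f 4 * g 0 ^ 3 * g 2 - 2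
    * f 0 ^ 4 * f 2 * f 4 ^ 3 * g 0 ^ 2 * g 2 + 8 * f 0 ^ 3 * f 2 * f 4 ^ 3 * g 0 ^ 3 * g 2 + 4 * f
    0 * f 2 * f 4 ^ 5 * g 0 ^ 3 * g 2) * h4 + (10 * f 0 ^ 9 * f 4 ^ 2 - 16 * f 0 ^ 7 * f 4 ^ 4 + 2
    * f 0 ^ 5 * f 4 ^ 6 + 4 * f 0 ^ 3 * f 4 ^ 8) * h5 + (3 * f 0 ^ 8 * f 4 ^ 2 * g 0 - 2 * f 0 ^ 6
    * f 4 ^ 4 * g 0 - 10 * f 0 ^ 4 * f 4 ^ 6 * g 0 - 2 * f 0 ^ 2 * f 4 ^ 8 * g 0) * h6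

theorem polyD5TwoZero_weightForm {f g : ℤ → ℂ} (h : IsThetaPair f g) (h0 : g 4 = 0)
    (h1 : f 2 ^ 4 = 1 / 2 * f 0 * f 4 * (f 0 ^ 2 + f 4 ^ 2))
    (h2 : g 2 ^ 4 = 1 / 2 * f 0 * f 4 * (f 0 ^ 2 - f 4 ^ 2))
    (h3 : g 0 ^ 4 = (f 0 ^ 2 + f 4 ^ 2) * (f 0 ^ 2 - f 4 ^ 2))
    (h4 : f 2 ^ 2 * g 2 ^ 2 = 1 / 2 * f 0 * f 4 * g 0 ^ 2) :
    polyD5TwoZero (fun n k => weightForm f g (lamD5 n k) / 2)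
      = f 2 ^ 3 * g 2 ^ 2 * g 0 ^ 2 * (f 0 ^ 2 - f 4 ^ 2) ^ 4 := by
  obtain ⟨e0_1, e1_1, e1_2, e1_3, e1_4, -, e2_2, -, e4_1, e5_1, e5_2, e6_1, e7_1, e9_1, e10_1,
    e11_1, -, -, e14_2, e14_4, e15_2, -, e27_1, e28_1⟩ :=
    h.weightForm_lamD5_of_even h0
  simp only [polyD5TwoZero, e0_1, e1_1, e1_2, e1_3, e1_4, e2_2, e4_1, e5_1, e5_2, e6_1, e7_1,
    e9_1, e10_1, e11_1, e14_2, e14_4, e15_2, e27_1, e28_1]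
  linear_combination (-5 * f 0 ^ 8 * f 2 * f 4 ^ 2 + 10 * f 0 ^ 6 * f 2 * f 4 ^ 4 + 32 * f 0 ^ 5
    * f 2 ^ 5 * f 4 + 38 * f 0 ^ 5 * f 4 * g 2 ^ 5 - 10 * f 0 ^ 4 * f 2 * f 4 ^ 6 - 12 * f 0 ^ 4
    * f 2 * f 4 * g 0 * g 2 ^ 4 - 12 * f 0 ^ 4 * f 4 ^ 2 * g 0 ^ 4 * g 2 - 20 * f 0 ^ 3 * f 2 ^ 5
    * f 4 ^ 3 + 18 * f 0 ^ 3 * f 2 ^ 2 * f 4 * g 0 ^ 2 * g 2 ^ 3 + 4 * f 0 ^ 3 * f 4 ^ 3 * g 2 ^ 5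
    - 24 * f 0 ^ 2 * f 2 ^ 9 + 36 * f 0 ^ 2 * f 2 ^ 4 * g 2 ^ 5 + 12 * f 0 ^ 2 * f 2 ^ 3 * f 4 * g
    0 ^ 3 * g 2 ^ 2 + 5 * f 0 ^ 2 * f 2 * f 4 ^ 8 - 12 * f 0 ^ 2 * f 2 * f 4 ^ 3 * g 0 * g 2 ^ 4
    - 12 * f 0 ^ 2 * f 4 ^ 4 * g 0 ^ 4 * g 2 + 6 * f 0 * f 2 ^ 5 * f 4 ^ 5 - 24 * f 0 * f 2 ^ 5 * g
    0 * g 2 ^ 4 - 24 * f 0 * f 2 ^ 4 * f 4 * g 0 ^ 4 * g 2 + 18 * f 0 * f 2 ^ 2 * f 4 ^ 3 * g 0 ^ 2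
    * g 2 ^ 3 + 24 * f 0 * g 0 * g 2 ^ 9 + 12 * f 2 ^ 9 * f 4 ^ 2 + 36 * f 2 ^ 6 * g 0 ^ 2 * g
    2 ^ 3 - f 2 * f 4 ^ 10 - 36 * f 2 * g 0 ^ 2 * g 2 ^ 8) * h1 + (19 * f 0 ^ 8 * f 4 ^ 2 * g 2 - 6
    * f 0 ^ 7 * f 2 * f 4 ^ 2 * g 0 + 6 * f 0 ^ 7 * f 4 ^ 2 * g 0 * g 2 - 9 * f 0 ^ 6 * f 2 * f
    4 ^ 2 * g 0 ^ 2 + 21 * f 0 ^ 6 * f 4 ^ 4 * g 2 - 6 * f 0 ^ 5 * f 2 ^ 3 * f 4 * g 2 ^ 2 - 12 * f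
    0 ^ 5 * f 2 * f 4 ^ 4 * g 0 + 2 * f 0 ^ 4 * f 4 ^ 6 * g 2 + 12 * f 0 ^ 4 * f 4 * g 0 * g 2 ^ 5
    - 6 * f 0 ^ 3 * f 2 * f 4 ^ 6 * g 0 - 18 * f 0 ^ 3 * f 2 * f 4 * g 0 ^ 2 * g 2 ^ 4 - 6 * f
    0 ^ 3 * f 4 ^ 6 * g 0 * g 2 - 12 * f 0 ^ 2 * f 2 ^ 3 * g 2 ^ 6 - 12 * f 0 ^ 2 * f 2 ^ 2 * f 4
    * g 0 ^ 3 * g 2 ^ 3 + 9 * f 0 ^ 2 * f 2 * f 4 ^ 6 * g 0 ^ 2 + 12 * f 0 ^ 2 * f 4 ^ 3 * g 0 * g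
    2 ^ 5 + 6 * f 0 * f 2 ^ 3 * f 4 ^ 5 * g 2 ^ 2 + 24 * f 0 * f 2 ^ 3 * f 4 * g 0 ^ 4 * g 2 ^ 2
    - 18 * f 0 * f 2 * f 4 ^ 3 * g 0 ^ 2 * g 2 ^ 4 - 12 * f 2 ^ 3 * f 4 ^ 2 * g 2 ^ 6) * h2 + (-1 /
    2 * f 0 ^ 9 * f 2 * f 4 + 2 * f 0 ^ 7 * f 2 * f 4 ^ 3 - 19 / 2 * f 0 ^ 7 * f 4 ^ 3 * g 2 + 3
    * f 0 ^ 6 * f 2 * f 4 ^ 3 * g 0 - 3 * f 0 ^ 6 * f 4 ^ 3 * g 0 * g 2 - 3 * f 0 ^ 5 * f 2 * f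
    4 ^ 5 - f 0 ^ 5 * f 4 ^ 5 * g 2 + 12 * f 0 ^ 4 * f 2 ^ 3 * f 4 ^ 2 * g 2 ^ 2 + 3 * f 0 ^ 4 * f
    2 * f 4 ^ 5 * g 0 + 3 * f 0 ^ 4 * f 4 ^ 5 * g 0 * g 2 + 2 * f 0 ^ 3 * f 2 * f 4 ^ 7 - 12 * f
    0 ^ 2 * f 2 ^ 3 * f 4 ^ 4 * g 2 ^ 2 - 1 / 2 * f 0 * f 2 * f 4 ^ 9) * h3 + (9 * f 0 ^ 8 * f 2
    * f 4 ^ 2 - f 0 ^ 8 * f 2 * g 0 ^ 2 - 9 * f 0 ^ 6 * f 2 * f 4 ^ 4 + 4 * f 0 ^ 6 * f 2 * f 4 ^ 2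
    * g 0 ^ 2 - 6 * f 0 ^ 6 * f 4 ^ 2 * g 0 ^ 2 * g 2 + 6 * f 0 ^ 5 * f 2 * f 4 ^ 2 * g 0 ^ 3 - 6
    * f 0 ^ 5 * f 4 ^ 2 * g 0 ^ 3 * g 2 - 9 * f 0 ^ 4 * f 2 * f 4 ^ 6 - 6 * f 0 ^ 4 * f 2 * f 4 ^ 4
    * g 0 ^ 2 + 22 * f 0 ^ 4 * f 4 ^ 4 * g 0 ^ 2 * g 2 + 6 * f 0 ^ 3 * f 2 * f 4 ^ 4 * g 0 ^ 3 + 6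
    * f 0 ^ 3 * f 4 ^ 4 * g 0 ^ 3 * g 2 + 9 * f 0 ^ 2 * f 2 * f 4 ^ 8 + 4 * f 0 ^ 2 * f 2 * f 4 ^ 6
    * g 0 ^ 2 + 12 * f 0 ^ 2 * f 4 ^ 6 * g 0 ^ 2 * g 2 - f 2 * f 4 ^ 8 * g 0 ^ 2) * h4

theorem polyD5TwoOne_weightForm {f g : ℤ → ℂ} (h : IsThetaPair f g) (h0 : g 4 = 0)
    (h1 : f 2 ^ 4 = 1 / 2 * f 0 * f 4 * (f 0 ^ 2 + f 4 ^ 2))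
    (h2 : g 2 ^ 4 = 1 / 2 * f 0 * f 4 * (f 0 ^ 2 - f 4 ^ 2))
    (h3 : g 0 ^ 4 = (f 0 ^ 2 + f 4 ^ 2) * (f 0 ^ 2 - f 4 ^ 2))
    (h4 : f 2 ^ 2 * g 2 ^ 2 = 1 / 2 * f 0 * f 4 * g 0 ^ 2) :
    polyD5TwoOne (fun n k => weightForm f g (lamD5 n k) / 2)
      = g 0 ^ 2 * g 2 ^ 5 * (f 0 ^ 2 - f 4 ^ 2) ^ 4 := by
  obtain ⟨-, e1_1, -, e1_3, -, -, -, -, -, e5_1, -, -, e7_1, e9_1, -, e11_1, -, -, e14_2, -,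
    e15_2, -, -, -⟩ :=
    h.weightForm_lamD5_of_even h0
  simp only [polyD5TwoOne, e1_1, e1_3, e5_1, e7_1, e9_1, e11_1, e14_2, e15_2]
  linear_combination (-16 * f 2 * g 0 ^ 2 * g 2 ^ 8) * h1
      + (-f 0 ^ 8 * g 0 ^ 2 * g 2 - 4 * f 0 ^ 6 * f 2 * f 4 ^ 2 * g 0 ^ 2
      - 4 * f 0 ^ 4 * f 2 * g 0 ^ 6 + 2 * f 0 ^ 4 * f 4 ^ 4 * g 0 ^ 2 * g 2
      - 8 * f 0 ^ 3 * f 2 * f 4 * g 0 ^ 2 * g 2 ^ 4 - 8 * f 0 ^ 3 * f 4 * g 0 ^ 2 * g 2 ^ 5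
      + 4 * f 0 ^ 2 * f 2 * f 4 ^ 6 * g 0 ^ 2 - 8 * f 0 * f 2 * f 4 ^ 3 * g 0 ^ 2 * g 2 ^ 4
      + 8 * f 0 * f 4 ^ 3 * g 0 ^ 2 * g 2 ^ 5 - f 4 ^ 8 * g 0 ^ 2 * g 2 + g 0 ^ 10 * g 2
      - 16 * g 0 ^ 2 * g 2 ^ 9) * h2
      + (-2 * f 0 ^ 7 * f 2 * f 4 * g 0 ^ 2 + 1 / 2 * f 0 ^ 7 * f 4 * g 0 ^ 2 * g 2
      + 4 * f 0 ^ 6 * f 2 ^ 3 * g 2 ^ 2 + 2 * f 0 ^ 5 * f 2 * f 4 ^ 3 * g 0 ^ 2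
      - 1 / 2 * f 0 ^ 5 * f 4 ^ 3 * g 0 ^ 2 * g 2 - 1 / 2 * f 0 ^ 3 * f 4 ^ 5 * g 0 ^ 2 * g 2
      + 1 / 2 * f 0 ^ 3 * f 4 * g 0 ^ 6 * g 2 - 4 * f 0 ^ 2 * f 2 ^ 3 * f 4 ^ 4 * g 2 ^ 2
      + 4 * f 0 ^ 2 * f 2 ^ 3 * g 0 ^ 4 * g 2 ^ 2 + 1 / 2 * f 0 * f 4 ^ 7 * g 0 ^ 2 * g 2
      - 1 / 2 * f 0 * f 4 ^ 3 * g 0 ^ 6 * g 2) * h3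
      + (4 * f 0 ^ 10 * f 2 - 8 * f 0 ^ 6 * f 2 * f 4 ^ 4 + 4 * f 0 ^ 2 * f 2 * f 4 ^ 8) * h4

/-- Only the sum of the four parts is evaluated. One quartic relation suffices: the difference of
the two sides is a multiple of it, and the resulting product no longer involves g. -/
theorem polyD5Four_weightForm {f g : ℤ → ℂ} (h : IsThetaPair f g)
    (hr : f 1 * f 3 * (g 1 ^ 2 - g 3 ^ 2) = g 1 * g 3 * (f 1 ^ 2 + f 3 ^ 2)) :
    polyD5FourZero (fun n k => weightForm f g (lamD5 n k) / 2)
      + polyD5FourOne (fun n k => weightForm f g (lamD5 n k) / 2)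
      + polyD5FourTwo (fun n k => weightForm f g (lamD5 n k) / 2)
      + polyD5FourThree (fun n k => weightForm f g (lamD5 n k) / 2)
      = f 1 * f 3 * (f 1 ^ 2 + f 3 ^ 2) * (f 1 ^ 4 + 6 * f 1 ^ 2 * f 3 ^ 2 + f 3 ^ 4)
        * (f 1 + f 3) ^ 5 * (f 1 - f 3) ^ 2 := by
  obtain ⟨e14_1, e14_3, e15_1, e16_1, e16_3, e17_1, e18_1, e19_1, e20_1, e21_1, e22_1, e23_1⟩ :=
    h.weightForm_lamD5_of_odd
  simp only [polyD5FourZero, polyD5FourOne, polyD5FourTwo, polyD5FourThree, e14_1, e14_3,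
    e15_1, e16_1, e16_3, e17_1, e18_1, e19_1, e20_1, e21_1, e22_1, e23_1]
  linear_combination (-3 / 4 * f 1 ^ 8 * g 1 ^ 3 - 3 / 2 * f 1 ^ 8 * g 1 ^ 2 * g 3 + 7 / 4 * f
    1 ^ 8 * g 1 * g 3 ^ 2 - 1 / 2 * f 1 ^ 8 * g 3 ^ 3 - 3 / 4 * f 1 ^ 7 * f 3 * g 1 ^ 3 - 3 / 4 * f
    1 ^ 7 * f 3 * g 1 ^ 2 * g 3 - 65 / 8 * f 1 ^ 7 * f 3 * g 1 * g 3 ^ 2 + 19 / 8 * f 1 ^ 7 * f 3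
    * g 3 ^ 3 - f 1 ^ 6 * f 3 ^ 2 * g 1 ^ 3 - 43 / 4 * f 1 ^ 6 * f 3 ^ 2 * g 1 ^ 2 * g 3 - 24 * f
    1 ^ 6 * f 3 ^ 2 * g 1 * g 3 ^ 2 + 121 / 8 * f 1 ^ 6 * f 3 ^ 2 * g 3 ^ 3 + 61 / 8 * f 1 ^ 5 * f
    3 ^ 3 * g 1 ^ 3 - 93 / 8 * f 1 ^ 5 * f 3 ^ 3 * g 1 ^ 2 * g 3 + 20 * f 1 ^ 5 * f 3 ^ 3 * g 1 * g
    3 ^ 2 + 131 / 4 * f 1 ^ 5 * f 3 ^ 3 * g 3 ^ 3 + 13 / 2 * f 1 ^ 4 * f 3 ^ 4 * g 1 ^ 3 + 185 / 8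
    * f 1 ^ 4 * f 3 ^ 4 * g 1 ^ 2 * g 3 + 157 / 4 * f 1 ^ 4 * f 3 ^ 4 * g 1 * g 3 ^ 2 + 121 / 2 * f
    1 ^ 4 * f 3 ^ 4 * g 3 ^ 3 + 15 / 2 * f 1 ^ 3 * f 3 ^ 5 * g 1 ^ 3 - 75 / 8 * f 1 ^ 3 * f 3 ^ 5
    * g 1 ^ 2 * g 3 + 341 / 4 * f 1 ^ 3 * f 3 ^ 5 * g 1 * g 3 ^ 2 + 651 / 4 * f 1 ^ 3 * f 3 ^ 5 * g
    3 ^ 3 + 1 / 4 * f 1 ^ 3 * g 1 ^ 8 + 9 / 4 * f 1 ^ 3 * g 1 ^ 7 * g 3 - 11 / 2 * f 1 ^ 3 * g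
    1 ^ 6 * g 3 ^ 2 + 51 / 8 * f 1 ^ 3 * g 1 ^ 5 * g 3 ^ 3 - 14 * f 1 ^ 3 * g 1 ^ 4 * g 3 ^ 4 + 15
    / 2 * f 1 ^ 3 * g 1 ^ 3 * g 3 ^ 5 - 149 / 8 * f 1 ^ 3 * g 1 ^ 2 * g 3 ^ 6 + 47 / 8 * f 1 ^ 3
    * g 3 ^ 8 - 89 / 8 * f 1 ^ 2 * f 3 ^ 6 * g 1 ^ 3 + 199 / 4 * f 1 ^ 2 * f 3 ^ 6 * g 1 ^ 2 * g 3
    - 743 / 8 * f 1 ^ 2 * f 3 ^ 6 * g 1 * g 3 ^ 2 - 151 / 8 * f 1 ^ 2 * f 3 ^ 6 * g 3 ^ 3 + 3 / 2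
    * f 1 ^ 2 * f 3 * g 1 ^ 8 - 19 / 4 * f 1 ^ 2 * f 3 * g 1 ^ 7 * g 3 + 27 / 4 * f 1 ^ 2 * f 3 * g
    1 ^ 6 * g 3 ^ 2 + 3 / 8 * f 1 ^ 2 * f 3 * g 1 ^ 5 * g 3 ^ 3 - 63 / 8 * f 1 ^ 2 * f 3 * g 1 ^ 4
    * g 3 ^ 4 + 1 / 8 * f 1 ^ 2 * f 3 * g 1 ^ 3 * g 3 ^ 5 + 229 / 4 * f 1 ^ 2 * f 3 * g 1 ^ 2 * g
    3 ^ 6 + 56 * f 1 ^ 2 * f 3 * g 1 * g 3 ^ 7 - 17 / 8 * f 1 ^ 2 * f 3 * g 3 ^ 8 - 48 * f 1 * f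
    3 ^ 7 * g 1 ^ 2 * g 3 - 67 / 4 * f 1 * f 3 ^ 7 * g 1 * g 3 ^ 2 - 1779 / 8 * f 1 * f 3 ^ 7 * g
    3 ^ 3 - 7 / 4 * f 1 * f 3 ^ 2 * g 1 ^ 8 - 31 / 8 * f 1 * f 3 ^ 2 * g 1 ^ 7 * g 3 + 41 / 2 * f 1
    * f 3 ^ 2 * g 1 ^ 6 * g 3 ^ 2 - 21 * f 1 * f 3 ^ 2 * g 1 ^ 5 * g 3 ^ 3 + 135 / 2 * f 1 * f
    3 ^ 2 * g 1 ^ 4 * g 3 ^ 4 + 265 / 4 * f 1 * f 3 ^ 2 * g 1 ^ 3 * g 3 ^ 5 + 891 / 8 * f 1 * f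
    3 ^ 2 * g 1 ^ 2 * g 3 ^ 6 - 69 / 4 * f 1 * f 3 ^ 2 * g 1 * g 3 ^ 7 - 1805 / 8 * f 1 * f 3 ^ 2
    * g 3 ^ 8 + 47 / 8 * f 3 ^ 8 * g 1 ^ 3 - 17 / 8 * f 3 ^ 8 * g 1 ^ 2 * g 3 - 1685 / 8 * f 3 ^ 8
    * g 1 * g 3 ^ 2 + 1 / 2 * f 3 ^ 3 * g 1 ^ 8 + 19 / 8 * f 3 ^ 3 * g 1 ^ 7 * g 3 - 79 / 8 * f
    3 ^ 3 * g 1 ^ 6 * g 3 ^ 2 + 83 / 2 * f 3 ^ 3 * g 1 ^ 5 * g 3 ^ 3 + 46 * f 3 ^ 3 * g 1 ^ 4 * g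
    3 ^ 4 - 339 / 2 * f 3 ^ 3 * g 1 ^ 3 * g 3 ^ 5 - 151 / 8 * f 3 ^ 3 * g 1 ^ 2 * g 3 ^ 6 - 1647 /
    8 * f 3 ^ 3 * g 1 * g 3 ^ 7 + 1 / 2 * f 3 ^ 3 * g 3 ^ 8) * hr

/-- In the application y is x at τ + 1 and z = ζ₃₂. The exponents in every monomial of this part add
up to 23 modulo 32; in the other three parts they add up to 31, 7 and 15. The factor z^32 + 1 occurs
where the sum exceeds the residue by 64. -/
theorem polyD5FourZero_smul {x y : ℕ → ℕ → ℂ} {z : ℂ} (hz : z ^ 32 = 1)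
    (h14_1 : y 14 1 = z ^ 5 * x 14 1) (h14_3 : y 14 3 = z ^ 13 * x 14 3)
    (h15_1 : y 15 1 = z ^ 13 * x 15 1) (h16_1 : y 16 1 = z ^ 29 * x 16 1)
    (h16_3 : y 16 3 = z ^ 5 * x 16 3) (h17_1 : y 17 1 = z ^ 21 * x 17 1)
    (h18_1 : y 18 1 = z ^ 29 * x 18 1) (h19_1 : y 19 1 = z ^ 21 * x 19 1)
    (h20_1 : y 20 1 = z ^ 5 * x 20 1) (h21_1 : y 21 1 = z ^ 21 * x 21 1)
    (h22_1 : y 22 1 = z ^ 29 * x 22 1) (h23_1 : y 23 1 = z ^ 13 * x 23 1) :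
    polyD5FourZero y = z ^ 23 * polyD5FourZero x := by
  simp only [polyD5FourZero, h14_1, h14_3, h15_1, h16_1, h16_3, h17_1, h18_1, h19_1, h20_1,
    h21_1, h22_1, h23_1]
  linear_combination (z ^ 23 * (-1265 * x 21 1 ^ 2 * x 23 1 + 3 * x 17 1 ^ 2 * x 15 1 + 3 * x 22 1
    * x 14 3 ^ 2 + 33 * x 22 1 * x 15 1 ^ 2 + 1149 * x 22 1 * x 21 1 * x 20 1 - 297 * x 22 1
    * x 15 1 * x 14 3 - 1742 * x 18 1 * x 23 1 * x 14 3 + 119 * x 17 1 * x 21 1 * x 23 1 - 82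
    * x 19 1 * x 17 1 * x 23 1 + 26 * x 19 1 * x 17 1 * x 15 1 + 22 * x 18 1 * x 21 1 * x 16 3
    + 1329 * x 18 1 * x 21 1 * x 20 1) + z ^ 23 * (z ^ 32 + 1) * (85 * x 22 1 * x 16 1 ^ 2 + 6
    * x 16 1 ^ 3)) * hz

theorem polyD5FourOne_smul {x y : ℕ → ℕ → ℂ} {z : ℂ} (hz : z ^ 32 = 1)
    (h14_1 : y 14 1 = z ^ 5 * x 14 1) (h14_3 : y 14 3 = z ^ 13 * x 14 3)
    (h15_1 : y 15 1 = z ^ 13 * x 15 1) (h16_1 : y 16 1 = z ^ 29 * x 16 1)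
    (h16_3 : y 16 3 = z ^ 5 * x 16 3) (h17_1 : y 17 1 = z ^ 21 * x 17 1)
    (h18_1 : y 18 1 = z ^ 29 * x 18 1) (h19_1 : y 19 1 = z ^ 21 * x 19 1)
    (h20_1 : y 20 1 = z ^ 5 * x 20 1) (h21_1 : y 21 1 = z ^ 21 * x 21 1)
    (h22_1 : y 22 1 = z ^ 29 * x 22 1) (h23_1 : y 23 1 = z ^ 13 * x 23 1) :
    polyD5FourOne y = z ^ 31 * polyD5FourOne x := by
  simp only [polyD5FourOne, h14_1, h14_3, h15_1, h16_1, h16_3, h17_1, h18_1, h19_1, h20_1,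
    h21_1, h22_1, h23_1]
  linear_combination (z ^ 31 * (9 * x 21 1 ^ 3 + x 18 1 ^ 2 * x 16 3 + 3 * x 21 1 * x 18 1 * x 14 3
    + 321 * x 19 1 * x 22 1 * x 14 3 + 747 * x 22 1 * x 18 1 * x 20 1 + 60 * x 16 1 * x 22 1
    * x 14 1 - 428 * x 16 1 * x 22 1 * x 16 3 + 100 * x 22 1 * x 18 1 * x 14 1 - 1042 * x 22 1 ^ 2
    * x 16 3 + 100 * x 21 1 ^ 2 * x 17 1 - 43 * x 16 1 ^ 2 * x 16 3 + 9 * x 17 1 ^ 2 * x 19 1 + 62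
    * x 19 1 ^ 2 * x 21 1)) * hz

theorem polyD5FourTwo_smul {x y : ℕ → ℕ → ℂ} {z : ℂ} (hz : z ^ 32 = 1)
    (h14_1 : y 14 1 = z ^ 5 * x 14 1) (h14_3 : y 14 3 = z ^ 13 * x 14 3)
    (h15_1 : y 15 1 = z ^ 13 * x 15 1) (h16_1 : y 16 1 = z ^ 29 * x 16 1)
    (h16_3 : y 16 3 = z ^ 5 * x 16 3) (h17_1 : y 17 1 = z ^ 21 * x 17 1)
    (h18_1 : y 18 1 = z ^ 29 * x 18 1) (h19_1 : y 19 1 = z ^ 21 * x 19 1)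
    (h20_1 : y 20 1 = z ^ 5 * x 20 1) (h21_1 : y 21 1 = z ^ 21 * x 21 1)
    (h22_1 : y 22 1 = z ^ 29 * x 22 1) (h23_1 : y 23 1 = z ^ 13 * x 23 1) :
    polyD5FourTwo y = z ^ 7 * polyD5FourTwo x := by
  simp only [polyD5FourTwo, h14_1, h14_3, h15_1, h16_1, h16_3, h17_1, h18_1, h19_1, h20_1,
    h21_1, h22_1, h23_1]
  linear_combination (z ^ 7 * (z ^ 32 + 1) * (x 16 1 * x 17 1 ^ 2 - 41 * x 17 1 * x 18 1 * x 21 1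
    + 33 * x 21 1 * x 17 1 * x 16 1) + z ^ 7 * (-50 * x 21 1 * x 20 1 * x 23 1 - 48 * x 21 1
    * x 16 3 * x 23 1 - 51 * x 21 1 * x 16 3 * x 14 3 + 30 * x 22 1 * x 14 1 * x 16 3 + 3 * x 22 1
    * x 14 1 * x 20 1 + 23 * x 17 1 * x 14 1 * x 23 1 - 107 * x 19 1 * x 20 1 * x 23 1 + 3 * x 17 1
    * x 14 1 * x 15 1 - 6 * x 17 1 * x 16 3 * x 14 3 + 19 * x 18 1 * x 20 1 * x 16 3 + 9 * x 22 1
    * x 14 1 ^ 2 + 140 * x 23 1 ^ 2 * x 14 3 + 60 * x 23 1 * x 14 3 ^ 2 + 45 * x 16 1 * x 16 3 ^ 2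
    - 47 * x 15 1 * x 14 3 ^ 2 + 3 * x 18 1 * x 16 3 ^ 2 - 19 * x 15 1 ^ 2 * x 14 3)) * hz

theorem polyD5FourThree_smul {x y : ℕ → ℕ → ℂ} {z : ℂ} (hz : z ^ 32 = 1)
    (h14_1 : y 14 1 = z ^ 5 * x 14 1) (h14_3 : y 14 3 = z ^ 13 * x 14 3)
    (h15_1 : y 15 1 = z ^ 13 * x 15 1) (h16_1 : y 16 1 = z ^ 29 * x 16 1)
    (h16_3 : y 16 3 = z ^ 5 * x 16 3) (h17_1 : y 17 1 = z ^ 21 * x 17 1)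
    (h18_1 : y 18 1 = z ^ 29 * x 18 1) (h19_1 : y 19 1 = z ^ 21 * x 19 1)
    (h20_1 : y 20 1 = z ^ 5 * x 20 1) (h21_1 : y 21 1 = z ^ 21 * x 21 1)
    (h22_1 : y 22 1 = z ^ 29 * x 22 1) (h23_1 : y 23 1 = z ^ 13 * x 23 1) :
    polyD5FourThree y = z ^ 15 * polyD5FourThree x := by
  simp only [polyD5FourThree, h14_1, h14_3, h15_1, h16_1, h16_3, h17_1, h18_1, h19_1, h20_1,
    h21_1, h22_1, h23_1]
  linear_combination (z ^ 15 * (x 21 1 * x 14 3 ^ 2 - 28 * x 21 1 * x 19 1 * x 16 3 - 18 * x 19 1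
    * x 15 1 * x 14 3 - 17 * x 18 1 * x 20 1 * x 14 3 + 61 * x 18 1 * x 20 1 * x 23 1 - 7 * x 18 1
    * x 14 1 * x 14 3 + 13 * x 22 1 * x 14 1 * x 15 1 + 160 * x 22 1 * x 16 3 * x 14 3 - 75
    * x 22 1 * x 16 3 * x 15 1 + 3 * x 18 1 * x 16 3 * x 14 3 + 9 * x 18 1 * x 16 3 * x 23 1 + 4
    * x 16 1 * x 14 1 * x 14 3 + 9 * x 16 1 * x 14 1 * x 15 1 + 17 * x 16 1 * x 16 3 * x 14 3 - 3
    * x 16 1 * x 20 1 * x 14 3 - 7 * x 17 1 * x 14 3 ^ 2 - 56 * x 17 1 * x 23 1 ^ 2 + 4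
    * x 17 1 ^ 2 * x 16 3 - 120 * x 21 1 ^ 2 * x 16 3) + z ^ 15 * (z ^ 32 + 1) * (3 * x 17 1
    * x 16 1 ^ 2 + 47 * x 19 1 * x 16 1 ^ 2)) * hz

/-! ### Relations between the theta series -/

theorem thetaEight_one_mul (p r : ℤ) {τ : ℂ} (hτ : 0 < τ.im) :
    thetaEight 1 (p + r) τ * thetaEight 1 (p - r) τ
      = thetaEight 1 p (2 * τ) * thetaEight 1 r (2 * τ)
        + thetaEight 1 (p + 4) (2 * τ) * thetaEight 1 (r + 4) (2 * τ) := by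
  simpa using thetaEight_mul 1 1 p r hτ

theorem thetaEight_neg_one_mul (p r : ℤ) {τ : ℂ} (hτ : 0 < τ.im) :
    thetaEight (-1) (p + r) τ * thetaEight (-1) (p - r) τ
      = thetaEight 1 p (2 * τ) * thetaEight 1 r (2 * τ)
        - thetaEight 1 (p + 4) (2 * τ) * thetaEight 1 (r + 4) (2 * τ) := by
  simpa [sub_eq_add_neg] using thetaEight_mul (-1) (-1) p r hτ

/-- The products of two theta series with even index, in terms of the theta series at `2 τ`. -/
theorem thetaEight_even_mul {τ : ℂ} (hτ : 0 < τ.im) :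
    thetaEight 1 0 τ ^ 2 = thetaEight 1 0 (2 * τ) ^ 2 + thetaEight 1 4 (2 * τ) ^ 2 ∧
    thetaEight 1 4 τ ^ 2 = 2 * thetaEight 1 0 (2 * τ) * thetaEight 1 4 (2 * τ) ∧
    thetaEight 1 0 τ * thetaEight 1 4 τ = 2 * thetaEight 1 2 (2 * τ) ^ 2 ∧
    thetaEight 1 2 τ ^ 2
      = thetaEight 1 2 (2 * τ) * (thetaEight 1 0 (2 * τ) + thetaEight 1 4 (2 * τ)) ∧
    thetaEight (-1) 0 τ ^ 2 = thetaEight 1 0 (2 * τ) ^ 2 - thetaEight 1 4 (2 * τ) ^ 2 ∧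
    thetaEight (-1) 2 τ ^ 2
      = thetaEight 1 2 (2 * τ) * (thetaEight 1 0 (2 * τ) - thetaEight 1 4 (2 * τ)) := by
  obtain ⟨-, e6, -, e8, -⟩ := (isThetaPair_thetaEight (2 * τ)).values
  have a0 := thetaEight_one_mul 0 0 hτ
  have a4 := thetaEight_one_mul 4 0 hτ
  have a04 := thetaEight_one_mul 2 (-2) hτ
  have a2 := thetaEight_one_mul 2 0 hτ
  have b0 := thetaEight_neg_one_mul 0 0 hτ
  have b2 := thetaEight_neg_one_mul 2 0 hτ
  norm_num [e6, e8, thetaEight_neg] at a0 a4 a04 a2 b0 b2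
  exact ⟨by linear_combination a0, by linear_combination a4, by linear_combination a04,
    by linear_combination a2, by linear_combination b0, by linear_combination b2⟩

/-- Writing Fₖ for the plain series at 2τ, the product formula turns both sides into F₂ (F₁² - F₃²)
(F₀ + F₄). -/
theorem thetaEight_odd_relation {τ : ℂ} (hτ : 0 < τ.im) :
    thetaEight 1 1 τ * thetaEight 1 3 τ * (thetaEight (-1) 1 τ ^ 2 - thetaEight (-1) 3 τ ^ 2)
      = thetaEight (-1) 1 τ * thetaEight (-1) 3 τ
        * (thetaEight 1 1 τ ^ 2 + thetaEight 1 3 τ ^ 2) := by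
  obtain ⟨e5, e6, e7, -⟩ := (isThetaPair_thetaEight (2 * τ)).values
  have a1 := thetaEight_one_mul 1 0 hτ
  have a3 := thetaEight_one_mul 3 0 hτ
  have a13 := thetaEight_one_mul 2 (-1) hτ
  have b1 := thetaEight_neg_one_mul 1 0 hτ
  have b3 := thetaEight_neg_one_mul 3 0 hτ
  have b13 := thetaEight_neg_one_mul 2 (-1) hτ
  norm_num [e5, e6, e7, thetaEight_neg] at a1 a3 a13 b1 b3 b13
  rw [← pow_two] at a1 a3 b1 b3
  rw [a1, a3, a13, b1, b3, b13]
  ring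

/-- The integers, sorted by parity. -/
def intParityEquiv : ℤ ⊕ ℤ ≃ ℤ where
  toFun := Sum.elim (fun n => 2 * n) fun n => 2 * n + 1
  invFun n := if n % 2 = 0 then .inl (n / 2) else .inr (n / 2)
  left_inv n := by rcases n with n | n <;> simp <;> omega
  right_inv n := by
    by_cases h : n % 2 = 0
    · simp only [h, if_true, Sum.elim_inl]; omega
    · simp only [h, if_false, Sum.elim_inr]; omega

/-- Splitting n by parity turns (8n+2k)²/4 into (8m+k)² or (8m+k+4)². -/
theorem thetaEight_two_mul_div_four (ε : ℤˣ) (k : ℤ) {τ : ℂ} (hτ : 0 < τ.im) :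
    thetaEight ε (2 * k) (τ / 4) = thetaEight 1 k τ + (ε : ℤ) * thetaEight 1 (k + 4) τ := by
  have h := (summable_thetaEightTerm ε (2 * k) (τ := τ / 4) (by simpa)).hasSum
  rw [← intParityEquiv.hasSum_iff] at h
  refine h.unique (HasSum.sum ?_ ?_)
  · refine (congrArg (HasSum · _) (funext fun n => ?_)).mpr (summable_thetaEightTerm 1 k hτ).hasSum
    simp only [intParityEquiv, Function.comp, Equiv.coe_fn_mk, Sum.elim_inl, thetaEightTerm,
      zpow_mul, one_zpow, Units.val_one, Int.cast_one, one_mul]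
    rw [show ε ^ (2 : ℤ) = 1 from Int.units_sq ε, one_zpow, Units.val_one, Int.cast_one, one_mul]
    congr 1
    push_cast
    ring
  · refine (congrArg (HasSum · _) (funext fun n => ?_)).mpr
      ((summable_thetaEightTerm 1 (k + 4) hτ).hasSum.mul_left ((ε : ℤ) : ℂ))
    simp only [intParityEquiv, Function.comp, Equiv.coe_fn_mk, Sum.elim_inr, thetaEightTerm,
      zpow_add, zpow_mul, zpow_one, one_zpow, Units.val_one, Int.cast_one, one_mul]
    rw [show ε ^ (2 : ℤ) = 1 from Int.units_sq ε, one_zpow, one_mul]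
    congr 2
    push_cast
    ring

/-- The two theta series at `τ / 4` whose index runs over all odd numbers, up to sign. -/
theorem thetaEight_two_div_four {τ : ℂ} (hτ : 0 < τ.im) :
    thetaEight 1 2 (τ / 4) = thetaEight 1 1 τ + thetaEight 1 3 τ ∧
    thetaEight (-1) 2 (τ / 4) = thetaEight 1 1 τ - thetaEight 1 3 τ := by
  have h5 := (isThetaPair_thetaEight τ).values.1
  have a := thetaEight_two_mul_div_four 1 1 hτ
  have b := thetaEight_two_mul_div_four (-1) 1 hτ
  norm_num [h5] at a b
  exact ⟨a, by rw [b, sub_eq_add_neg]⟩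

/-- The relations needed by the three polynomial identities arise by expressing all squares, and
f(0) f(4), through the series at 2τ, where they hold identically. -/
theorem weightForm_thetaEight_cubic {τ : ℂ} (hτ : 0 < τ.im) :
    polyD5One (fun n k => thetaD5 (lamD5 n k) τ) = thetaEight (-1) 2 τ ^ 2
      * thetaEight (-1) 0 τ ^ 5 * (thetaEight 1 0 τ ^ 2 - thetaEight 1 4 τ ^ 2) ^ 4 ∧
    polyD5TwoZero (fun n k => thetaD5 (lamD5 n k) τ) = thetaEight 1 2 τ ^ 3
      * thetaEight (-1) 2 τ ^ 2 * thetaEight (-1) 0 τ ^ 2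
      * (thetaEight 1 0 τ ^ 2 - thetaEight 1 4 τ ^ 2) ^ 4 ∧
    polyD5TwoOne (fun n k => thetaD5 (lamD5 n k) τ) = thetaEight (-1) 0 τ ^ 2
      * thetaEight (-1) 2 τ ^ 5 * (thetaEight 1 0 τ ^ 2 - thetaEight 1 4 τ ^ 2) ^ 4 := by
  have hp := isThetaPair_thetaEight τ
  obtain ⟨r1, r2, r3, r4, r5, r6⟩ := thetaEight_even_mul hτ
  simp only [thetaD5_eq_weightForm _ hτ]
  set F0 := thetaEight 1 0 (2 * τ)
  set F2 := thetaEight 1 2 (2 * τ)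
  set F4 := thetaEight 1 4 (2 * τ)
  have h1 : thetaEight 1 2 τ ^ 4 = 1 / 2 * thetaEight 1 0 τ * thetaEight 1 4 τ
      * (thetaEight 1 0 τ ^ 2 + thetaEight 1 4 τ ^ 2) := by
    rw [show 4 = 2 * 2 from rfl, pow_mul, r4, r1, r2, mul_assoc (1 / 2 : ℂ), r3]; ring
  have h2 : thetaEight (-1) 2 τ ^ 4 = 1 / 2 * thetaEight 1 0 τ * thetaEight 1 4 τ
      * (thetaEight 1 0 τ ^ 2 - thetaEight 1 4 τ ^ 2) := by
    rw [show 4 = 2 * 2 from rfl, pow_mul, r6, r1, r2, mul_assoc (1 / 2 : ℂ), r3]; ring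
  have h3 : thetaEight (-1) 0 τ ^ 4 = (thetaEight 1 0 τ ^ 2 + thetaEight 1 4 τ ^ 2)
      * (thetaEight 1 0 τ ^ 2 - thetaEight 1 4 τ ^ 2) := by
    rw [show 4 = 2 * 2 from rfl, pow_mul, r5, r1, r2]; ring
  have h4 : thetaEight 1 2 τ ^ 2 * thetaEight (-1) 2 τ ^ 2
      = 1 / 2 * thetaEight 1 0 τ * thetaEight 1 4 τ * thetaEight (-1) 0 τ ^ 2 := by
    rw [r4, r6, r5, mul_assoc (1 / 2 : ℂ), r3]; ring
  have h5 : thetaEight 1 2 τ ^ 2 * thetaEight (-1) 0 τ ^ 2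
      = (thetaEight 1 0 τ ^ 2 + thetaEight 1 4 τ ^ 2) * thetaEight (-1) 2 τ ^ 2 := by
    rw [r4, r6, r5, r1, r2]; ring
  have h6 : thetaEight (-1) 0 τ ^ 2 * thetaEight (-1) 2 τ ^ 2
      = (thetaEight 1 0 τ ^ 2 - thetaEight 1 4 τ ^ 2) * thetaEight 1 2 τ ^ 2 := by
    rw [r4, r6, r5, r1, r2]; ring
  have h0 := thetaEight_neg_one_four τ
  exact ⟨polyD5One_weightForm hp h0 h1 h2 h3 h4 h5 h6, polyD5TwoZero_weightForm hp h0 h1 h2 h3 h4,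
    polyD5TwoOne_weightForm hp h0 h1 h2 h3 h4⟩

/-- With u = f(1) + f(3) and v = f(1) - f(3), the value found in `polyD5Four_weightForm` is u⁵ v²
(u⁸ - v⁸) / 16. Here u and v are series at τ/4 whose squares are F₂ (F₀ ± F₄) at τ/2, so u⁸ - v⁸ = 8
F₂⁴ F₀ F₄ (F₀² + F₄²) = 16 F₂⁸. -/
theorem polyD5Four_thetaD5 {τ : ℂ} (hτ : 0 < τ.im) :
    polyD5FourZero (fun n k => thetaD5 (lamD5 n k) τ)
      + polyD5FourOne (fun n k => thetaD5 (lamD5 n k) τ)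
      + polyD5FourTwo (fun n k => thetaD5 (lamD5 n k) τ)
      + polyD5FourThree (fun n k => thetaD5 (lamD5 n k) τ)
      = thetaEight 1 2 (τ / 2) ^ 8 * thetaEight 1 2 (τ / 4) ^ 5
        * thetaEight (-1) 2 (τ / 4) ^ 2 := by
  simp only [thetaD5_eq_weightForm _ hτ]
  rw [polyD5Four_weightForm (isThetaPair_thetaEight τ) (thetaEight_odd_relation hτ)]
  have hσ : 0 < (τ / 4).im := by simpa
  obtain ⟨r1, r2, r3, r4, r5, r6⟩ := thetaEight_even_mul hσ
  rw [show 2 * (τ / 4) = τ / 2 by ring] at *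
  obtain ⟨hu, hv⟩ := thetaEight_two_div_four hτ
  set u := thetaEight 1 2 (τ / 4)
  set v := thetaEight (-1) 2 (τ / 4)
  set F0 := thetaEight 1 0 (τ / 2)
  set F2 := thetaEight 1 2 (τ / 2)
  set F4 := thetaEight 1 4 (τ / 2)
  have e1 : thetaEight 1 1 τ = (u + v) / 2 := by rw [hu, hv]; ring
  have e3 : thetaEight 1 3 τ = (u - v) / 2 := by rw [hu, hv]; ring
  have key : u ^ 8 - v ^ 8 = 16 * F2 ^ 8 := by
    have hσ2 : 0 < (τ / 2).im := by simpa
    obtain ⟨s1, s2, s3, s4, -⟩ := thetaEight_even_mul hσ2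
    have h1 : F2 ^ 4 = 1 / 2 * F0 * F4 * (F0 ^ 2 + F4 ^ 2) := by
      rw [show 4 = 2 * 2 from rfl, pow_mul, s4, s1, s2, mul_assoc (1 / 2 : ℂ), s3]; ring
    rw [show 8 = 2 * 4 from rfl, pow_mul, pow_mul v, r4, r6]
    linear_combination (-16) * F2 ^ 4 * h1
  rw [e1, e3]
  linear_combination u ^ 5 * v ^ 2 / 16 * key

/-! ### Translation of `τ` by integers -/

theorem zetaRoot_pow_self {n : ℕ} (hn : n ≠ 0) : zetaRoot n ^ n = 1 := by
  rw [zetaRoot, ← Complex.exp_nat_mul, mul_div_cancel₀ _ (Nat.cast_ne_zero.mpr hn),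
    Complex.exp_two_pi_mul_I]

theorem zetaRoot_mul_pow {m n : ℕ} (hm : m ≠ 0) : zetaRoot (m * n) ^ m = zetaRoot n := by
  rw [zetaRoot, zetaRoot, ← Complex.exp_nat_mul]
  congr 1
  rw [Nat.cast_mul, ← mul_div_assoc, mul_div_mul_left _ _ (Nat.cast_ne_zero.mpr hm)]

theorem zetaRoot_ne_zero (n : ℕ) : zetaRoot n ≠ 0 := Complex.exp_ne_zero _

theorem zetaRoot_two : zetaRoot 2 = -1 := by
  rw [zetaRoot, Nat.cast_ofNat, mul_assoc, mul_div_cancel_left₀ _ two_ne_zero,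
    Complex.exp_pi_mul_I]

/-- The translation exchanges f and g at odd indices, with phases ζ₃₂ at 1 and ζ₃₂⁹ at 3. Sums of
the two products are preserved up to the phase, and differences acquire an additional -1 = ζ₃₂¹⁶. -/
theorem thetaD5_add_one {τ : ℂ} (hτ : 0 < τ.im) :
    thetaD5 (lamD5 14 1) (τ + 1) = zetaRoot 32 ^ 5 * thetaD5 (lamD5 14 1) τ ∧
    thetaD5 (lamD5 14 3) (τ + 1) = zetaRoot 32 ^ 13 * thetaD5 (lamD5 14 3) τ ∧
    thetaD5 (lamD5 15 1) (τ + 1) = zetaRoot 32 ^ 13 * thetaD5 (lamD5 15 1) τ ∧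
    thetaD5 (lamD5 16 1) (τ + 1) = zetaRoot 32 ^ 29 * thetaD5 (lamD5 16 1) τ ∧
    thetaD5 (lamD5 16 3) (τ + 1) = zetaRoot 32 ^ 5 * thetaD5 (lamD5 16 3) τ ∧
    thetaD5 (lamD5 17 1) (τ + 1) = zetaRoot 32 ^ 21 * thetaD5 (lamD5 17 1) τ ∧
    thetaD5 (lamD5 18 1) (τ + 1) = zetaRoot 32 ^ 29 * thetaD5 (lamD5 18 1) τ ∧
    thetaD5 (lamD5 19 1) (τ + 1) = zetaRoot 32 ^ 21 * thetaD5 (lamD5 19 1) τ ∧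
    thetaD5 (lamD5 20 1) (τ + 1) = zetaRoot 32 ^ 5 * thetaD5 (lamD5 20 1) τ ∧
    thetaD5 (lamD5 21 1) (τ + 1) = zetaRoot 32 ^ 21 * thetaD5 (lamD5 21 1) τ ∧
    thetaD5 (lamD5 22 1) (τ + 1) = zetaRoot 32 ^ 29 * thetaD5 (lamD5 22 1) τ ∧
    thetaD5 (lamD5 23 1) (τ + 1) = zetaRoot 32 ^ 13 * thetaD5 (lamD5 23 1) τ := by
  have hz : zetaRoot 32 ^ 16 + 1 = 0 := by
    rw [show 32 = 16 * 2 from rfl, zetaRoot_mul_pow (by norm_num), zetaRoot_two, neg_add_cancel]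
  have hτ1 : 0 < (τ + 1).im := by simpa
  have hexp (k : ℕ) : Complex.exp (Real.pi * Complex.I * (k ^ 2 / 16)) = zetaRoot 32 ^ k ^ 2 := by
    rw [zetaRoot, ← Complex.exp_nat_mul]
    congr 1
    push_cast
    ring
  have s1 (ε : ℤˣ) : thetaEight ε 1 (τ + 1) = zetaRoot 32 * thetaEight (-ε) 1 τ := by
    have := hexp 1
    rw [thetaEight_add_one]
    simp_all
  have s3 (ε : ℤˣ) : thetaEight ε 3 (τ + 1) = zetaRoot 32 ^ 9 * thetaEight (-ε) 3 τ := by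
    have := hexp 3
    rw [thetaEight_add_one, show (-1 : ℤˣ) ^ (3 : ℤ) = -1 from rfl]
    simp_all
  have hp := (isThetaPair_thetaEight τ).weightForm_lamD5_of_odd
  have hp1 := (isThetaPair_thetaEight (τ + 1)).weightForm_lamD5_of_odd
  simp only [s1, s3, neg_neg] at hp1
  simp only [thetaD5_eq_weightForm _ hτ, thetaD5_eq_weightForm _ hτ1, hp, hp1]
  set z := zetaRoot 32
  set F1 := thetaEight 1 1 τ
  set F3 := thetaEight 1 3 τ
  set G1 := thetaEight (-1) 1 τ
  set G3 := thetaEight (-1) 3 τ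
  exact ⟨by ring,
    by linear_combination z ^ 13 * (z ^ 16 - 1) * (F3 ^ 5 + G3 ^ 5) / 2 * hz,
    by ring,
    by linear_combination -(z ^ 13) * (F1 ^ 4 * F3 - G1 ^ 4 * G3) / 2 * hz,
    by linear_combination z ^ 5 * (z ^ 16 - 1) * (F1 * F3 ^ 4 + G1 * G3 ^ 4) / 2 * hz,
    by linear_combination -(z ^ 5) * (F1 ^ 5 - G1 ^ 5) / 2 * hz,
    by linear_combination -(z ^ 29) * (F3 ^ 5 - G3 ^ 5) / 2 * hz,
    by ring,
    by linear_combination -(z ^ 5) * (F1 ^ 3 * F3 ^ 2 - G1 ^ 3 * G3 ^ 2) / 2 * hz,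
    by linear_combination -(z ^ 21) * (F1 * F3 ^ 4 - G1 * G3 ^ 4) / 2 * hz,
    by ring,
    by linear_combination -(z ^ 13) * (F1 ^ 2 * F3 ^ 3 - G1 ^ 2 * G3 ^ 3) / 2 * hz⟩

theorem polyD5Four_add_nat (b : ℕ) {τ : ℂ} (hτ : 0 < τ.im) :
    polyD5FourZero (fun n k => thetaD5 (lamD5 n k) (τ + b))
      = zetaRoot 32 ^ (23 * b) * polyD5FourZero (fun n k => thetaD5 (lamD5 n k) τ) ∧
    polyD5FourOne (fun n k => thetaD5 (lamD5 n k) (τ + b))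
      = zetaRoot 32 ^ (31 * b) * polyD5FourOne (fun n k => thetaD5 (lamD5 n k) τ) ∧
    polyD5FourTwo (fun n k => thetaD5 (lamD5 n k) (τ + b))
      = zetaRoot 32 ^ (7 * b) * polyD5FourTwo (fun n k => thetaD5 (lamD5 n k) τ) ∧
    polyD5FourThree (fun n k => thetaD5 (lamD5 n k) (τ + b))
      = zetaRoot 32 ^ (15 * b) * polyD5FourThree (fun n k => thetaD5 (lamD5 n k) τ) := by
  induction b with
  | zero => simp
  | succ b ih =>
    have hb : 0 < (τ + b).im := by simpa
    obtain ⟨e14_1, e14_3, e15_1, e16_1, e16_3, e17_1, e18_1, e19_1, e20_1, e21_1, e22_1, e23_1⟩ :=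
      thetaD5_add_one hb
    have hz := zetaRoot_pow_self (n := 32) (by norm_num)
    obtain ⟨i0, i1, i2, i3⟩ := ih
    rw [show τ + (b + 1 : ℕ) = τ + b + 1 by push_cast; ring]
    let x : ℕ → ℕ → ℂ := fun n k => thetaD5 (lamD5 n k) (τ + b)
    refine ⟨?_, ?_, ?_, ?_⟩
    · rw [polyD5FourZero_smul (x := x) (y := fun n k => thetaD5 (lamD5 n k) (τ + b + 1)) hz
        e14_1 e14_3 e15_1 e16_1 e16_3 e17_1 e18_1 e19_1 e20_1 e21_1 e22_1 e23_1, i0]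
      ring
    · rw [polyD5FourOne_smul (x := x) (y := fun n k => thetaD5 (lamD5 n k) (τ + b + 1)) hz
        e14_1 e14_3 e15_1 e16_1 e16_3 e17_1 e18_1 e19_1 e20_1 e21_1 e22_1 e23_1, i1]
      ring
    · rw [polyD5FourTwo_smul (x := x) (y := fun n k => thetaD5 (lamD5 n k) (τ + b + 1)) hz
        e14_1 e14_3 e15_1 e16_1 e16_3 e17_1 e18_1 e19_1 e20_1 e21_1 e22_1 e23_1, i2]
      ring
    · rw [polyD5FourThree_smul (x := x) (y := fun n k => thetaD5 (lamD5 n k) (τ + b + 1)) hz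
        e14_1 e14_3 e15_1 e16_1 e16_3 e17_1 e18_1 e19_1 e20_1 e21_1 e22_1 e23_1, i3]
      ring

/-! ### The cubic forms as eta quotients -/

/-- The sum of the four parts of the cubic forms for `d = 4` is an eta quotient. -/
theorem polyD5Four_eq_eta {τ : ℂ} (hτ : 0 < τ.im) :
    polyD5FourZero (fun n k => thetaD5 (lamD5 n k) τ)
      + polyD5FourOne (fun n k => thetaD5 (lamD5 n k) τ)
      + polyD5FourTwo (fun n k => thetaD5 (lamD5 n k) τ)
      + polyD5FourThree (fun n k => thetaD5 (lamD5 n k) τ)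
      = ModularForm.eta τ ^ 18 / ModularForm.eta (τ / 4) ^ 3 := by
  have h2 : 0 < (τ / 2).im := by simpa
  have h4 : 0 < (τ / 4).im := by simpa
  have a1 := thetaEight_one_two_mul_eta h2
  have a2 := thetaEight_one_two_mul_eta h4
  have a3 := thetaEight_neg_one_two_mul_eta h4
  rw [show 2 * (τ / 2) = τ by ring] at a1
  rw [show 2 * (τ / 4) = τ / 2 by ring] at a2 a3
  rw [show 4 * (τ / 4) = τ by ring] at a3
  have n1 := eta_ne_zero_of_im_pos hτ
  have n2 := eta_ne_zero_of_im_pos h2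
  have n4 := eta_ne_zero_of_im_pos h4
  rw [polyD5Four_thetaD5 hτ, eq_div_of_mul_eq n2 a1, eq_div_of_mul_eq n4 a2,
    eq_div_of_mul_eq n2 a3]
  field_simp

/-- This factor equals (g(0) g(2) / f(2))², and all three series are known eta quotients. -/
theorem thetaEight_sq_sub_sq {τ : ℂ} (hτ : 0 < τ.im) :
    thetaEight 1 0 τ ^ 2 - thetaEight 1 4 τ ^ 2
      = ModularForm.eta τ ^ 4 / ModularForm.eta (2 * τ) ^ 2 := by
  obtain ⟨r1, r2, -, r4, r5, r6⟩ := thetaEight_even_mul hτ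
  have n1 := eta_ne_zero_of_im_pos hτ
  have n2 : ModularForm.eta (2 * τ) ≠ 0 := eta_ne_zero_of_im_pos (by simpa)
  have n4 : ModularForm.eta (4 * τ) ≠ 0 := eta_ne_zero_of_im_pos (by simpa)
  have h6 : thetaEight (-1) 0 τ ^ 2 * thetaEight (-1) 2 τ ^ 2
      = (thetaEight 1 0 τ ^ 2 - thetaEight 1 4 τ ^ 2) * thetaEight 1 2 τ ^ 2 := by
    rw [r4, r6, r5, r1, r2]; ring
  rw [eq_div_of_mul_eq n1 (thetaEight_one_two_mul_eta hτ),
    eq_div_of_mul_eq n2 (thetaEight_neg_one_two_mul_eta hτ),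
    eq_div_of_mul_eq n4 (thetaEight_neg_one_zero_mul_eta hτ)] at h6
  generalize ModularForm.eta (2 * τ) = e2, ModularForm.eta (4 * τ) = e4 at *
  field_simp at h6 ⊢
  linear_combination -h6

theorem polyD5_eq_eta {τ : ℂ} (hτ : 0 < τ.im) :
    polyD5One (fun n k => thetaD5 (lamD5 n k) τ)
      = ModularForm.eta τ ^ 18 / ModularForm.eta (4 * τ) ^ 3 ∧
    polyD5TwoZero (fun n k => thetaD5 (lamD5 n k) τ) = ModularForm.eta τ ^ 15 ∧
    polyD5TwoOne (fun n k => thetaD5 (lamD5 n k) τ)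
      = ModularForm.eta τ ^ 21 * ModularForm.eta (4 * τ) ^ 3 / ModularForm.eta (2 * τ) ^ 9 := by
  have n1 := eta_ne_zero_of_im_pos hτ
  have n2 : ModularForm.eta (2 * τ) ≠ 0 := eta_ne_zero_of_im_pos (by simpa)
  have n4 : ModularForm.eta (4 * τ) ≠ 0 := eta_ne_zero_of_im_pos (by simpa)
  obtain ⟨h1, h2, h3⟩ := weightForm_thetaEight_cubic hτ
  rw [h1, h2, h3, thetaEight_sq_sub_sq hτ, eq_div_of_mul_eq n1 (thetaEight_one_two_mul_eta hτ),
    eq_div_of_mul_eq n2 (thetaEight_neg_one_two_mul_eta hτ),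
    eq_div_of_mul_eq n4 (thetaEight_neg_one_zero_mul_eta hτ)]
  generalize ModularForm.eta (2 * τ) = e2, ModularForm.eta (4 * τ) = e4 at *
  refine ⟨?_, ?_, ?_⟩ <;> field_simp

theorem etaQuotient_one_zero (r : ℕ) (τ : ℂ) :
    etaQuotient r 1 0 τ = ModularForm.eta τ ^ (r + 1) / ModularForm.eta (4 * τ) := by
  rw [etaQuotient]; congr 2; norm_num

theorem etaQuotient_two_zero (r : ℕ) {τ : ℂ} (hτ : 0 < τ.im) :
    etaQuotient r 2 0 τ = ModularForm.eta τ ^ r := by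
  have n1 := eta_ne_zero_of_im_pos hτ
  rw [etaQuotient, show ((4 / (2 : ℕ) * τ + (0 : ℕ)) / (2 : ℕ) : ℂ) = τ by push_cast; ring, pow_succ]
  field_simp

theorem eta_add_half_eq {τ : ℂ} (hτ : 0 < τ.im) :
    ModularForm.eta (τ + 1 / 2) = zetaRoot 48 * ModularForm.eta (2 * τ) ^ 3
      / (ModularForm.eta τ * ModularForm.eta (4 * τ)) :=
  eq_div_of_mul_eq (mul_ne_zero (eta_ne_zero_of_im_pos hτ) (eta_ne_zero_of_im_pos (by simpa)))
    (by rw [← mul_assoc]; exact eta_add_half hτ)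

theorem etaQuotient_two_one (r : ℕ) {τ : ℂ} (hτ : 0 < τ.im) :
    etaQuotient r 2 1 τ = (zetaRoot 48)⁻¹ * (ModularForm.eta τ ^ (r + 2)
      * ModularForm.eta (4 * τ) / ModularForm.eta (2 * τ) ^ 3) := by
  rw [etaQuotient, show ((4 / (2 : ℕ) * τ + (1 : ℕ)) / (2 : ℕ) : ℂ) = τ + 1 / 2 by push_cast; ring,
    eta_add_half_eq hτ]
  have n1 := eta_ne_zero_of_im_pos hτ
  have n2 : ModularForm.eta (2 * τ) ≠ 0 := eta_ne_zero_of_im_pos (by simpa)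
  have n4 : ModularForm.eta (4 * τ) ≠ 0 := eta_ne_zero_of_im_pos (by simpa)
  have nz := zetaRoot_ne_zero 48
  generalize ModularForm.eta (2 * τ) = e2, ModularForm.eta (4 * τ) = e4 at *
  field_simp
  ring

theorem etaQuotient_four (r b : ℕ) (τ : ℂ) : etaQuotient r 4 b τ
    = ModularForm.eta τ ^ (r + 1) / ModularForm.eta ((τ + b) / 4) := by
  rw [etaQuotient]; congr 2; norm_num

theorem eta_add_nat (b : ℕ) (τ : ℂ) :
    ModularForm.eta (τ + b) = zetaRoot 24 ^ b * ModularForm.eta τ := by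
  induction b with
  | zero => simp
  | succ b ih =>
    rw [show τ + (b + 1 : ℕ) = τ + b + 1 by push_cast; ring, eta_add_one, ih]
    ring

/-- The identity for b = 0 is evaluated at τ + b. The prefactor ζ₄^(-3b) compensates η(τ+b)^18 =
ζ₂₄^(18b) η(τ)^18, and the part Gⱼ contributes ζ₃₂^((23+8j)b) = ζ₃₂^(23b) ζ₄^(jb). -/
theorem etaQuotient_cube_eq_of_four (b : ℕ) {τ : ℂ} (hτ : 0 < τ.im) :
    etaQuotient 5 4 b τ ^ 3 = cubeThetaTildeD5 4 b τ := by
  have hb : 0 < (τ + b).im := by simpa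
  have h := polyD5Four_eq_eta hb
  obtain ⟨h0, h1, h2, h3⟩ := polyD5Four_add_nat b hτ
  rw [h0, h1, h2, h3, eta_add_nat, mul_pow, ← pow_mul] at h
  have z8 : zetaRoot 32 ^ 8 = zetaRoot 4 := zetaRoot_mul_pow (m := 8) (n := 4) (by norm_num)
  have z32 := zetaRoot_pow_self (n := 32) (by norm_num)
  have z6 : zetaRoot 24 ^ 6 = zetaRoot 4 := zetaRoot_mul_pow (m := 6) (n := 4) (by norm_num)
  have z18 : zetaRoot 24 ^ (b * 18) = zetaRoot 4 ^ (3 * b) := by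
    rw [← z6, ← pow_mul]; ring_nf
  have e1 : zetaRoot 32 ^ (31 * b) = zetaRoot 32 ^ (23 * b) * zetaRoot 4 ^ b := by
    rw [← z8]; ring
  have e2 : zetaRoot 32 ^ (7 * b) = zetaRoot 32 ^ (23 * b) * zetaRoot 4 ^ (2 * b) := by
    rw [← z8, ← pow_mul, ← pow_add, show 23 * b + 8 * (2 * b) = 7 * b + 32 * b by ring, pow_add,
      pow_mul _ 32, z32, one_pow, mul_one]
  have e3 : zetaRoot 32 ^ (15 * b) = zetaRoot 32 ^ (23 * b) * zetaRoot 4 ^ (3 * b) := by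
    rw [← z8, ← pow_mul, ← pow_add, show 23 * b + 8 * (3 * b) = 15 * b + 32 * b by ring, pow_add,
      pow_mul _ 32, z32, one_pow, mul_one]
  rw [z18, e1, e2, e3, mul_div_assoc] at h
  have hz : zetaRoot 4 ^ (3 * b) ≠ 0 := pow_ne_zero _ (zetaRoot_ne_zero 4)
  rw [etaQuotient_four, cubeThetaTildeD5, div_pow, ← pow_mul, zpow_neg,
    show (3 * b : ℤ) = (3 * b : ℕ) by push_cast; rfl, zpow_natCast]
  refine mul_left_cancel₀ hz ?_
  rw [← h]
  field_simp

theorem etaQuotient_cube_eq {a b d : ℕ} (had : a * d = 4) (hb : b < d) {τ : ℂ} (hτ : 0 < τ.im) :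
    etaQuotient 5 d b τ ^ 3 = cubeThetaTildeD5 d b τ := by
  obtain ⟨h1, h2, h3⟩ := polyD5_eq_eta hτ
  have hd : d ∈ Nat.divisors 4 := Nat.mem_divisors.mpr ⟨⟨a, by rw [← had, mul_comm]⟩, by norm_num⟩
  rw [show Nat.divisors 4 = {1, 2, 4} by decide] at hd
  simp only [Finset.mem_insert, Finset.mem_singleton] at hd
  rcases hd with rfl | rfl | rfl
  · obtain rfl : b = 0 := by omega
    rw [etaQuotient_one_zero, div_pow, ← pow_mul]
    exact h1.symm
  · interval_cases b
    · rw [etaQuotient_two_zero _ hτ, ← pow_mul]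
      exact h2.symm
    · rw [etaQuotient_two_one _ hτ, mul_pow, inv_pow,
        show zetaRoot 48 ^ 3 = zetaRoot 16 from zetaRoot_mul_pow (m := 3) (n := 16) (by norm_num),
        div_pow, mul_pow, ← pow_mul, ← pow_mul]
      change _ = (zetaRoot 16)⁻¹ * polyD5TwoOne (fun n k => thetaD5 (lamD5 n k) τ)
      rw [h3]
  · exact etaQuotient_cube_eq_of_four b hτ

/-! ### The transformation `τ ↦ -1/τ` -/

/-- The square root of `-i τ`, as an exponential. -/
noncomputable def sqrtNegIMul (τ : ℂ) : ℂ := Complex.exp (Complex.log (-Complex.I * τ) / 2)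

theorem neg_I_mul_ne_zero {τ : ℂ} (hτ : 0 < τ.im) : -Complex.I * τ ≠ 0 := by
  have h : τ ≠ 0 := by rintro rfl; simp at hτ
  simp [h]

theorem sqrtNegIMul_sq {τ : ℂ} (hτ : 0 < τ.im) : sqrtNegIMul τ ^ 2 = -Complex.I * τ := by
  rw [sqrtNegIMul, ← Complex.exp_nat_mul, Nat.cast_ofNat, mul_div_cancel₀ _ two_ne_zero,
    Complex.exp_log (neg_I_mul_ne_zero hτ)]

theorem sqrtNegIMul_ne_zero (τ : ℂ) : sqrtNegIMul τ ≠ 0 := Complex.exp_ne_zero _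

theorem exp_re_pos {z : ℂ} (h : |z.im| < Real.pi / 2) : 0 < (Complex.exp z).re := by
  rw [Complex.exp_re]
  exact mul_pos (Real.exp_pos _) (Real.cos_pos_of_mem_Ioo (abs_lt.mp h))

theorem abs_im_log_neg_I_mul_lt {τ : ℂ} (hτ : 0 < τ.im) :
    |(Complex.log (-Complex.I * τ)).im| < Real.pi / 2 := by
  rw [Complex.log_im, Complex.abs_arg_lt_pi_div_two_iff]
  left
  simpa

theorem sqrtNegIMul_re_pos {τ : ℂ} (hτ : 0 < τ.im) : 0 < (sqrtNegIMul τ).re := by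
  refine exp_re_pos ?_
  have h := abs_im_log_neg_I_mul_lt hτ
  have hp := Real.pi_pos
  rw [abs_lt] at h ⊢
  rw [Complex.div_ofNat_im]
  constructor <;> linarith

/-- This settles every choice of branch below: principal roots of numbers off the negative real axis
have positive real part. -/
theorem eq_of_sq_eq_of_re_pos {a b : ℂ} (h : a ^ 2 = b ^ 2) (ha : 0 < a.re) (hb : 0 < b.re) :
    a = b := by
  rcases sq_eq_sq_iff_eq_or_eq_neg.mp h with h | h
  · exact h
  · rw [h, Complex.neg_re] at ha
    linarith

theorem sqrtNegIMul_div {τ : ℂ} (hτ : 0 < τ.im) {c : ℝ} (hc : 0 < c) :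
    sqrtNegIMul (τ / (c ^ 2 : ℝ)) = sqrtNegIMul τ / c := by
  have h : 0 < (τ / (c ^ 2 : ℝ)).im := by rw [Complex.div_ofReal_im]; positivity
  refine eq_of_sq_eq_of_re_pos ?_ (sqrtNegIMul_re_pos h) ?_
  · rw [sqrtNegIMul_sq h, div_pow, sqrtNegIMul_sq hτ]
    push_cast
    ring
  · rw [Complex.div_ofReal_re]
    exact div_pos (sqrtNegIMul_re_pos hτ) hc

theorem eta_neg_one_div {τ : ℂ} (hτ : 0 < τ.im) :
    ModularForm.eta (-1 / τ) = sqrtNegIMul τ * ModularForm.eta τ := by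
  have h := ModularForm.eta_comp_eq_csqrt_I_inv hτ
  simp only [Function.comp, Pi.smul_apply, Pi.mul_apply, smul_eq_mul] at h
  rw [h, ← mul_assoc]
  congr 1
  have h0 : τ ≠ 0 := by rintro rfl; simp at hτ
  rw [sqrt_eq_exp h0, sqrt_eq_exp Complex.I_ne_zero, ← Complex.exp_neg,
    ← Complex.exp_add]
  -- The quotient of the principal roots of τ and i has argument arg(τ)/2 - π/4, which lies in
  -- [-π/4, π/4].
  refine eq_of_sq_eq_of_re_pos ?_ (exp_re_pos ?_) (sqrtNegIMul_re_pos hτ)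
  · rw [sqrtNegIMul_sq hτ, ← Complex.exp_nat_mul,
      show ((2 : ℕ) * (-(Complex.log Complex.I / 2) + Complex.log τ / 2) : ℂ)
        = -Complex.log Complex.I + Complex.log τ by push_cast; ring, Complex.exp_add,
      Complex.exp_neg, Complex.exp_log h0, Complex.exp_log Complex.I_ne_zero, Complex.inv_I]
  · have h1 := Complex.arg_mem_Ioc τ
    have h2 : 0 ≤ Complex.arg τ := Complex.arg_nonneg_iff.mpr hτ.le
    have hp := Real.pi_pos
    rw [Complex.add_im, Complex.neg_im, Complex.div_ofNat_im, Complex.div_ofNat_im, Complex.log_im,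
      Complex.log_im, Complex.arg_I, abs_lt]
    constructor <;> linarith [h1.2]

theorem sqrtNegIMul_pow_eq_cpow (r : ℕ) {τ : ℂ} (h : τ ≠ 0) :
    sqrtNegIMul τ ^ (3 * r) = (-Complex.I * τ) ^ (3 * r / 2 : ℂ) := by
  rw [Complex.cpow_def_of_ne_zero (by simpa using h), sqrtNegIMul, ← Complex.exp_nat_mul]
  congr 1
  push_cast
  ring

theorem neg_one_div_im_pos {τ : ℂ} (hτ : 0 < τ.im) : 0 < (-1 / τ).im := by
  have h := UpperHalfPlane.im_inv_neg_coe_pos ⟨τ, hτ⟩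
  have e : -1 / τ = (-τ)⁻¹ := by rw [inv_neg, neg_div, one_div]
  rw [e]
  exact h

/-- Squaring leaves only a sign. The quotient of the roots at (τ-1)/4 and (-1/τ+1)/4 has argument in
(-π/2, π/2), because each has argument in (-π/4, π/4); ζ₈ times the root at τ has argument in (0,
π/2). Both real parts are therefore positive. -/
theorem sqrtNegIMul_sub_one_div_four {τ : ℂ} (hτ : 0 < τ.im) :
    sqrtNegIMul ((τ - 1) / 4)
      = sqrtNegIMul ((-1 / τ + 1) / 4) * (zetaRoot 8 * sqrtNegIMul τ) := by
  have h0 : τ ≠ 0 := by rintro rfl; simp at hτ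
  have hA : 0 < ((-1 / τ + 1) / 4).im := by simpa using neg_one_div_im_pos hτ
  have hB : 0 < ((τ - 1) / 4).im := by simpa
  have ha := abs_lt.mp (abs_im_log_neg_I_mul_lt hA)
  have hb := abs_lt.mp (abs_im_log_neg_I_mul_lt hB)
  have hz : zetaRoot 8 = Complex.exp (Real.pi / 4 * Complex.I) := by
    rw [zetaRoot]
    congr 1
    push_cast
    ring
  have hz2 : zetaRoot 8 ^ 2 = Complex.I := by
    rw [hz, ← Complex.exp_nat_mul,
      show ((2 : ℕ) * (Real.pi / 4 * Complex.I) : ℂ) = Real.pi / 2 * Complex.I by push_cast; ring,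
      Complex.exp_pi_div_two_mul_I]
  rw [mul_comm]
  refine (div_eq_iff (sqrtNegIMul_ne_zero _)).mp (eq_of_sq_eq_of_re_pos ?_ ?_ ?_)
  · have h1 : τ - 1 ≠ 0 := by
      intro h
      rw [sub_eq_zero.mp h] at hτ
      simp at hτ
    rw [div_pow, mul_pow, sqrtNegIMul_sq hA, sqrtNegIMul_sq hB, sqrtNegIMul_sq hτ, hz2,
      div_eq_iff (neg_I_mul_ne_zero hA)]
    field_simp
    linear_combination (-(τ - 1)) * Complex.I_sq
  · rw [sqrtNegIMul, sqrtNegIMul, ← Complex.exp_sub]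
    refine exp_re_pos ?_
    rw [Complex.sub_im, Complex.div_ofNat_im, Complex.div_ofNat_im, abs_lt]
    constructor <;> linarith
  · have ht := abs_lt.mp (abs_im_log_neg_I_mul_lt hτ)
    rw [hz, sqrtNegIMul, ← Complex.exp_add]
    refine exp_re_pos ?_
    have him : (Real.pi / 4 * Complex.I : ℂ).im = Real.pi / 4 := by
      rw [show (Real.pi / 4 * Complex.I : ℂ) = ((Real.pi / 4 : ℝ) : ℂ) * Complex.I by push_cast; rfl,
        Complex.im_ofReal_mul, Complex.I_im, mul_one]
    rw [Complex.add_im, him, Complex.div_ofNat_im, abs_lt]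
    constructor <;> linarith

/-- With A = (-1/τ+1)/4 and B = (τ-1)/4 one has -1/A + 4 = -1/B and B + 1 = (τ+3)/4. Two inversions,
a translation by 4 and one by 1 connect η(A) with η((τ+3)/4), and the cube collects the roots of
unity into ζ₄. -/
theorem eta_add_three_div_four {τ : ℂ} (hτ : 0 < τ.im) :
    ModularForm.eta ((-1 / τ + 1) / 4) ^ 3 * zetaRoot 4
      = sqrtNegIMul τ ^ 3 * ModularForm.eta ((τ + 3) / 4) ^ 3 := by
  have h0 : τ ≠ 0 := by rintro rfl; simp at hτ
  have h1 : τ - 1 ≠ 0 := by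
    intro h
    rw [sub_eq_zero.mp h] at hτ
    simp at hτ
  have hA : 0 < ((-1 / τ + 1) / 4).im := by simpa using neg_one_div_im_pos hτ
  have hB : 0 < ((τ - 1) / 4).im := by simpa
  have e1 := eta_neg_one_div hA
  have e2 := eta_neg_one_div hB
  have e3 := eta_add_nat 4 (-1 / ((-1 / τ + 1) / 4))
  have e4 := eta_add_one ((τ - 1) / 4)
  have hAn : -1 + τ ≠ 0 := by rwa [neg_add_eq_sub]
  rw [show -1 / ((-1 / τ + 1) / 4) + (4 : ℕ) = -1 / ((τ - 1) / 4) by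
    rw [show -1 / τ + 1 = (τ - 1) / τ by field_simp; ring]
    field_simp
    push_cast
    ring, e2, e1, sqrtNegIMul_sub_one_div_four hτ] at e3
  rw [show (τ - 1) / 4 + 1 = (τ + 3) / 4 by ring] at e4
  have z3 : zetaRoot 24 ^ 3 = zetaRoot 8 := zetaRoot_mul_pow (m := 3) (n := 8) (by norm_num)
  have z6 : zetaRoot 24 ^ 6 = zetaRoot 4 := zetaRoot_mul_pow (m := 6) (n := 4) (by norm_num)
  have nz := zetaRoot_ne_zero 24
  have ns := sqrtNegIMul_ne_zero ((-1 / τ + 1) / 4)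
  rw [e4, ← z6]
  rw [← z3] at e3
  have e5 : zetaRoot 24 * ModularForm.eta ((-1 / τ + 1) / 4)
      = sqrtNegIMul τ * ModularForm.eta ((τ - 1) / 4) :=
    mul_left_cancel₀ (mul_ne_zero ns (pow_ne_zero 3 nz)) (by linear_combination -e3)
  have e6 := congrArg (· ^ 3) e5
  simp only [mul_pow] at e6 ⊢
  linear_combination zetaRoot 24 ^ 3 * e6

theorem sTransformationLaws_etaQuotient_cube (r : ℕ) :
    STransformationLaws (3 * r / 2) (fun d b τ => etaQuotient r d b τ ^ 3) := by
  intro τ hτ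
  have h0 : τ ≠ 0 := by rintro rfl; simp at hτ
  have hs := sqrtNegIMul_pow_eq_cpow r h0
  have hS := neg_one_div_im_pos hτ
  have h2 : 0 < (τ / 2).im := by simpa
  have h4 : 0 < (τ / 4).im := by simpa
  have n1 := eta_ne_zero_of_im_pos hτ
  have n2 := eta_ne_zero_of_im_pos h2
  have n4 := eta_ne_zero_of_im_pos h4
  have ns := sqrtNegIMul_ne_zero τ
  have s4 : sqrtNegIMul (τ / 4) = sqrtNegIMul τ / 2 := by
    have := sqrtNegIMul_div hτ (c := 2) two_pos
    norm_num at this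
    exact this
  have s2 : sqrtNegIMul (τ / 2) = sqrtNegIMul τ / (√2 : ℝ) := by
    have := sqrtNegIMul_div hτ (c := √2) (by positivity)
    rw [Real.sq_sqrt (by norm_num)] at this
    norm_num at this
    exact this
  have e4 : ModularForm.eta (4 * (-1 / τ)) = sqrtNegIMul τ / 2 * ModularForm.eta (τ / 4) := by
    rw [← s4, ← eta_neg_one_div h4]
    congr 1
    field_simp
  have e2 : ModularForm.eta (2 * (-1 / τ)) = sqrtNegIMul τ / (√2 : ℝ) * ModularForm.eta (τ / 2) := by
    rw [← s2, ← eta_neg_one_div h2]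
    congr 1
    field_simp
  have hsq : ((√2 : ℝ) : ℂ) ^ 2 = 2 := by
    rw [← Complex.ofReal_pow, Real.sq_sqrt (by norm_num)]; norm_num
  have nsq : ((√2 : ℝ) : ℂ) ≠ 0 := by
    intro h
    rw [h] at hsq
    norm_num at hsq
  refine ⟨?_, ?_, ?_, ?_⟩ <;> beta_reduce
  · rw [etaQuotient_one_zero, etaQuotient_four, e4, eta_neg_one_div hτ, ← hs, Nat.cast_zero,
      add_zero]
    field_simp
    ring
  · rw [etaQuotient_two_zero _ hS, etaQuotient_two_zero _ hτ, eta_neg_one_div hτ, ← hs]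
    ring
  -- Both sides contain η at a half-shifted point, since (τ+2)/4 = τ/4 + 1/2, so ζ₄₈ cancels. The
  -- cube of √2 is the constant 2√2.
  · have hh := eta_add_half_eq h4
    rw [show τ / 4 + 1 / 2 = (τ + (2 : ℕ)) / 4 by push_cast; ring,
      show 2 * (τ / 4) = τ / 2 by ring, show 4 * (τ / 4) = τ by ring] at hh
    rw [etaQuotient_two_one _ hS, etaQuotient_four, hh, e4, e2, eta_neg_one_div hτ, ← hs]
    have nz := zetaRoot_ne_zero 48
    generalize ((√2 : ℝ) : ℂ) = c at *
    have hc : (sqrtNegIMul τ / c * ModularForm.eta (τ / 2)) ^ 3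
        = sqrtNegIMul τ ^ 3 / (2 * c) * ModularForm.eta (τ / 2) ^ 3 := by
      field_simp
      linear_combination -hsq
    have hc3 : c ^ 3 = 2 * c := by linear_combination c * hsq
    have key : (zetaRoot 48)⁻¹ * ((sqrtNegIMul τ * ModularForm.eta τ) ^ (r + 2)
          * (sqrtNegIMul τ / 2 * ModularForm.eta (τ / 4))
          / (sqrtNegIMul τ / c * ModularForm.eta (τ / 2)) ^ 3)
        = sqrtNegIMul τ ^ r * c * (ModularForm.eta τ ^ (r + 1)
          / (zetaRoot 48 * ModularForm.eta (τ / 2) ^ 3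
            / (ModularForm.eta (τ / 4) * ModularForm.eta τ))) := by
      rw [hc]
      field_simp
      ring
    rw [key, mul_pow, mul_pow, hc3]
    ring
  · have h := eta_add_three_div_four hτ
    have n3 : ModularForm.eta ((τ + 3) / 4) ≠ 0 := eta_ne_zero_of_im_pos (by simpa)
    have n1' : ModularForm.eta ((-1 / τ + 1) / 4) ≠ 0 :=
      eta_ne_zero_of_im_pos (by simpa using hS)
    rw [etaQuotient_four, etaQuotient_four, eta_neg_one_div hτ, ← hs, Nat.cast_one,
      Nat.cast_ofNat, div_pow, div_pow, ← mul_div_assoc,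
      div_eq_div_iff (pow_ne_zero 3 n1') (pow_ne_zero 3 n3)]
    linear_combination (-(sqrtNegIMul τ ^ (3 * r) * ModularForm.eta τ ^ (3 * (r + 1)))) * h

/-! ### Orbits of weights modulo `4 M` -/

theorem reflectD5_mem_orbit (i : Fin 5) (β : WeightD5) :
    reflectD5 i β ∈ MulAction.orbit symmetryD5 β :=
  ⟨⟨(reflectD5_involutive i).toPerm (reflectD5 i),
    (le_sup_left.trans le_sup_left : weylD5 ≤ symmetryD5) (Subgroup.subset_closure ⟨i, rfl⟩)⟩, rfl⟩

theorem neg_mem_orbit (β : WeightD5) : -β ∈ MulAction.orbit symmetryD5 β :=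
  ⟨⟨Equiv.neg WeightD5, (le_sup_right.trans le_sup_left :
    Subgroup.closure {Equiv.neg WeightD5} ≤ symmetryD5) (Subgroup.subset_closure rfl)⟩, rfl⟩

theorem add_four_smul_simpleRootD5_mem_orbit (i : Fin 5) (β : WeightD5) :
    β + (4 : ℤ) • simpleRootD5 i ∈ MulAction.orbit symmetryD5 β :=
  ⟨⟨Equiv.addRight ((4 : ℤ) • simpleRootD5 i), (le_sup_right : translationsD5 ≤ symmetryD5)
    (Subgroup.subset_closure ⟨i, rfl⟩)⟩, rfl⟩

theorem mem_orbit_trans {β γ δ : WeightD5} (h : γ ∈ MulAction.orbit symmetryD5 β)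
    (h' : δ ∈ MulAction.orbit symmetryD5 γ) : δ ∈ MulAction.orbit symmetryD5 β := by
  rwa [← MulAction.orbit_eq_iff.mpr h]

theorem mem_orbit_swap {β γ : WeightD5} (h : γ ∈ MulAction.orbit symmetryD5 β) :
    β ∈ MulAction.orbit symmetryD5 γ :=
  MulAction.mem_orbit_symm.mp h

theorem foldr_add_four_smul_simpleRootD5_mem_orbit (w : List (Fin 5)) (β : WeightD5) :
    w.foldr (fun i γ => γ + (4 : ℤ) • simpleRootD5 i) β ∈ MulAction.orbit symmetryD5 β := by
  induction w with
  | nil => exact MulAction.mem_orbit_self β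
  | cons i w ih => exact mem_orbit_trans ih (add_four_smul_simpleRootD5_mem_orbit i _)

/-- The translation by four times the highest root. -/
theorem add_four_smul_highestRoot_mem_orbit (β : WeightD5) :
    β + ![0, 4, 0, 0, 0] ∈ MulAction.orbit symmetryD5 β := by
  -- The list records the multiplicities 1, 2, 2, 1, 1 of the simple roots in the highest root,
  -- which is the second fundamental weight.
  convert foldr_add_four_smul_simpleRootD5_mem_orbit [0, 1, 1, 2, 2, 3, 4] β using 1
  simp only [List.foldr_cons, List.foldr_nil, add_assoc, add_right_inj]
  decide

/-- The orbit of `β` contains a weight with the given doubled orthonormal coordinates. -/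
def CoordInOrbit (β : WeightD5) (v : Fin 5 → ℤ) : Prop :=
  ∃ γ ∈ MulAction.orbit symmetryD5 β, coordD5 γ = v

namespace CoordInOrbit

variable {β : WeightD5} {a b c d e : ℤ}

theorem self (β : WeightD5) : CoordInOrbit β (coordD5 β) :=
  ⟨β, MulAction.mem_orbit_self β, rfl⟩

theorem mem_orbit {γ : WeightD5} (h : CoordInOrbit β (coordD5 γ)) :
    γ ∈ MulAction.orbit symmetryD5 β := by
  obtain ⟨δ, hδ, hc⟩ := h
  rwa [← coordD5_injective hc]

theorem swap₀ (h : CoordInOrbit β ![a, b, c, d, e]) : CoordInOrbit β ![b, a, c, d, e] := by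
  obtain ⟨γ, hγ, hc⟩ := h
  exact ⟨_, mem_orbit_trans hγ (reflectD5_mem_orbit 0 γ), by rw [coordD5_reflectD5_zero, hc]; rfl⟩

theorem swap₁ (h : CoordInOrbit β ![a, b, c, d, e]) : CoordInOrbit β ![a, c, b, d, e] := by
  obtain ⟨γ, hγ, hc⟩ := h
  exact ⟨_, mem_orbit_trans hγ (reflectD5_mem_orbit 1 γ), by rw [coordD5_reflectD5_one, hc]; rfl⟩

theorem swap₂ (h : CoordInOrbit β ![a, b, c, d, e]) : CoordInOrbit β ![a, b, d, c, e] := by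
  obtain ⟨γ, hγ, hc⟩ := h
  exact ⟨_, mem_orbit_trans hγ (reflectD5_mem_orbit 2 γ), by rw [coordD5_reflectD5_two, hc]; rfl⟩

theorem swap₃ (h : CoordInOrbit β ![a, b, c, d, e]) : CoordInOrbit β ![a, b, c, e, d] := by
  obtain ⟨γ, hγ, hc⟩ := h
  exact ⟨_, mem_orbit_trans hγ (reflectD5_mem_orbit 3 γ), by rw [coordD5_reflectD5_three, hc]; rfl⟩

theorem neg_last_two (h : CoordInOrbit β ![a, b, c, d, e]) :
    CoordInOrbit β ![a, b, c, -d, -e] := by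
  obtain ⟨γ, hγ, hc⟩ := h.swap₃
  exact ⟨_, mem_orbit_trans hγ (reflectD5_mem_orbit 4 γ), by rw [coordD5_reflectD5_four, hc]; rfl⟩

theorem neg_all (h : CoordInOrbit β ![a, b, c, d, e]) :
    CoordInOrbit β ![-a, -b, -c, -d, -e] := by
  obtain ⟨γ, hγ, hc⟩ := h
  exact ⟨_, mem_orbit_trans hγ (neg_mem_orbit γ), by rw [coordD5_neg, hc]; simp⟩

theorem add_sub_eight (h : CoordInOrbit β ![a, b, c, d, e]) :
    CoordInOrbit β ![a, b, c, d + 8, e - 8] := by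
  obtain ⟨γ, hγ, hc⟩ := h
  refine ⟨_, mem_orbit_trans hγ (add_four_smul_simpleRootD5_mem_orbit 3 γ), ?_⟩
  rw [coordD5_add, coordD5_four_smul_simpleRootD5, hc]
  simp [sub_eq_add_neg]

theorem add_add_eight (h : CoordInOrbit β ![a, b, c, d, e]) :
    CoordInOrbit β ![a, b, c, d + 8, e + 8] := by
  obtain ⟨γ, hγ, hc⟩ := h
  refine ⟨_, mem_orbit_trans hγ (add_four_smul_simpleRootD5_mem_orbit 4 γ), ?_⟩
  rw [coordD5_add, coordD5_four_smul_simpleRootD5, hc]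
  simp

/-- The rank is odd: -1 changes five signs and the Weyl group restores four of them in pairs. A
single sign change is thus available, and with it the diagram automorphism. -/
theorem neg_last (h : CoordInOrbit β ![a, b, c, d, e]) : CoordInOrbit β ![a, b, c, d, -e] := by
  have h1 := h.neg_all.swap₃.swap₂.neg_last_two.swap₂.swap₃.swap₁.swap₂.swap₃.swap₀.swap₁.swap₂
  have h2 := h1.neg_last_two.swap₂.swap₁.swap₀.swap₃.swap₂.swap₁
  simpa only [neg_neg] using h2

end CoordInOrbit

/-- The diagram automorphism that exchanges the last two nodes. -/
theorem diagramSwap_mem_orbit (β : WeightD5) :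
    ![β 0, β 1, β 2, β 4, β 3] ∈ MulAction.orbit symmetryD5 β := by
  refine CoordInOrbit.mem_orbit ?_
  have h := (CoordInOrbit.self β).neg_last
  convert h using 1
  funext i
  fin_cases i <;> simp [coordD5] <;> ring

/-- The representatives λ₂₆, λ₁₆³ and λ₂₁ have level above four, so they lie outside the alcove.
This lemma and the next two join them to the alcove weights that are otherwise missing. -/
theorem lamD5_twentySix_mem_orbit : lamD5 26 1 ∈ MulAction.orbit symmetryD5 ![0, 0, 0, 1, 3] :=
  CoordInOrbit.mem_orbit (CoordInOrbit.self
    ![0, 0, 0, 1, 3]).neg_last_two.add_add_eight.swap₃.neg_last.swap₂.swap₁.swap₀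

theorem lamD5_sixteen_three_mem_orbit :
    lamD5 16 3 ∈ MulAction.orbit symmetryD5 ![0, 0, 0, 1, 2] :=
  CoordInOrbit.mem_orbit (CoordInOrbit.self
    ![0, 0, 0, 1, 2]).neg_last_two.add_add_eight.swap₃.add_sub_eight.swap₂.swap₁.swap₀

theorem lamD5_twentyOne_mem_orbit : lamD5 21 1 ∈ MulAction.orbit symmetryD5 ![1, 0, 0, 1, 2] := by
  have h := (CoordInOrbit.self ![1, 0, 0, 1, 2]).neg_last_two.swap₀.swap₁.swap₂.add_add_eight
  exact CoordInOrbit.mem_orbit h.swap₂.swap₁.swap₀.swap₃.swap₂.swap₁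

/-- A weight is in the closed fundamental alcove if it is dominant of level at most four. -/
def IsAlcoveD5 (β : WeightD5) : Prop :=
  (∀ i, 0 ≤ β i) ∧ β 0 + 2 * β 1 + 2 * β 2 + β 3 + β 4 ≤ 4

/-- The squared distance of `8 β` from the Weyl vector. -/
def weylDistD5 (β : WeightD5) : ℤ :=
  (4 * coordD5 β 0 - 4) ^ 2 + (4 * coordD5 β 1 - 3) ^ 2 + (4 * coordD5 β 2 - 2) ^ 2
    + (4 * coordD5 β 3 - 1) ^ 2 + (4 * coordD5 β 4) ^ 2

theorem weylDistD5_nonneg (β : WeightD5) : 0 ≤ weylDistD5 β := by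
  unfold weylDistD5
  positivity

/-- The Weyl vector pairs to 1 with each simple root, so reflecting at a negative coordinate
decreases the distance. -/
theorem weylDistD5_reflectD5 (i : Fin 5) (β : WeightD5) :
    weylDistD5 (reflectD5 i β) = weylDistD5 β + 16 * β i := by
  fin_cases i <;>
    simp [weylDistD5, coordD5_reflectD5_zero, coordD5_reflectD5_one, coordD5_reflectD5_two,
      coordD5_reflectD5_three, coordD5_reflectD5_four] <;> simp [coordD5] <;> ring

/-- The scale 8 is chosen for this formula. With N β in place of 8 β and level L the increment is 32
N² + 56 N - 8 N² L, where 7 is the height of the highest root; it is negative for all L ≥ 5 exactly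
when N > 7. -/
theorem weylDistD5_sub_highestRoot (β : WeightD5) :
    weylDistD5 (β - ![0, 4, 0, 0, 0]) = weylDistD5 β
      + (2496 - 512 * (β 0 + 2 * β 1 + 2 * β 2 + β 3 + β 4)) := by
  simp [weylDistD5, coordD5]
  ring

/-- Outside the alcove either a coordinate is negative or the level is at least five. The
corresponding reflection or translation strictly lowers a nonnegative integer, so the descent
terminates. -/
theorem exists_isAlcoveD5_mem_orbit (β : WeightD5) :
    ∃ γ, IsAlcoveD5 γ ∧ γ ∈ MulAction.orbit symmetryD5 β := by
  induction hn : (weylDistD5 β).toNat using Nat.strong_induction_on generalizing β with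
  | _ n ih =>
    have step (γ : WeightD5) (hγ : γ ∈ MulAction.orbit symmetryD5 β)
        (hlt : weylDistD5 γ < weylDistD5 β) :
        ∃ δ, IsAlcoveD5 δ ∧ δ ∈ MulAction.orbit symmetryD5 β := by
      have := weylDistD5_nonneg γ
      obtain ⟨δ, hδ, hδγ⟩ := ih (weylDistD5 γ).toNat (by omega) γ rfl
      exact ⟨δ, hδ, mem_orbit_trans hγ hδγ⟩
    by_cases h : ∀ i, 0 ≤ β i
    · by_cases h4 : β 0 + 2 * β 1 + 2 * β 2 + β 3 + β 4 ≤ 4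
      · exact ⟨β, ⟨h, h4⟩, MulAction.mem_orbit_self β⟩
      · refine step (β - ![0, 4, 0, 0, 0]) (mem_orbit_swap ?_) ?_
        · have h := add_four_smul_highestRoot_mem_orbit (β - ![0, 4, 0, 0, 0])
          rwa [sub_add_cancel] at h
        · rw [weylDistD5_sub_highestRoot]
          omega
    · push Not at h
      obtain ⟨i, hi⟩ := h
      refine step _ (reflectD5_mem_orbit i β) ?_
      rw [weylDistD5_reflectD5]
      omega

/-- Every weight of the alcove is one of the representatives, up to the diagram automorphism, with
three exceptions. -/
theorem IsAlcoveD5.eq_lamD5_or {β : WeightD5} (h : IsAlcoveD5 β) :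
    (∃ nk ∈ orbitIndicesD5, lamD5 nk.1 nk.2 = β ∨ lamD5 nk.1 nk.2 = ![β 0, β 1, β 2, β 4, β 3]) ∨
      ∃ γ ∈ [![0, 0, 0, 1, 3], ![0, 0, 0, 1, 2], ![1, 0, 0, 1, 2]],
        β = γ ∨ ![β 0, β 1, β 2, β 4, β 3] = γ := by
  have key : ∀ a ∈ Finset.range 5, ∀ b ∈ Finset.range 3, ∀ c ∈ Finset.range 3,
      ∀ d ∈ Finset.range 5, ∀ e ∈ Finset.range 5, a + 2 * b + 2 * c + d + e ≤ 4 →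
      (∃ nk ∈ orbitIndicesD5, lamD5 nk.1 nk.2 = ![(a : ℤ), b, c, d, e]
        ∨ lamD5 nk.1 nk.2 = ![(a : ℤ), b, c, e, d]) ∨
      ∃ γ ∈ [![(0 : ℤ), 0, 0, 1, 3], ![0, 0, 0, 1, 2], ![1, 0, 0, 1, 2]],
        ![(a : ℤ), b, c, d, e] = γ ∨ ![(a : ℤ), b, c, e, d] = γ := by
    decide +kernel
  obtain ⟨h0, h4⟩ := h
  obtain ⟨a, ha⟩ := Int.eq_ofNat_of_zero_le (h0 0)
  obtain ⟨b, hb⟩ := Int.eq_ofNat_of_zero_le (h0 1)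
  obtain ⟨c, hc⟩ := Int.eq_ofNat_of_zero_le (h0 2)
  obtain ⟨d, hd⟩ := Int.eq_ofNat_of_zero_le (h0 3)
  obtain ⟨e, he⟩ := Int.eq_ofNat_of_zero_le (h0 4)
  have hβ : β = ![(a : ℤ), b, c, d, e] := by
    funext i
    fin_cases i <;> simp [ha, hb, hc, hd, he]
  have hk := key a (by simp; omega) b (by simp; omega) c (by simp; omega) d (by simp; omega)
    e (by simp; omega) (by omega)
  rw [hβ]
  exact hk

/-- The left values of an integral theta pair whose weight form separates the orbits. -/
def separatingLeft (x : Fin 8) : ℤ := ![2, 7, 3, 11, 5, 11, 3, 7] x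

/-- The right values of an integral theta pair whose weight form separates the orbits. -/
def separatingRight (x : Fin 16) : ℤ :=
  ![1, 1, 1, 1, 0, -1, -1, -1, -1, -1, -1, -1, 0, 1, 1, 1] x

theorem isThetaPair_separating : IsThetaPair (R := ℤ)
    (fun k => separatingLeft (k : ZMod 8)) (fun k => separatingRight (k : ZMod 16)) where
  left_neg k := by
    have h : ∀ x : ZMod 8, separatingLeft (-x) = separatingLeft x :=
      show ∀ x : Fin 8, separatingLeft (-x) = separatingLeft x by decide
    rw [Int.cast_neg]
    exact h k
  right_neg k := by
    have h : ∀ x : ZMod 16, separatingRight (-x) = separatingRight x :=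
      show ∀ x : Fin 16, separatingRight (-x) = separatingRight x by decide
    rw [Int.cast_neg]
    exact h k
  left_add_eight k := by
    have h : ∀ x : ZMod 8, separatingLeft (x + ((8 : ℤ) : ZMod 8)) = separatingLeft x :=
      show ∀ x : Fin 8, separatingLeft (x + 8) = separatingLeft x by decide
    rw [Int.cast_add]
    exact h k
  right_add_eight k := by
    have h : ∀ x : ZMod 16, separatingRight (x + ((8 : ℤ) : ZMod 16)) = -separatingRight x :=
      show ∀ x : Fin 16, separatingRight (x + 8) = -separatingRight x by decide
    rw [Int.cast_add]
    exact h k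

/-- The left values are distinct primes, so their product records the coordinates modulo 8 up to
sign and order. The right product separates pairs such as λ₀ and λ₁⁴, which differ only in the sign
of that product. That the 39 sums are distinct is a finite check. -/
theorem eq_of_lamD5_mem_orbit {nk nk' : ℕ × ℕ} (h : nk ∈ orbitIndicesD5)
    (h' : nk' ∈ orbitIndicesD5)
    (ho : lamD5 nk.1 nk.2 ∈ MulAction.orbit symmetryD5 (lamD5 nk'.1 nk'.2)) : nk = nk' := by
  have key : ∀ nk ∈ orbitIndicesD5, ∀ nk' ∈ orbitIndicesD5,
      weightForm (fun k => separatingLeft (k : ZMod 8)) (fun k => separatingRight (k : ZMod 16))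
          (lamD5 nk.1 nk.2)
        = weightForm (fun k => separatingLeft (k : ZMod 8))
          (fun k => separatingRight (k : ZMod 16)) (lamD5 nk'.1 nk'.2) → nk = nk' := by
    decide +kernel
  exact key nk h nk' h' (isThetaPair_separating.weightForm_eq_of_mem_orbit ho)

theorem exists_lamD5_mem_orbit (β : WeightD5) :
    ∃ nk ∈ orbitIndicesD5, lamD5 nk.1 nk.2 ∈ MulAction.orbit symmetryD5 β := by
  obtain ⟨γ, hγ, hγβ⟩ := exists_isAlcoveD5_mem_orbit β
  have hswap := mem_orbit_trans hγβ (diagramSwap_mem_orbit γ)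
  rcases hγ.eq_lamD5_or with ⟨nk, hnk, h | h⟩ | ⟨δ, hδ, h⟩
  · exact ⟨nk, hnk, h ▸ hγβ⟩
  · exact ⟨nk, hnk, h ▸ hswap⟩
  · have hδβ : δ ∈ MulAction.orbit symmetryD5 β := by
      rcases h with h | h
      · exact h ▸ hγβ
      · exact h ▸ hswap
    simp only [List.mem_cons, List.not_mem_nil, or_false] at hδ
    rcases hδ with rfl | rfl | rfl
    · exact ⟨(26, 1), by decide, mem_orbit_trans hδβ lamD5_twentySix_mem_orbit⟩
    · exact ⟨(16, 3), by decide, mem_orbit_trans hδβ lamD5_sixteen_three_mem_orbit⟩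
    · exact ⟨(21, 1), by decide, mem_orbit_trans hδβ lamD5_twentyOne_mem_orbit⟩

theorem existsUnique_lamD5_mem_orbit (β : WeightD5) : ∃! nk : ℕ × ℕ,
    nk ∈ orbitIndicesD5 ∧ lamD5 nk.1 nk.2 ∈ MulAction.orbit symmetryD5 β := by
  obtain ⟨nk, hnk, h⟩ := exists_lamD5_mem_orbit β
  exact ⟨nk, ⟨hnk, h⟩, fun nk' h' =>
    eq_of_lamD5_mem_orbit h'.1 hnk (mem_orbit_trans (mem_orbit_swap h) h'.2)⟩

theorem card_orbits_symmetryD5 :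
    Nat.card (MulAction.orbitRel.Quotient symmetryD5 WeightD5) = 39 := by
  let φ : orbitIndicesD5 → MulAction.orbitRel.Quotient symmetryD5 WeightD5 :=
    fun nk => Quotient.mk _ (lamD5 nk.1.1 nk.1.2)
  have hφ : Function.Bijective φ := by
    constructor
    · intro nk nk' h
      exact Subtype.ext (eq_of_lamD5_mem_orbit nk.2 nk'.2 (Quotient.exact h))
    · intro q
      induction q using Quotient.inductionOn with
      | h β =>
        obtain ⟨nk, hnk, h⟩ := exists_lamD5_mem_orbit β
        exact ⟨⟨nk, hnk⟩, Quotient.sound h⟩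
  rw [← Nat.card_eq_of_bijective φ hφ, Nat.card_eq_fintype_card, Fintype.card_coe]
  decide

theorem mainTheorem5 :
    -- the orbits of level 4 weights, and the theta functions of the orbits
    Nat.card (MulAction.orbitRel.Quotient symmetryD5 WeightD5) = 39 ∧
    (∀ β : WeightD5, ∃! nk : ℕ × ℕ,
      nk ∈ orbitIndicesD5 ∧ lamD5 nk.1 nk.2 ∈ MulAction.orbit symmetryD5 β) ∧
    (∀ (β : WeightD5) (τ : ℂ), 0 < τ.im → Summable (thetaTermD5 β τ)) ∧
    (∀ (β γ : WeightD5) (τ : ℂ), 0 < τ.im → γ ∈ MulAction.orbit symmetryD5 β →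
      thetaD5 γ τ = thetaD5 β τ) ∧
    -- the cubes of the eta quotients are the explicit cubic forms in the theta functions
    (∀ a b d : ℕ, a * d = 4 → b < d → ∀ τ : ℂ, 0 < τ.im →
      etaQuotient 5 d b τ
        = ModularForm.eta τ ^ 6 / ModularForm.eta ((a * τ + b) / d) ∧
      etaQuotient 5 d b τ ^ 3 = cubeThetaTildeD5 d b τ) ∧
    -- the transformation laws, which are those of the case `A₃` up to the weight
    STransformationLaws (15 / 2) cubeThetaTildeD5 ∧
    STransformationLaws (15 / 2) (fun d b τ => etaQuotient 5 d b τ ^ 3) ∧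
    STransformationLaws (9 / 2) (fun d b τ => etaQuotient 3 d b τ ^ 3) := by
  have hcube (a b d : ℕ) (had : a * d = 4) (hb : b < d) {τ : ℂ} (hτ : 0 < τ.im) :=
    etaQuotient_cube_eq had hb hτ
  have h5 := sTransformationLaws_etaQuotient_cube 5
  have h3 := sTransformationLaws_etaQuotient_cube 3
  norm_num at h5 h3
  refine ⟨card_orbits_symmetryD5, existsUnique_lamD5_mem_orbit,
    fun β τ hτ => (hasSum_thetaTermD5 β hτ).summable,
    fun β γ τ hτ h => thetaD5_eq_of_mem_orbit hτ h, fun a b d had hb τ hτ => ⟨?_, ?_⟩, ?_, h5, h3⟩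
  · have hd : (d : ℂ) ≠ 0 := Nat.cast_ne_zero.mpr (by omega)
    have ha : (4 / d : ℂ) = a := by
      rw [div_eq_iff hd]
      exact_mod_cast had.symm
    rw [etaQuotient, ha]
  · exact hcube a b d had hb hτ
  -- Both -1/τ and τ lie in the upper half-plane, so each cubic form may be replaced by the cube of
  -- its eta quotient.
  · intro τ hτ
    have hS := neg_one_div_im_pos hτ
    have h := h5 τ hτ
    beta_reduce at h
    rwa [hcube 4 0 1 rfl (by norm_num) hS, hcube 1 0 4 rfl (by norm_num) hτ,
      hcube 2 0 2 rfl (by norm_num) hS, hcube 2 0 2 rfl (by norm_num) hτ,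
      hcube 2 1 2 rfl (by norm_num) hS, hcube 1 2 4 rfl (by norm_num) hτ,
      hcube 1 1 4 rfl (by norm_num) hS, hcube 1 3 4 rfl (by norm_num) hτ] at h
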